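/- Let $n\ge 2$. Let $M$ be a Kähler manifold of real dimension $2n$ with flat Riemannian metric $\langle\cdot,\cdot\rangle$, complex structure $J$ and symplectic form $\omega(X,Y)=\langle JX,Y\rangle$, together with parallel bundle maps $\pi_1,\pi_2:TM\to TM$ which are fibrewise orthogonal projections, satisfy $\pi_1+\pi_2=\mathrm{id}$, and whose kernels are Lagrangian subspaces. Let $S(X,Y)=\langle J\pi_1X,\pi_2Y\rangle$. Let $L$ be an $n$-dimensional manifold, $0<T\le\infty$, and let $F:L\times[0,T)\to M$ be a smooth graphical Lagrangian mean curvature flow: each $F_t=F(\cdot,t)$ is a Lagrangian immersion, $\partial_tF$ is the mean curvature vector of $F_t$, and $\pi_1\circ dF_t$ is injective on every $T_pL$. At each $(p,t)$ there are an orthonormal basis $\{a_i\}$ of $\pi_1(T_{F(p,t)}M)$ and $\lambda_1,\dots,\lambda_n\in\mathbb R$ such that the vectors $e_i=(a_i+\lambda_iJa_i)/\sqrt{1+\lambda_i^2}$ form an orthonormal basis of $dF_t(T_pL)$; call this an adapted frame. A graphical Lagrangian immersion is two-convex if $\lambda_i+\lambda_j>0$ and $1+\lambda_i\lambda_j>0$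 for all $i\ne j$ at every point. Write $h_{ijk}=\langle\overline\nabla_{e_i}e_j,Je_k\rangle$, where $\overline\nabla$ is the Levi-Civita connection of $M$, and $|A|^2=\sum_{i,j,k}h_{ijk}^2$. With respect to an orthonormal frame of $L$, and $S_{ij}=S(e_i,e_j)$, let $S^{[2]}$ be the matrix with entries $$S^{[2]}_{(ij)(k\ell)}=S_{ik}\delta_{j\ell}+S_{j\ell}\delta_{ik}-S_{i\ell}\delta_{jk}-S_{jk}\delta_{i\ell}\qquad(i<j,\ k<\ell).$$ (1) Suppose $F_t$ is two-convex for every $t\in[0,T)$. Then $\log\det S^{[2]}$ is a smooth function on $L\times[0,T)$. At every $(p,t)$ and in every adapted frame, $$\log\det S^{[2]}=\log\prod_{i<j}\frac{(\lambda_i+\lambda_j)(1+\lambda_i\lambda_j)}{(1+\lambda_i^2)(1+\lambda_j^2)},$$ and, with $\Delta$ the Laplace-Beltrami operator of the metric induced by $F_t$, $$(\partial_t-\Delta)\log\det S^{[2]}\ \ge\ \sum_{i<j}\sum_k\Big[4h_{kij}^2+\frac{(1+\lambda_i^2)(1+\lambda_j^2)}{(\lambda_i+\lambda_j)^2}(h_{kii}+h_{kjj})^2+\frac{(1+\lambda_i^2)(1+\lambda_j^2)}{(1+\lambda_i\lambda_j)^2}(h_{kii}-h_{kjj})^2\Big]\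 \ge\ 2|A|^2\ \ge\ 0.$$ (2) Suppose $L$ is compact and $F_{t_0}$ is two-convex for some $t_0\in[0,T)$. Then $F_t$ is two-convex for every $t\in[t_0,T)$, and (if $L$ is nonempty) the minimum of $\log\det S^{[2]}$ over $L$ at time $t$ exists and is a non-decreasing function of $t\in[t_0,T)$. -/

import Mathlib

open scoped Manifold ContDiff

noncomputable section

/-- The model space `ℝᵐ` with its Euclidean norm. -/
abbrev Euc (m : ℕ) : Type := EuclideanSpace ℝ (Fin m)

/-- The tangent space of an `m`-dimensional manifold at `p`. -/
abbrev Tan (m : ℕ) {X : Type*} [TopologicalSpace X] [ChartedSpace (Euc m) X] (p : X) : Type :=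
  TangentSpace (𝓡 m) p

/-- Smooth Riemannian metrics on an `m`-dimensional manifold. -/
abbrev SmoothMetric (m : ℕ) (X : Type*) [TopologicalSpace X] [ChartedSpace (Euc m) X]
    [IsManifold (𝓡 m) ∞ X] : Type _ :=
  Bundle.ContMDiffRiemannianMetric (𝓡 m) ∞ (Euc m) (fun p : X => Tan m p)

section Flat

variable {m : ℕ} {X : Type*} [TopologicalSpace X] [ChartedSpace (Euc m) X]

/-- The differential of a chart, as a map into the model space. -/
def chartD (φ : OpenPartialHomeomorph X (Euc m)) (p : X) (v : Tan m p) : Euc m :=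
  mfderiv (𝓡 m) 𝓘(ℝ, Euc m) φ p v

/-- The differential of the inverse of a chart, at a point of the model space. -/
def chartSymmD (φ : OpenPartialHomeomorph X (Euc m)) (y : Euc m) (w : Euc m) :
    Tan m (φ.symm y) :=
  mfderiv 𝓘(ℝ, Euc m) (𝓡 m) φ.symm y w

/-- `φ` is a smooth chart around `p`. -/
def IsChartAround (φ : OpenPartialHomeomorph X (Euc m)) (p : X) : Prop :=
  φ ∈ IsManifold.maximalAtlas (𝓡 m) ∞ X ∧ p ∈ φ.source

variable [IsManifold (𝓡 m) ∞ X]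

/-- A flat chart of a Riemannian manifold: a smooth chart that is an isometry onto an open subset
of Euclidean space. In such a chart the Christoffel symbols vanish, so the Levi-Civita connection
is the ordinary derivative. -/
def IsFlatChart (g : SmoothMetric m X) (ψ : OpenPartialHomeomorph X (Euc m)) : Prop :=
  ψ ∈ IsManifold.maximalAtlas (𝓡 m) ∞ X ∧
    ∀ p ∈ ψ.source, ∀ v w : Tan m p, inner ℝ (chartD ψ p v) (chartD ψ p w) = g.inner p v w

/-- A flat metric: locally isometric to Euclidean space. -/
def IsFlatMetric (g : SmoothMetric m X) : Prop :=
  ∀ p : X, ∃ ψ : OpenPartialHomeomorph X (Euc m), IsFlatChart g ψ ∧ p ∈ ψ.source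

/-- A bundle map `A : TX → TX` of a flat Riemannian manifold is parallel: in flat charts, where
covariant differentiation is ordinary differentiation, the derivative of (the matrix of) `A`
vanishes. -/
def IsParallel (g : SmoothMetric m X) (A : ∀ p : X, Tan m p →ₗ[ℝ] Tan m p) : Prop :=
  ∀ ψ : OpenPartialHomeomorph X (Euc m), IsFlatChart g ψ → ∀ y ∈ ψ.target, ∀ w : Euc m,
    HasFDerivAt (fun z : Euc m => chartD ψ (ψ.symm z) (A (ψ.symm z) (chartSymmD ψ z w)))
      (0 : Euc m →L[ℝ] Euc m) y

end Flat

/-- A Kähler manifold of real dimension `2n` with flat metric `g` and complex structure `J`,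
together with parallel complementary orthogonal projections `π₁`, `π₂` of its tangent bundle whose
kernels are Lagrangian subspaces for `ω(v, w) = g(J v, w)`. -/
structure FlatKahlerSplitting (n : ℕ) (M : Type*) [TopologicalSpace M]
    [ChartedSpace (Euc (2 * n)) M] [IsManifold (𝓡 (2 * n)) ∞ M] where
  g : SmoothMetric (2 * n) M
  flat : IsFlatMetric g
  J : ∀ p : M, Tan (2 * n) p →ₗ[ℝ] Tan (2 * n) p
  J_sq : ∀ (p : M) (v : Tan (2 * n) p), J p (J p v) = -v
  J_isometry : ∀ (p : M) (v w : Tan (2 * n) p), g.inner p (J p v) (J p w) = g.inner p v w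
  J_parallel : IsParallel g J
  π₁ : ∀ p : M, Tan (2 * n) p →ₗ[ℝ] Tan (2 * n) p
  π₂ : ∀ p : M, Tan (2 * n) p →ₗ[ℝ] Tan (2 * n) p
  π₁_parallel : IsParallel g π₁
  π₂_parallel : IsParallel g π₂
  π₁_idem : ∀ (p : M) (v : Tan (2 * n) p), π₁ p (π₁ p v) = π₁ p v
  π₂_idem : ∀ (p : M) (v : Tan (2 * n) p), π₂ p (π₂ p v) = π₂ p v
  π₁_symm : ∀ (p : M) (v w : Tan (2 * n) p), g.inner p (π₁ p v) w = g.inner p v (π₁ p w)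
  π₂_symm : ∀ (p : M) (v w : Tan (2 * n) p), g.inner p (π₂ p v) w = g.inner p v (π₂ p w)
  π_add : ∀ (p : M) (v : Tan (2 * n) p), π₁ p v + π₂ p v = v
  finrank_ker_π₁ : ∀ p : M, Module.finrank ℝ (LinearMap.ker (π₁ p)) = n
  finrank_ker_π₂ : ∀ p : M, Module.finrank ℝ (LinearMap.ker (π₂ p)) = n
  ω_ker_π₁ : ∀ (p : M), ∀ v ∈ LinearMap.ker (π₁ p), ∀ w ∈ LinearMap.ker (π₁ p),
    g.inner p (J p v) w = 0
  ω_ker_π₂ : ∀ (p : M), ∀ v ∈ LinearMap.ker (π₂ p), ∀ w ∈ LinearMap.ker (π₂ p),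
    g.inner p (J p v) w = 0

/-- For a symmetric matrix `S`, the matrix
`S^{[2]}_{(ij)(kl)} = S_{ik} δ_{jl} + S_{jl} δ_{ik} - S_{il} δ_{jk} - S_{jk} δ_{il}`
with rows and columns indexed by the pairs `i < j`. -/
def secondCompound {n : ℕ} (S : Matrix (Fin n) (Fin n) ℝ) :
    Matrix {q : Fin n × Fin n // q.1 < q.2} {q : Fin n × Fin n // q.1 < q.2} ℝ :=
  let δ : Matrix (Fin n) (Fin n) ℝ := 1
  Matrix.of fun a b =>
    S a.1.1 b.1.1 * δ a.1.2 b.1.2 + S a.1.2 b.1.2 * δ a.1.1 b.1.1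
      - S a.1.1 b.1.2 * δ a.1.2 b.1.1 - S a.1.2 b.1.1 * δ a.1.1 b.1.2

section Submanifold

variable {n : ℕ} {M L : Type*} [TopologicalSpace M] [ChartedSpace (Euc (2 * n)) M]
  [IsManifold (𝓡 (2 * n)) ∞ M] [TopologicalSpace L] [ChartedSpace (Euc n) L]

/-- The differential `df_p : T_pL → T_{f(p)}M`. -/
def tangentD (f : L → M) (p : L) : Tan n p →L[ℝ] Tan (2 * n) (f p) :=
  mfderiv (𝓡 n) (𝓡 (2 * n)) f p

/-- The symplectic form `ω(v, w) = ⟨J v, w⟩`. -/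
def FlatKahlerSplitting.ω (K : FlatKahlerSplitting n M) (x : M) (v w : Tan (2 * n) x) : ℝ :=
  K.g.inner x (K.J x v) w

/-- The tensor `S(v, w) = ⟨J π₁ v, π₂ w⟩`. -/
def FlatKahlerSplitting.S (K : FlatKahlerSplitting n M) (x : M) (v w : Tan (2 * n) x) : ℝ :=
  K.g.inner x (K.J x (K.π₁ x v)) (K.π₂ x w)

/-- An orthonormal basis of `T_pL` for the metric induced by `f`. -/
def IsOrthonormalFrame (K : FlatKahlerSplitting n M) (f : L → M) (p : L) (e : Fin n → Tan n p) :
    Prop :=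
  ∀ i j, K.g.inner (f p) (tangentD f p (e i)) (tangentD f p (e j)) = if i = j then 1 else 0

/-- The matrix of the restriction of `S` to `L` in a frame. -/
def matrixS (K : FlatKahlerSplitting n M) (f : L → M) (p : L) (e : Fin n → Tan n p) :
    Matrix (Fin n) (Fin n) ℝ :=
  Matrix.of fun i j => K.S (f p) (tangentD f p (e i)) (tangentD f p (e j))

open Classical in
/-- `log det S^{[2]}` at `p`, computed in an orthonormal frame of `T_pL` (the value does not depend
on the frame, and is `0` by convention where the immersion `f` degenerates). -/
def logDetS2 (K : FlatKahlerSplitting n M) (f : L → M) (p : L) : ℝ :=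
  if h : ∃ e : Fin n → Tan n p, IsOrthonormalFrame K f p e then
    Real.log (secondCompound (matrixS K f p h.choose)).det
  else 0

/-- `f` is graphical: `π₁` is injective on the tangent spaces of `L`. -/
def IsGraphical (K : FlatKahlerSplitting n M) (f : L → M) : Prop :=
  ∀ p : L, Function.Injective fun v : Tan n p => K.π₁ (f p) (tangentD f p v)

/-- An adapted frame at `p`: an orthonormal basis `a` of `π₁(T_{f(p)}M)` and real numbers `lam` such
that `e_i = (a_i + λ_i J a_i) / √(1 + λ_i²)` (as tangent vectors of `M`) are tangent to `L`.
The `e_i` then form an orthonormal basis of `T_pL`. -/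
structure IsAdaptedFrame (K : FlatKahlerSplitting n M) (f : L → M) (p : L)
    (e : Fin n → Tan n p) (a : Fin n → Tan (2 * n) (f p)) (lam : Fin n → ℝ) : Prop where
  mem_range : ∀ i, K.π₁ (f p) (a i) = a i
  orthonormal : ∀ i j, K.g.inner (f p) (a i) (a j) = if i = j then 1 else 0
  frame_eq : ∀ i, tangentD f p (e i) =
    (1 / Real.sqrt (1 + lam i ^ 2)) • (a i + lam i • K.J (f p) (a i))

/-- `f` is graphical and two-convex: `λ_i + λ_j > 0` and `1 + λ_i λ_j > 0` for all `i ≠ j`. -/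
def IsTwoConvex (K : FlatKahlerSplitting n M) (f : L → M) : Prop :=
  IsGraphical K f ∧
    ∀ (p : L) (e : Fin n → Tan n p) (a : Fin n → Tan (2 * n) (f p)) (lam : Fin n → ℝ),
      IsAdaptedFrame K f p e a lam →
        ∀ i j, i ≠ j → 0 < lam i + lam j ∧ 0 < 1 + lam i * lam j

/-- The pairing `⟨∇̄_X Y, ν⟩` for tangent vectors `X`, `Y` of `L` at `p` and a normal vector `ν`,
where `∇̄` is the Levi-Civita connection of `M`: in a flat chart `ψ` of `M` it is the Euclidean
product of the second derivative of `ψ ∘ f ∘ φ⁻¹` along `X`, `Y` with `ν`. (`Y` is extended with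
constant coefficients in the chart `φ` of `L`; other extensions, and other charts, change `∇̄_X Y`
only by a tangential vector.) -/
def secondFF (φ : OpenPartialHomeomorph L (Euc n)) (ψ : OpenPartialHomeomorph M (Euc (2 * n)))
    (f : L → M) (p : L) (X Y : Tan n p) (ν : Tan (2 * n) (f p)) : ℝ :=
  inner ℝ
    (fderiv ℝ (fderiv ℝ fun x : Euc n => ψ (f (φ.symm x))) (φ p) (chartD φ p X) (chartD φ p Y))
    (chartD ψ (f p) ν)

/-- `H` is the mean curvature vector of `f` at `p`: it is normal, and
`⟨H, ν⟩ = ∑ i, ⟨∇̄_{e_i} e_i, ν⟩` for normal vectors `ν` and orthonormal frames `e`. -/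
def IsMeanCurvatureVector (K : FlatKahlerSplitting n M) (f : L → M) (p : L)
    (H : Tan (2 * n) (f p)) : Prop :=
  (∀ X : Tan n p, K.g.inner (f p) H (tangentD f p X) = 0) ∧
  ∀ (φ : OpenPartialHomeomorph L (Euc n)) (ψ : OpenPartialHomeomorph M (Euc (2 * n))),
    IsChartAround φ p → IsFlatChart K.g ψ → f p ∈ ψ.source →
    ∀ e : Fin n → Tan n p, IsOrthonormalFrame K f p e →
    ∀ ν : Tan (2 * n) (f p), (∀ X : Tan n p, K.g.inner (f p) ν (tangentD f p X) = 0) →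
      K.g.inner (f p) H ν = ∑ i, secondFF φ ψ f p (e i) (e i) ν

/-- The components `h_{ijk} = ⟨∇̄_{e_i} e_j, J e_k⟩` of the second fundamental form of a Lagrangian
immersion in a frame `e` of `T_pL`. -/
def hComp (K : FlatKahlerSplitting n M) (φ : OpenPartialHomeomorph L (Euc n))
    (ψ : OpenPartialHomeomorph M (Euc (2 * n))) (f : L → M) (p : L) (e : Fin n → Tan n p)
    (i j k : Fin n) : ℝ :=
  secondFF φ ψ f p (e i) (e j) (K.J (f p) (tangentD f p (e k)))

/-- The time interval `[0, T)`, where `T` may be `∞`. -/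
def timeInterval (T : EReal) : Set ℝ := {t | 0 ≤ t ∧ (t : EReal) < T}

/-- `F : [0, T) × L → M` is a smooth mean curvature flow `∂F/∂t = H` of Lagrangian immersions. -/
structure IsLagrangianMCF (K : FlatKahlerSplitting n M) (T : EReal) (F : ℝ → L → M) : Prop where
  smooth : ContMDiffOn (𝓘(ℝ, ℝ).prod (𝓡 n)) (𝓡 (2 * n)) ∞ (fun q : ℝ × L => F q.1 q.2)
    (timeInterval T ×ˢ Set.univ)
  immersion : ∀ t ∈ timeInterval T, ∀ p : L, Function.Injective (tangentD (n := n) (F t) p)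
  lagrangian : ∀ t ∈ timeInterval T, ∀ (p : L) (X Y : Tan n p),
    K.ω (F t p) (tangentD (F t) p X) (tangentD (F t) p Y) = 0
  flow : ∀ t ∈ timeInterval T, ∀ p : L,
    IsMeanCurvatureVector K (F t) p
      (mfderivWithin 𝓘(ℝ, ℝ) (𝓡 (2 * n)) (fun s => F s p) (timeInterval T) t (1 : ℝ))

/-- Partial derivatives on `ℝⁿ`. -/
def pderiv (a : Fin n) (u : Euc n → ℝ) (x : Euc n) : ℝ :=
  fderiv ℝ u x (EuclideanSpace.single a 1)

/-- The coefficients `g_{ab}` of the metric induced by `f`, in the chart `φ` of `L`. -/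
def inducedMetric (K : FlatKahlerSplitting n M) (f : L → M)
    (φ : OpenPartialHomeomorph L (Euc n)) (x : Euc n) : Matrix (Fin n) (Fin n) ℝ :=
  Matrix.of fun a b =>
    K.g.inner (f (φ.symm x)) (tangentD f (φ.symm x) (chartSymmD φ x (EuclideanSpace.single a 1)))
      (tangentD f (φ.symm x) (chartSymmD φ x (EuclideanSpace.single b 1)))

/-- The Christoffel symbols `Γ^c_{ab}` of the induced metric in the chart `φ`. -/
def christoffel (K : FlatKahlerSplitting n M) (f : L → M)
    (φ : OpenPartialHomeomorph L (Euc n)) (c a b : Fin n) (x : Euc n) : ℝ :=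
  (1 / 2) * ∑ d, (inducedMetric K f φ x)⁻¹ c d *
    (pderiv a (fun y => inducedMetric K f φ y b d) x
      + pderiv b (fun y => inducedMetric K f φ y a d) x
      - pderiv d (fun y => inducedMetric K f φ y a b) x)

/-- The Laplace-Beltrami operator of the induced metric, computed in a chart `φ` around `p`:
`Δu = g^{ab} (∂_a ∂_b u - Γ^c_{ab} ∂_c u)`. -/
def laplaceBeltrami (K : FlatKahlerSplitting n M) (f : L → M)
    (φ : OpenPartialHomeomorph L (Euc n)) (u : L → ℝ) (p : L) : ℝ :=
  ∑ a, ∑ b, (inducedMetric K f φ (φ p))⁻¹ a b *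
    (pderiv a (pderiv b fun y => u (φ.symm y)) (φ p)
      - ∑ c, christoffel K f φ c a b (φ p) * pderiv c (fun y => u (φ.symm y)) (φ p))

end Submanifold

end

/-!
The function `log det S^{[2]}` depends on the differential of the immersion only. In a flat chart
of `M`, where the parallel tensors `J`, `π₁`, `π₂` have constant coefficients (`exists_represents`),
it is a fixed function `logPullbackDet S` of the linear map `A = fderiv ℝ f x : ℝⁿ → ℝ²ⁿ`, and this
function does not change when `A` is precomposed with an isomorphism of `ℝⁿ`, because `S^{[2]}` is
the action of `S` on `Λ²` and passing to another basis multiplies numerator and denominator of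
`det (S ∧ G) / det (Λ²G)` by the same factor (`compoundDet_congr`).

For a map into Euclidean space the mean curvature vector is `g^{ab} ∂_a ∂_b f` minus a tangential
term (`velocity_eq`). For any function `Φ` of the differential that is invariant under
reparametrization, the evolution equation at a point therefore has a very simple form: all third
derivatives of `f` and all tangential terms cancel, and `(∂_t - Δ) Φ(df)` is minus the sum over an
orthonormal frame of the Hessian of `Φ` in the direction of the second fundamental form
`A_k = (D²f(e_k, ·))^⊥` (`evolution_of_invariant`). What remains is linear algebra in one adapted
frame, where `S` and the metric are diagonal: for `N e_i = ∑ H_{ij} J e_j` the matrices of `S` and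
of the metric along `A + s N` are quadratic polynomials in `s`, the second derivative of `log det`
is explicit, and dropping terms that have a sign leaves the stated quadratic expression
(`logPullbackDet_hessian_le`). The comparison with `2 |A|²` is an elementary estimate for each pair
of indices, together with the fact that for `n ≥ 2` every index belongs to a pair
(`two_mul_sum_sq_le`). The evolution inequality holds wherever the immersion is two-convex at the
given point and time (`IsLagrangianMCF.evolution_logDetS2`).

For compact `L`, the maximum principle, applied to `log det S^{[2]} + ε t`, shows that the minimum
does not decrease as long as the flow is two-convex (`IsLagrangianMCF.exists_logDetS2_le`).
Two-convexity says that the symmetric form of which the tangent space is the graph has positive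
trace, and determinant larger than `-1`, over every plane. In this form it involves no adapted
frames (`ModelSplitting.IsTwoConvexMap`), and so it is an open condition. A limit of two-convex
tangent spaces satisfies the same inequalities in the weak sense, and `det S^{[2]}`, the product of
all the quantities in question up to positive factors, stays bounded away from zero by the maximum
principle, so that the inequalities are strict. Hence there is no first time at which two-convexity
fails (`IsLagrangianMCF.isTwoConvexAt_of_le`).
-/

noncomputable section

/-! ### Linear algebra of `Λ²ℝⁿ` -/

/-- The pairs `i < j` of indices, which label the standard basis `ε_i ∧ ε_j` of `Λ²ℝⁿ`. -/
abbrev IndexPair (n : ℕ) : Type := {q : Fin n × Fin n // q.1 < q.2}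

section Wedge

variable {n : ℕ}

theorem sum_indexPair {α : Type*} [AddCommMonoid α] (f : Fin n → Fin n → α) :
    ∑ q : IndexPair n, f q.1.1 q.1.2 = ∑ i, ∑ j ∈ Finset.Ioi i, f i j := by
  rw [← Finset.sum_subtype (Finset.univ.filter fun q : Fin n × Fin n => q.1 < q.2) (by simp)
    (fun q => f q.1 q.2), Finset.sum_filter, ← Finset.univ_product_univ, Finset.sum_product]
  refine Finset.sum_congr rfl fun i _ => ?_
  rw [← Finset.sum_filter]
  exact Finset.sum_congr (by ext; simp) fun _ _ => rfl

theorem prod_indexPair (f : Fin n → Fin n → ℝ) :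
    ∏ q : IndexPair n, f q.1.1 q.1.2 = ∏ i, ∏ j ∈ Finset.Ioi i, f i j := by
  rw [← Finset.prod_subtype (Finset.univ.filter fun q : Fin n × Fin n => q.1 < q.2) (by simp)
    (fun q => f q.1 q.2), Finset.prod_filter, ← Finset.univ_product_univ, Finset.prod_product]
  refine Finset.prod_congr rfl fun i _ => ?_
  rw [← Finset.prod_filter]
  exact Finset.prod_congr (by ext; simp) fun _ _ => rfl

/-- A sum over all pairs of indices splits into the diagonal and the pairs `i < j`. -/
theorem sum_sum_eq_diag_add_indexPair (f : Fin n → Fin n → ℝ) :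
    ∑ i, ∑ j, f i j = ∑ i, f i i + ∑ q : IndexPair n, (f q.1.1 q.1.2 + f q.1.2 q.1.1) := by
  rw [Finset.sum_add_distrib, sum_indexPair f, sum_indexPair fun i j => f j i]
  have h1 : ∀ i, ∑ j, f i j = f i i + ∑ j ∈ Finset.Ioi i, f i j + ∑ j ∈ Finset.Iio i, f i j := by
    intro i
    have : (Finset.univ : Finset (Fin n)) = insert i (Finset.Ioi i ∪ Finset.Iio i) := by
      ext j
      simp only [Finset.mem_univ, Finset.mem_insert, Finset.mem_union, Finset.mem_Ioi,
        Finset.mem_Iio, true_iff]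
      rcases lt_trichotomy i j with h | h | h <;> simp [h]
    rw [this, Finset.sum_insert (by simp), Finset.sum_union, add_assoc]
    rw [Finset.disjoint_left]
    intro j hj hj'
    simp only [Finset.mem_Ioi, Finset.mem_Iio] at hj hj'
    omega
  have h2 : ∑ i, ∑ j ∈ Finset.Iio i, f i j = ∑ i, ∑ j ∈ Finset.Ioi i, f j i :=
    Finset.sum_comm' (by simp)
  simp only [h1, Finset.sum_add_distrib, h2]
  ring

/-- The matrix on `Λ²ℝⁿ` of the symmetrized exterior product of two endomorphisms,
`v ∧ w ↦ X v ∧ Y w + Y v ∧ X w`. -/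
def wedge (X Y : Matrix (Fin n) (Fin n) ℝ) : Matrix (IndexPair n) (IndexPair n) ℝ :=
  Matrix.of fun a b => X a.1.1 b.1.1 * Y a.1.2 b.1.2 + X a.1.2 b.1.2 * Y a.1.1 b.1.1
    - X a.1.1 b.1.2 * Y a.1.2 b.1.1 - X a.1.2 b.1.1 * Y a.1.1 b.1.2

/-- The second compound matrix, that is, the matrix on `Λ²ℝⁿ` of `v ∧ w ↦ P v ∧ P w`. -/
def minors (P : Matrix (Fin n) (Fin n) ℝ) : Matrix (IndexPair n) (IndexPair n) ℝ :=
  Matrix.of fun a b => P a.1.1 b.1.1 * P a.1.2 b.1.2 - P a.1.1 b.1.2 * P a.1.2 b.1.1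

theorem secondCompound_eq_wedge (S : Matrix (Fin n) (Fin n) ℝ) :
    secondCompound S = wedge S 1 := rfl

theorem wedge_self (X : Matrix (Fin n) (Fin n) ℝ) : wedge X X = (2 : ℝ) • minors X := by
  ext a b
  simp only [wedge, minors, Matrix.of_apply, Matrix.smul_apply, smul_eq_mul]
  ring

theorem wedge_transpose (X Y : Matrix (Fin n) (Fin n) ℝ) :
    (wedge X Y).transpose = wedge X.transpose Y.transpose := by
  ext a b
  simp only [wedge, Matrix.of_apply, Matrix.transpose_apply]
  ring

theorem minors_transpose (P : Matrix (Fin n) (Fin n) ℝ) :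
    (minors P).transpose = minors P.transpose := by
  ext a b
  simp only [minors, Matrix.of_apply, Matrix.transpose_apply]
  ring

theorem wedge_mul_left (P X Y : Matrix (Fin n) (Fin n) ℝ) :
    wedge (P * X) (P * Y) = minors P * wedge X Y := by
  ext a b
  obtain ⟨⟨i, j⟩, hij⟩ := a
  obtain ⟨⟨r, s⟩, hrs⟩ := b
  set f : Fin n → Fin n → ℝ := fun k l => P i k * P j l *
    (X k r * Y l s + X l s * Y k r - X k s * Y l r - X l r * Y k s) with hf
  have h : ∑ k, ∑ l, f k l = (minors P * wedge X Y) ⟨⟨i, j⟩, hij⟩ ⟨⟨r, s⟩, hrs⟩ := by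
    rw [sum_sum_eq_diag_add_indexPair, Finset.sum_eq_zero (fun k _ => by simp only [hf]; ring),
      zero_add, Matrix.mul_apply]
    refine Finset.sum_congr rfl fun q _ => ?_
    simp only [hf, minors, wedge, Matrix.of_apply]
    ring
  rw [← h]
  simp only [wedge, Matrix.of_apply, Matrix.mul_apply]
  rw [mul_comm (∑ k, P j k * X k s), mul_comm (∑ k, P j k * X k r)]
  simp only [Finset.sum_mul_sum, ← Finset.sum_add_distrib, ← Finset.sum_sub_distrib, hf]
  exact Finset.sum_congr rfl fun k _ => Finset.sum_congr rfl fun l _ => by ring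

theorem wedge_mul_right (X Y Q : Matrix (Fin n) (Fin n) ℝ) :
    wedge (X * Q) (Y * Q) = wedge X Y * minors Q := by
  apply Matrix.transpose_injective
  rw [wedge_transpose, Matrix.transpose_mul, Matrix.transpose_mul, wedge_mul_left,
    Matrix.transpose_mul, wedge_transpose, minors_transpose]

theorem minors_one : minors (1 : Matrix (Fin n) (Fin n) ℝ) = 1 := by
  ext ⟨⟨i, j⟩, hij⟩ ⟨⟨k, l⟩, hkl⟩
  simp only [minors, Matrix.of_apply, Matrix.one_apply, Subtype.mk.injEq, Prod.mk.injEq]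
  simp only at hij hkl
  by_cases h1 : i = k <;> by_cases h2 : j = l <;> by_cases h3 : i = l <;> by_cases h4 : j = k <;>
    simp [h1, h2, h3, h4] <;> omega

theorem minors_mul (P Q : Matrix (Fin n) (Fin n) ℝ) : minors (P * Q) = minors P * minors Q := by
  have h := wedge_mul_left P Q Q
  rw [wedge_self, wedge_self, Matrix.mul_smul] at h
  exact smul_right_injective _ (two_ne_zero (α := ℝ)) h

theorem det_minors_ne_zero {P : Matrix (Fin n) (Fin n) ℝ} (hP : IsUnit P.det) :
    (minors P).det ≠ 0 := by
  have h : (minors P).det * (minors P⁻¹).det = 1 := by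
    rw [← Matrix.det_mul, ← minors_mul, Matrix.mul_nonsing_inv _ hP, minors_one, Matrix.det_one]
  exact left_ne_zero_of_mul_eq_one h

/-- For a bilinear form with matrix `S` and a scalar product with matrix `G` in the same basis, the
determinant of `S^{[2]}` computed in a basis that is orthonormal for the scalar product. -/
def compoundDet (S G : Matrix (Fin n) (Fin n) ℝ) : ℝ := (wedge S G).det / (minors G).det

theorem compoundDet_one (S : Matrix (Fin n) (Fin n) ℝ) :
    compoundDet S 1 = (secondCompound S).det := by
  rw [compoundDet, minors_one, Matrix.det_one, div_one, secondCompound_eq_wedge]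

theorem compoundDet_congr (S G : Matrix (Fin n) (Fin n) ℝ) {P : Matrix (Fin n) (Fin n) ℝ}
    (hP : IsUnit P.det) :
    compoundDet (P.transpose * S * P) (P.transpose * G * P) = compoundDet S G := by
  have h0 := det_minors_ne_zero hP
  rw [compoundDet, compoundDet, wedge_mul_right, wedge_mul_left, minors_mul, minors_mul,
    ← minors_transpose]
  simp only [Matrix.det_mul, Matrix.det_transpose]
  rw [mul_right_comm, mul_right_comm _ (minors G).det, mul_div_mul_left _ _ (mul_ne_zero h0 h0)]

theorem secondCompound_diagonal (s : Fin n → ℝ) :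
    secondCompound (Matrix.diagonal s) =
      Matrix.diagonal fun q : IndexPair n => s q.1.1 + s q.1.2 := by
  ext ⟨⟨i, j⟩, hij⟩ ⟨⟨k, l⟩, hkl⟩
  simp only [secondCompound, Matrix.of_apply, Matrix.one_apply, Matrix.diagonal_apply,
    Subtype.mk.injEq, Prod.mk.injEq]
  simp only at hij hkl
  by_cases h1 : i = k <;> by_cases h2 : j = l <;> by_cases h3 : i = l <;> by_cases h4 : j = k <;>
    simp [h1, h2, h3, h4, hkl.ne, hkl.ne'] ; omega

theorem det_secondCompound_diagonal (s : Fin n → ℝ) :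
    (secondCompound (Matrix.diagonal s)).det = ∏ i, ∏ j ∈ Finset.Ioi i, (s i + s j) := by
  rw [secondCompound_diagonal, Matrix.det_diagonal, prod_indexPair fun i j => s i + s j]

end Wedge

/-! ### Derivatives of determinants and inverse matrices -/

section DetDeriv

open Filter Topology

variable {ι : Type*} [Fintype ι] [DecidableEq ι]
  {E : Type*} [NormedAddCommGroup E] [NormedSpace ℝ E]

theorem ContDiffWithinAt.matrix_det {k : WithTop ℕ∞} {M : E → Matrix ι ι ℝ} {s : Set E} {x : E}
    (hM : ∀ i j, ContDiffWithinAt ℝ k (fun y => M y i j) s x) :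
    ContDiffWithinAt ℝ k (fun y => (M y).det) s x := by
  simp only [Matrix.det_apply']
  exact ContDiffWithinAt.sum fun σ _ => contDiffWithinAt_const.mul
    (contDiffWithinAt_prod fun i _ => hM _ _)

theorem ContDiffWithinAt.matrix_inv {k : WithTop ℕ∞} {M : E → Matrix ι ι ℝ} {s : Set E} {x : E}
    (hM : ∀ i j, ContDiffWithinAt ℝ k (fun y => M y i j) s x) (h0 : (M x).det ≠ 0) (i j : ι) :
    ContDiffWithinAt ℝ k (fun y => (M y)⁻¹ i j) s x := by
  simp only [Matrix.inv_def, Ring.inverse_eq_inv', Matrix.smul_apply, smul_eq_mul,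
    Matrix.adjugate_apply]
  refine ((ContDiffWithinAt.matrix_det hM).inv h0).mul (ContDiffWithinAt.matrix_det fun a b => ?_)
  simp only [Matrix.updateRow_apply]
  split_ifs
  · exact contDiffWithinAt_const
  · exact hM a b

/-- Jacobi's formula. -/
theorem hasDerivAt_matrix_det {M : ℝ → Matrix ι ι ℝ} {M' : Matrix ι ι ℝ} {s : ℝ}
    (hM : ∀ i j, HasDerivAt (fun r => M r i j) (M' i j) s) :
    HasDerivAt (fun r => (M r).det) ((M s).adjugate * M').trace s := by
  have key : ((M s).adjugate * M').trace = ∑ σ : Equiv.Perm ι, ((Equiv.Perm.sign σ : ℤ) : ℝ) *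
      ∑ i, (∏ j ∈ Finset.univ.erase i, M s (σ j) j) • M' (σ i) i := by
    have h1 : ∀ i, ((M s).adjugate * M') i i = ((M s).updateCol i fun j => M' j i).det := by
      intro i
      rw [← Matrix.cramer_apply, Matrix.cramer_eq_adjugate_mulVec]
      rfl
    simp only [Matrix.trace, Matrix.diag, h1, Matrix.det_apply', Finset.mul_sum]
    rw [Finset.sum_comm]
    refine Finset.sum_congr rfl fun σ _ => Finset.sum_congr rfl fun i _ => ?_
    congr 1
    rw [← Finset.mul_prod_erase _ _ (Finset.mem_univ i), Matrix.updateCol_self, smul_eq_mul,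
      mul_comm]
    congr 1
    exact Finset.prod_congr rfl fun j hj => by rw [Matrix.updateCol_ne (Finset.ne_of_mem_erase hj)]
  rw [key]
  simp only [Matrix.det_apply']
  exact HasDerivAt.fun_sum fun σ _ => (HasDerivAt.fun_finsetProd fun i _ => hM _ _).const_mul _

theorem hasFDerivAt_matrix_inv {M : E → Matrix ι ι ℝ} {M' : ι → ι → E →L[ℝ] ℝ} {x : E}
    (hM : ∀ i j, HasFDerivAt (fun y => M y i j) (M' i j) x)
    (hC : ∀ i j, DifferentiableAt ℝ (fun y => (M y)⁻¹ i j) x)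
    (h0 : ∀ᶠ y in 𝓝 x, (M y).det ≠ 0) (i j : ι) :
    HasFDerivAt (fun y => (M y)⁻¹ i j)
      (-∑ k, ∑ l, ((M x)⁻¹ i k * (M x)⁻¹ l j) • M' k l) x := by
  choose N' hN' using hC
  -- Differentiate `M⁻¹ * M = 1`.
  have h1 : ∀ i l, ∑ k, ((M x)⁻¹ i k • M' k l + M x k l • N' i k) = 0 := by
    intro i l
    have h2 : HasFDerivAt (fun y => ∑ k, (M y)⁻¹ i k * M y k l)
        (∑ k, ((M x)⁻¹ i k • M' k l + M x k l • N' i k)) x :=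
      HasFDerivAt.fun_sum fun k _ => (hN' i k).mul (hM k l)
    refine h2.unique ((hasFDerivAt_const ((1 : Matrix ι ι ℝ) i l) x).congr_of_eventuallyEq ?_)
    filter_upwards [h0] with y hy
    rw [← Matrix.mul_apply, Matrix.nonsing_inv_mul _ (isUnit_iff_ne_zero.2 hy)]
  have h3 : N' i j = -∑ k, ∑ l, ((M x)⁻¹ i k * (M x)⁻¹ l j) • M' k l := by
    have h4 : ∀ l, ∑ k, M x k l • N' i k = -∑ k, (M x)⁻¹ i k • M' k l := fun l => by
      rw [eq_neg_iff_add_eq_zero, add_comm, ← Finset.sum_add_distrib, h1]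
    have h5 : ∑ l, (M x)⁻¹ l j • ∑ k, M x k l • N' i k = N' i j := by
      have : ∀ k, ∑ l, M x k l * (M x)⁻¹ l j = (1 : Matrix ι ι ℝ) k j := fun k => by
        rw [← Matrix.mul_apply, Matrix.mul_nonsing_inv _ (isUnit_iff_ne_zero.2 h0.self_of_nhds)]
      simp only [Finset.smul_sum, smul_smul]
      rw [Finset.sum_comm]
      simp only [mul_comm ((M x)⁻¹ _ j), ← Finset.sum_smul, this, Matrix.one_apply, ite_smul,
        one_smul, zero_smul, Finset.sum_ite_eq', Finset.mem_univ, if_true]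
    rw [← h5, Finset.sum_comm, ← Finset.sum_neg_distrib]
    refine Finset.sum_congr rfl fun l _ => ?_
    rw [h4, smul_neg, Finset.smul_sum]
    congr 1
    exact Finset.sum_congr rfl fun k _ => by rw [smul_smul, mul_comm]
  rw [← h3]
  exact hN' i j

theorem hasDerivAt_log_det {M : ℝ → Matrix ι ι ℝ} {M' : Matrix ι ι ℝ} {s : ℝ}
    (hM : ∀ i j, HasDerivAt (fun r => M r i j) (M' i j) s) (h0 : (M s).det ≠ 0) :
    HasDerivAt (fun r => Real.log (M r).det) ((M s)⁻¹ * M').trace s := by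
  have h := (hasDerivAt_matrix_det hM).log h0
  convert h using 1
  rw [Matrix.inv_def, Ring.inverse_eq_inv', Matrix.smul_mul, Matrix.trace_smul, smul_eq_mul,
    div_eq_inv_mul]

/-- The second derivative of `log det M` at a point where `M` is diagonal. -/
theorem hasDerivAt_trace_inv_mul {M M' : ℝ → Matrix ι ι ℝ} {M'' : Matrix ι ι ℝ} {d : ι → ℝ}
    {s : ℝ} (hM : ∀ i j, ContDiffAt ℝ 1 (fun r => M r i j) s)
    (hM' : ∀ i j, HasDerivAt (fun r => M r i j) (M' s i j) s)
    (hM'' : ∀ i j, HasDerivAt (fun r => M' r i j) (M'' i j) s)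
    (hd : M s = Matrix.diagonal d) (h0 : ∀ i, d i ≠ 0) :
    HasDerivAt (fun r => ((M r)⁻¹ * M' r).trace)
      (∑ i, M'' i i / d i - ∑ i, ∑ j, M' s i j * M' s j i / (d i * d j)) s := by
  have hdet : (M s).det ≠ 0 := by
    rw [hd, Matrix.det_diagonal]
    exact Finset.prod_ne_zero_iff.2 fun i _ => h0 i
  have hinv : (M s)⁻¹ = Matrix.diagonal fun i => (d i)⁻¹ := by
    refine Matrix.inv_eq_right_inv ?_
    rw [hd, Matrix.diagonal_mul_diagonal, ← Matrix.diagonal_one]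
    congr 1
    funext i
    exact mul_inv_cancel₀ (h0 i)
  have hI : ∀ i j, ContDiffAt ℝ 1 (fun r => (M r)⁻¹ i j) s := fun i j => by
    have := ContDiffWithinAt.matrix_inv (fun i j => (hM i j).contDiffWithinAt (s := Set.univ))
      hdet i j
    rwa [contDiffWithinAt_univ] at this
  have hD : ContDiffAt ℝ 1 (fun r => (M r).det) s := by
    have := ContDiffWithinAt.matrix_det (fun i j => (hM i j).contDiffWithinAt (s := Set.univ))
    rwa [contDiffWithinAt_univ] at this
  have h1 := fun i j => (hasFDerivAt_matrix_inv (fun i j => (hM' i j).hasFDerivAt)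
    (fun i j => (hI i j).differentiableAt one_ne_zero)
    (hD.continuousAt.eventually_ne hdet) i j).hasDerivAt
  have h2 : HasDerivAt (fun r => ∑ i, ∑ j, (M r)⁻¹ i j * M' r j i) _ s :=
    HasDerivAt.fun_sum fun i _ => HasDerivAt.fun_sum fun j _ => (h1 i j).mul (hM'' j i)
  refine h2.congr_deriv ?_
  simp only [hinv, Matrix.diagonal_apply, neg_apply,
    sum_apply, smul_apply,
    ContinuousLinearMap.toSpanSingleton_apply, smul_eq_mul, one_mul, ite_mul, zero_mul, mul_ite,
    mul_zero, Finset.sum_add_distrib, Finset.sum_ite_eq, Finset.sum_ite_eq', Finset.mem_univ,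
    if_true, neg_mul, Finset.sum_neg_distrib]
  rw [neg_add_eq_sub]
  congr 1
  · exact Finset.sum_congr rfl fun i _ => (div_eq_inv_mul _ _).symm
  · refine Finset.sum_congr rfl fun i _ => Finset.sum_congr rfl fun j _ => ?_
    have := h0 i
    have := h0 j
    field_simp

end DetDeriv

/-! ### Bilinear forms pulled back by a linear map -/

section Frames

open Filter Topology

variable {n : ℕ} {V : Type*} [NormedAddCommGroup V] [InnerProductSpace ℝ V]

/-- The standard basis of `ℝⁿ`. -/
abbrev stdFrame (n : ℕ) : Fin n → Euc n := fun a => EuclideanSpace.single a 1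

/-- The matrix, in the frame `e` of `ℝⁿ`, of the pullback of the bilinear form `b` under `A`. -/
def frameMat (b : V →L[ℝ] V →L[ℝ] ℝ) (A : Euc n →L[ℝ] V) (e : Fin n → Euc n) :
    Matrix (Fin n) (Fin n) ℝ :=
  Matrix.of fun i j => b (A (e i)) (A (e j))

/-- The matrix whose columns are the vectors of a frame. -/
def frameCols (e : Fin n → Euc n) : Matrix (Fin n) (Fin n) ℝ := Matrix.of fun a i => e i a

theorem euc_eq_sum (x : Euc n) : x = ∑ a, x a • stdFrame n a := by
  ext b
  simp [stdFrame, Pi.single_apply]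

theorem bilin_eq_sum {W : Type*} [AddCommGroup W] [Module ℝ W] (B : Euc n →ₗ[ℝ] Euc n →ₗ[ℝ] W)
    (x y : Euc n) : B x y = ∑ a, ∑ b, (x a * y b) • B (stdFrame n a) (stdFrame n b) := by
  conv_lhs => rw [euc_eq_sum x, euc_eq_sum y]
  simp only [map_sum, map_smul, LinearMap.sum_apply, LinearMap.smul_apply, Finset.smul_sum,
    smul_smul]
  rw [Finset.sum_comm]
  simp only [mul_comm]

theorem frameMat_eq (b : V →L[ℝ] V →L[ℝ] ℝ) (A : Euc n →L[ℝ] V) (e : Fin n → Euc n) :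
    frameMat b A e =
      (frameCols e).transpose * frameMat b A (stdFrame n) * frameCols e := by
  ext i j
  have h := bilin_eq_sum (LinearMap.mk₂ ℝ (fun x y => b (A x) (A y)) (by simp) (by simp) (by simp)
    (by simp)) (e i) (e j)
  simp only [LinearMap.mk₂_apply, smul_eq_mul] at h
  simp only [frameMat, Matrix.of_apply, h, Matrix.mul_apply, Matrix.transpose_apply, frameCols,
    Finset.sum_mul]
  rw [Finset.sum_comm]
  exact Finset.sum_congr rfl fun _ _ => Finset.sum_congr rfl fun _ _ => by ring

/-- `det S^{[2]}` for the pullback of the bilinear form `S` under `A`, as a rational function of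
the matrix of `A`. -/
def pullbackDet (S : V →L[ℝ] V →L[ℝ] ℝ) (A : Euc n →L[ℝ] V) : ℝ :=
  compoundDet (frameMat S A (stdFrame n)) (frameMat (innerSL ℝ) A (stdFrame n))

/-- `log det S^{[2]}` as a function of the differential of an immersion. -/
def logPullbackDet (S : V →L[ℝ] V →L[ℝ] ℝ) (A : Euc n →L[ℝ] V) : ℝ := Real.log (pullbackDet S A)

theorem compoundDet_frameMat (S : V →L[ℝ] V →L[ℝ] ℝ) (A : Euc n →L[ℝ] V) {e : Fin n → Euc n}
    (he : IsUnit (frameCols e).det) :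
    compoundDet (frameMat S A e) (frameMat (innerSL ℝ) A e) = pullbackDet S A := by
  rw [frameMat_eq S, frameMat_eq (innerSL ℝ), compoundDet_congr _ _ he, pullbackDet]

section Orthonormal

variable {A : Euc n →L[ℝ] V} {e : Fin n → Euc n}

theorem isUnit_det_frameCols (he : frameMat (innerSL ℝ) A e = 1) :
    IsUnit (frameCols e).det := by
  rw [frameMat_eq] at he
  have := congrArg Matrix.det he
  rw [Matrix.det_mul, Matrix.det_one] at this
  exact IsUnit.of_mul_eq_one_right _ this

theorem isUnit_det_gram (he : frameMat (innerSL ℝ) A e = 1) :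
    IsUnit (frameMat (innerSL ℝ) A (stdFrame n)).det := by
  rw [frameMat_eq] at he
  have := congrArg Matrix.det he
  rw [Matrix.det_mul, Matrix.det_mul, Matrix.det_one] at this
  exact isUnit_of_mul_isUnit_right (isUnit_of_mul_isUnit_left (this ▸ isUnit_one))

/-- The inverse of the metric in terms of an orthonormal frame: `g^{ab} = ∑ᵢ eᵢᵃ eᵢᵇ`. -/
theorem gram_inv_apply (he : frameMat (innerSL ℝ) A e = 1) (a b : Fin n) :
    (frameMat (innerSL ℝ) A (stdFrame n))⁻¹ a b = ∑ i, e i a * e i b := by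
  have hP := isUnit_det_frameCols he
  rw [frameMat_eq] at he
  have h1 : frameCols e * ((frameCols e).transpose * frameMat (innerSL ℝ) A (stdFrame n)) = 1 :=
    mul_eq_one_comm.1 he
  rw [← mul_assoc] at h1
  rw [Matrix.inv_eq_left_inv h1, Matrix.mul_apply]
  rfl

theorem pullbackDet_eq (S : V →L[ℝ] V →L[ℝ] ℝ) (he : frameMat (innerSL ℝ) A e = 1) :
    pullbackDet S A = (secondCompound (frameMat S A e)).det := by
  rw [← compoundDet_frameMat S A (isUnit_det_frameCols he), he, compoundDet_one]

theorem sum_gram_inv_smul {W : Type*} [AddCommGroup W] [Module ℝ W]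
    (he : frameMat (innerSL ℝ) A e = 1) (B : Euc n →ₗ[ℝ] Euc n →ₗ[ℝ] W) :
    ∑ a, ∑ b, (frameMat (innerSL ℝ) A (stdFrame n))⁻¹ a b • B (stdFrame n a) (stdFrame n b) =
      ∑ i, B (e i) (e i) := by
  simp only [gram_inv_apply he, bilin_eq_sum B (e _) (e _), Finset.sum_smul]
  conv_rhs => rw [Finset.sum_comm]
  refine Finset.sum_congr rfl fun a _ => ?_
  rw [Finset.sum_comm]

end Orthonormal

theorem contDiff_frameMat (b : V →L[ℝ] V →L[ℝ] ℝ) (e : Fin n → Euc n) (i j : Fin n) :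
    ContDiff ℝ ∞ fun A : Euc n →L[ℝ] V => frameMat b A e i j := by
  simp only [frameMat, Matrix.of_apply]
  fun_prop

theorem contDiffAt_pullbackDet (S : V →L[ℝ] V →L[ℝ] ℝ) {A : Euc n →L[ℝ] V}
    (hA : IsUnit (frameMat (innerSL ℝ) A (stdFrame n)).det) :
    ContDiffAt ℝ ∞ (pullbackDet S) A := by
  have h := fun b i j =>
    (contDiff_frameMat (V := V) b (stdFrame n) i j).contDiffAt (x := A).contDiffWithinAt
      (s := Set.univ)
  rw [← contDiffWithinAt_univ]
  refine (ContDiffWithinAt.matrix_det fun a b => ?_).div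
    (ContDiffWithinAt.matrix_det fun a b => ?_) (det_minors_ne_zero hA)
  · simp only [wedge, Matrix.of_apply]
    exact (((((h _ _ _).mul (h _ _ _)).add ((h _ _ _).mul (h _ _ _))).sub
      ((h _ _ _).mul (h _ _ _)))).sub ((h _ _ _).mul (h _ _ _))
  · simp only [minors, Matrix.of_apply]
    exact ((h _ _ _).mul (h _ _ _)).sub ((h _ _ _).mul (h _ _ _))

theorem contDiffAt_logPullbackDet (S : V →L[ℝ] V →L[ℝ] ℝ) {A : Euc n →L[ℝ] V}
    (hA : IsUnit (frameMat (innerSL ℝ) A (stdFrame n)).det) (h0 : pullbackDet S A ≠ 0) :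
    ContDiffAt ℝ ∞ (logPullbackDet S) A :=
  (contDiffAt_pullbackDet S hA).log h0

/-- `det S^{[2]}` does not depend on the choice of coordinates: to first order, it does not change
when `A` is precomposed with a linear map. -/
theorem fderiv_logPullbackDet_comp (S : V →L[ℝ] V →L[ℝ] ℝ) {A : Euc n →L[ℝ] V}
    (hA : DifferentiableAt ℝ (logPullbackDet S) A) (B : Euc n →L[ℝ] Euc n) :
    fderiv ℝ (logPullbackDet S) A (A.comp B) = 0 := by
  have h1 : HasDerivAt (fun s : ℝ => A + s • A.comp B) (A.comp B) 0 := by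
    simpa using ((hasDerivAt_id (0 : ℝ)).smul_const (A.comp B)).const_add A
  have h2 : HasDerivAt (fun s : ℝ => logPullbackDet S (A + s • A.comp B))
      (fderiv ℝ (logPullbackDet S) A (A.comp B)) 0 := by
    have hA' : HasFDerivAt (logPullbackDet S) (fderiv ℝ (logPullbackDet S) A)
        (A + (0 : ℝ) • A.comp B) := by simpa using hA.hasFDerivAt
    exact hA'.comp_hasDerivAt (0 : ℝ) h1
  refine h2.unique ((hasDerivAt_const (0 : ℝ) (logPullbackDet S A)).congr_of_eventuallyEq ?_)
  set e : ℝ → Fin n → Euc n := fun s i => stdFrame n i + s • B (stdFrame n i) with he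
  have h3 : ContinuousAt (fun s => (frameCols (e s)).det) 0 := by
    refine Continuous.continuousAt ?_
    refine Continuous.matrix_det ?_
    refine continuous_matrix fun a i => ?_
    simp only [he, frameCols, Matrix.of_apply, PiLp.add_apply, PiLp.smul_apply]
    fun_prop
  have h4 : (frameCols (e 0)).det ≠ 0 := by
    have : frameCols (e 0) = 1 := by
      ext a i
      simp [he, frameCols, Matrix.one_apply]
    simp [this]
  filter_upwards [h3.eventually_ne h4] with s hs
  have h5 : ∀ b, frameMat b (A + s • A.comp B) (stdFrame n) = frameMat b A (e s) := fun b => by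
    ext i j
    simp [frameMat, he]
  rw [logPullbackDet, logPullbackDet, pullbackDet, h5, h5,
    compoundDet_frameMat _ _ (isUnit_iff_ne_zero.2 hs)]

end Frames

/-! ### Evolution of invariant functions of the differential -/

section Calculus

open Filter Topology

theorem two_le_infty : (2 : WithTop ℕ∞) ≤ ∞ := ENat.LEInfty.out

theorem ContDiffAt.eventually_differentiableAt {E F : Type*} [NormedAddCommGroup E]
    [NormedSpace ℝ E] [NormedAddCommGroup F] [NormedSpace ℝ F] {f : E → F} {x : E}
    (hf : ContDiffAt ℝ ∞ f x) : ∀ᶠ y in 𝓝 x, DifferentiableAt ℝ f y :=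
  ((hf.of_le two_le_infty).eventually (by decide)).mono fun _ hy => hy.differentiableAt (by simp)

theorem HasFDerivAt.apply_const {E F G : Type*} [NormedAddCommGroup E]
    [NormedSpace ℝ E] [NormedAddCommGroup F] [NormedSpace ℝ F] [NormedAddCommGroup G]
    [NormedSpace ℝ G] {c : E → F →L[ℝ] G} {c' : E →L[ℝ] F →L[ℝ] G} {x : E}
    (h : HasFDerivAt c c' x) (u : F) : HasFDerivAt (fun y => c y u) (c'.flip u) x :=
  (ContinuousLinearMap.apply ℝ G u).hasFDerivAt.comp x h

theorem fderiv_fderiv_comp {E W : Type*} [NormedAddCommGroup E] [NormedSpace ℝ E]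
    [NormedAddCommGroup W] [NormedSpace ℝ W] {Φ : W → ℝ} {A : E → W} {x : E}
    (hΦ : ContDiffAt ℝ ∞ Φ (A x)) (hA : ContDiffAt ℝ ∞ A x) (v w : E) :
    fderiv ℝ (fderiv ℝ fun y => Φ (A y)) x v w =
      fderiv ℝ (fderiv ℝ Φ) (A x) (fderiv ℝ A x v) (fderiv ℝ A x w)
        + fderiv ℝ Φ (A x) (fderiv ℝ (fderiv ℝ A) x v w) := by
  have h1 : fderiv ℝ (fun y => Φ (A y)) =ᶠ[𝓝 x]
      fun y => (fderiv ℝ Φ (A y)).comp (fderiv ℝ A y) := by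
    filter_upwards [hA.continuousAt.eventually hΦ.eventually_differentiableAt,
      hA.eventually_differentiableAt] with y hy hy'
    exact fderiv_comp y hy hy'
  have h2 : HasFDerivAt (fderiv ℝ Φ) (fderiv ℝ (fderiv ℝ Φ) (A x)) (A x) :=
    ((hΦ.fderiv_right (m := ∞) (by simp)).differentiableAt (by simp)).hasFDerivAt
  have h3 : HasFDerivAt (fderiv ℝ A) (fderiv ℝ (fderiv ℝ A) x) x :=
    ((hA.fderiv_right (m := ∞) (by simp)).differentiableAt (by simp)).hasFDerivAt
  have h4 : HasFDerivAt A (fderiv ℝ A x) x := (hA.differentiableAt (by simp)).hasFDerivAt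
  have h5 : HasFDerivAt (fun y => fderiv ℝ Φ (A y))
      ((fderiv ℝ (fderiv ℝ Φ) (A x)).comp (fderiv ℝ A x)) x := h2.comp x h4
  rw [h1.fderiv_eq, (h5.clm_comp h3).fderiv]
  simp
  ring

/-- Second derivatives along a line. -/
theorem fderiv_fderiv_eq_of_hasDerivAt {W : Type*} [NormedAddCommGroup W] [NormedSpace ℝ W]
    {Φ : W → ℝ} {A N : W} (hΦ : ContDiffAt ℝ ∞ Φ A) {ℓ' : ℝ → ℝ} {c : ℝ}
    (h1 : ∀ᶠ s in 𝓝 (0 : ℝ), HasDerivAt (fun r : ℝ => Φ (A + r • N)) (ℓ' s) s)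
    (h2 : HasDerivAt ℓ' c 0) : fderiv ℝ (fderiv ℝ Φ) A N N = c := by
  have hl : ∀ s : ℝ, HasDerivAt (fun r : ℝ => A + r • N) N s := fun s => by
    simpa using ((hasDerivAt_id s).smul_const N).const_add A
  have hl0 : Tendsto (fun r : ℝ => A + r • N) (𝓝 0) (𝓝 A) := by
    simpa using (hl 0).continuousAt.tendsto
  have hΦ' := hl0.eventually hΦ.eventually_differentiableAt
  have h3 : ℓ' =ᶠ[𝓝 0] fun s => fderiv ℝ Φ (A + s • N) N := by
    filter_upwards [h1, hΦ'] with s hs hs'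
    exact hs.unique (hs'.hasFDerivAt.comp_hasDerivAt s (hl s))
  have h4 : HasFDerivAt (fderiv ℝ Φ) (fderiv ℝ (fderiv ℝ Φ) A) (A + (0 : ℝ) • N) := by
    rw [zero_smul, add_zero]
    exact ((hΦ.fderiv_right (m := ∞) (by simp)).differentiableAt (by simp)).hasFDerivAt
  have h5 : HasDerivAt (fun s : ℝ => fderiv ℝ Φ (A + s • N) N)
      (fderiv ℝ (fderiv ℝ Φ) A N N) 0 := by
    have h6 : HasFDerivAt (fun C => fderiv ℝ Φ C N) ((fderiv ℝ (fderiv ℝ Φ) A).flip N)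
      (A + (0 : ℝ) • N) := h4.apply_const N
    exact h6.comp_hasDerivAt (0 : ℝ) (hl 0)
  exact (h5.congr_of_eventuallyEq h3).unique h2

variable {n : ℕ} {V : Type*} [NormedAddCommGroup V] [InnerProductSpace ℝ V]

/-- The derivative of the invariance `DΦ(C)(C ∘ B) = 0` with respect to `C`. -/
theorem fderiv_fderiv_comp_right {Φ : (Euc n →L[ℝ] V) → ℝ} {A : Euc n →L[ℝ] V}
    (hΦ : ContDiffAt ℝ ∞ Φ A)
    (hinv : ∀ᶠ C in 𝓝 A, ∀ B : Euc n →L[ℝ] Euc n, fderiv ℝ Φ C (C.comp B) = 0)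
    (X : Euc n →L[ℝ] V) (B : Euc n →L[ℝ] Euc n) :
    fderiv ℝ (fderiv ℝ Φ) A X (A.comp B) = -fderiv ℝ Φ A (X.comp B) := by
  have h2 : HasFDerivAt (fderiv ℝ Φ) (fderiv ℝ (fderiv ℝ Φ) A) A :=
    ((hΦ.fderiv_right (m := ∞) (by simp)).differentiableAt (by simp)).hasFDerivAt
  have h3 : HasFDerivAt (fun C : Euc n →L[ℝ] V => C.comp B)
      ((ContinuousLinearMap.compL ℝ (Euc n) (Euc n) V).flip B) A :=
    ((ContinuousLinearMap.compL ℝ (Euc n) (Euc n) V).flip B).hasFDerivAt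
  have h4 := (h2.clm_apply h3).unique
    ((hasFDerivAt_const (0 : ℝ) A).congr_of_eventuallyEq (hinv.mono fun C hC => hC B))
  have h5 := congrArg (fun T => T X) h4
  simp at h5
  linarith

/-- The component of `v ↦ Y v` tangent to the image of `A`, as an endomorphism of `ℝⁿ`; here `e` is
a frame which `A` maps to an orthonormal one. -/
def tangentialPart (A : Euc n →L[ℝ] V) (e : Fin n → Euc n) (Y : Euc n →L[ℝ] V) :
    Euc n →L[ℝ] Euc n :=
  ∑ j, ((innerSL ℝ (A (e j))).comp Y).smulRight (e j)

theorem tangentialPart_apply (A : Euc n →L[ℝ] V) (e : Fin n → Euc n) (Y : Euc n →L[ℝ] V)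
    (v : Euc n) : tangentialPart A e Y v = ∑ j, inner ℝ (A (e j)) (Y v) • e j := by
  simp [tangentialPart]

/-- The component of `Y` normal to the image of `A`. -/
def normalPart (A : Euc n →L[ℝ] V) (e : Fin n → Euc n) (Y : Euc n →L[ℝ] V) : Euc n →L[ℝ] V :=
  Y - A.comp (tangentialPart A e Y)

/-- The derivative of the velocity `X = ∑ g^{ab} ∂_a ∂_b f - df(w)`. -/
theorem fderiv_velocity {f X : Euc n → V} {w : Euc n → Euc n}
    {x : Euc n} {e : Fin n → Euc n} (hf : ContDiffAt ℝ ∞ f x)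
    (he : frameMat (innerSL ℝ) (fderiv ℝ f x) e = 1) (hw : DifferentiableAt ℝ w x)
    (hX : X =ᶠ[𝓝 x] fun y =>
      ∑ a, ∑ b, (frameMat (innerSL ℝ) (fderiv ℝ f y) (stdFrame n))⁻¹ a b •
        fderiv ℝ (fderiv ℝ f) y (stdFrame n a) (stdFrame n b) - fderiv ℝ f y (w y)) :
    fderiv ℝ X x = ∑ i, fderiv ℝ (fderiv ℝ (fderiv ℝ f)) x (e i) (e i)
      - (2 : ℝ) • ∑ i, (fderiv ℝ (fderiv ℝ f) x (e i)).comp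
          (tangentialPart (fderiv ℝ f x) e (fderiv ℝ (fderiv ℝ f) x (e i)))
      - fderiv ℝ (fderiv ℝ f) x (w x) - (fderiv ℝ f x).comp (fderiv ℝ w x) := by
  set A := fderiv ℝ f with hA
  set A' := fderiv ℝ A with hA'
  set A'' := fderiv ℝ A' with hA''
  have cA : ContDiffAt ℝ ∞ A x := hf.fderiv_right (by simp)
  have cA' : ContDiffAt ℝ ∞ A' x := cA.fderiv_right (by simp)
  have dA : HasFDerivAt A (A' x) x := (cA.differentiableAt (by simp)).hasFDerivAt
  have dA' : HasFDerivAt A' (A'' x) x := (cA'.differentiableAt (by simp)).hasFDerivAt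
  -- Symmetry of the second and third derivatives.
  have sA : ∀ᶠ y in 𝓝 x, ∀ v u, A' y v u = A' y u v := by
    filter_upwards [(hf.of_le two_le_infty).eventually (by decide)] with y hy
    exact hy.isSymmSndFDerivAt (by simp)
  have sA' : ∀ v u, A'' x v u = A'' x u v :=
    (cA.of_le two_le_infty).isSymmSndFDerivAt (by simp)
  have tA' : ∀ v u z, A'' x v u z = A'' x v z u := by
    intro v u z
    have h2 := ((dA'.apply_const u).apply_const z).unique
      (((dA'.apply_const z).apply_const u).congr_of_eventuallyEq (sA.mono fun y hy => hy u z))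
    exact congrArg (fun T => T v) h2
  set G : Euc n → Matrix (Fin n) (Fin n) ℝ := fun y => frameMat (innerSL ℝ) (A y) (stdFrame n)
  have cG : ∀ a b, ContDiffAt ℝ ∞ (fun y => G y a b) x := fun a b =>
    (contDiff_frameMat (innerSL ℝ) (stdFrame n) a b).contDiffAt.comp x cA
  have dG0 : (G x).det ≠ 0 := (isUnit_det_gram he).ne_zero
  have dG : ∀ a b, HasFDerivAt (fun y => G y a b) _ x := fun a b =>
    (dA.apply_const (stdFrame n a)).inner ℝ (dA.apply_const (stdFrame n b))
  have cGi : ∀ a b, ContDiffAt ℝ ∞ (fun y => (G y)⁻¹ a b) x := fun a b => by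
    rw [← contDiffWithinAt_univ]
    exact ContDiffWithinAt.matrix_inv (fun a b => (cG a b).contDiffWithinAt) dG0 a b
  have cdet : ContDiffAt ℝ ∞ (fun y => (G y).det) x := by
    rw [← contDiffWithinAt_univ]
    exact ContDiffWithinAt.matrix_det fun a b => (cG a b).contDiffWithinAt
  have dGi := hasFDerivAt_matrix_inv dG (fun a b => (cGi a b).differentiableAt (by simp))
    (cdet.continuousAt.eventually_ne dG0)
  have hd := (HasFDerivAt.fun_sum (u := Finset.univ) fun a _ => HasFDerivAt.fun_sum
    (u := Finset.univ) fun b _ =>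
      (dGi a b).smul ((dA'.apply_const (stdFrame n a)).apply_const (stdFrame n b))).sub
    (dA.clm_apply hw.hasFDerivAt)
  have hd' := (hd.congr_of_eventuallyEq hX).fderiv
  rw [hd']
  ext1 v
  set q : Euc n →ₗ[ℝ] Euc n →ₗ[ℝ] ℝ := LinearMap.mk₂ ℝ
    (fun y z => inner ℝ (A x y) (A' x v z) + inner ℝ (A' x v y) (A x z))
    (by intros; simp only [map_add, inner_add_left]; ring)
    (by intros; simp only [map_smul, real_inner_smul_left, smul_eq_mul]; ring)
    (by intros; simp only [map_add, inner_add_right]; ring)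
    (by intros; simp only [map_smul, real_inner_smul_right, smul_eq_mul]; ring) with hq
  set B : Euc n →ₗ[ℝ] Euc n →ₗ[ℝ] V := LinearMap.mk₂ ℝ (fun y z => A' x y z)
    (by simp) (by simp) (by simp) (by simp) with hB
  set B₂ : Euc n →ₗ[ℝ] Euc n →ₗ[ℝ] V := LinearMap.mk₂ ℝ (fun y z => A'' x v y z)
    (by simp) (by simp) (by simp) (by simp) with hB₂
  have hq' : ∀ y z, q y z = inner ℝ (A x y) (A' x v z) + inner ℝ (A' x v y) (A x z) :=
    fun _ _ => rfl
  have k1 : ∑ a, ∑ b, (G x)⁻¹ a b • A'' x v (stdFrame n a) (stdFrame n b) =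
      ∑ i, A'' x (e i) (e i) v := by
    have := sum_gram_inv_smul he B₂
    refine this.trans (Finset.sum_congr rfl fun i _ => ?_)
    simp only [hB₂, LinearMap.mk₂_apply]
    rw [sA', tA']
  -- The derivative of the inverse metric contributes twice the tangential part.
  have k2 : ∀ a b, ∑ k, ∑ l, (G x)⁻¹ a k * (G x)⁻¹ l b * q (stdFrame n k) (stdFrame n l) =
      ∑ i, ∑ j, (e i a * e j b) * q (e i) (e j) := by
    intro a b
    have g1 : ∀ a b, (G x)⁻¹ a b = ∑ i, e i a * e i b := gram_inv_apply he
    have : ∀ k l, (G x)⁻¹ a k * (G x)⁻¹ l b * q (stdFrame n k) (stdFrame n l) =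
        ∑ i, ∑ j, (e i a * e j b) * ((e i k * e j l) • q (stdFrame n k) (stdFrame n l)) := by
      intro k l
      rw [g1, g1, Finset.sum_mul_sum, Finset.sum_mul]
      refine Finset.sum_congr rfl fun i _ => ?_
      rw [Finset.sum_mul]
      exact Finset.sum_congr rfl fun j _ => by rw [smul_eq_mul]; ring
    simp only [this]
    rw [Finset.sum_congr rfl fun k _ => Finset.sum_comm, Finset.sum_comm]
    refine Finset.sum_congr rfl fun i _ => ?_
    rw [Finset.sum_congr rfl fun k _ => Finset.sum_comm, Finset.sum_comm]
    refine Finset.sum_congr rfl fun j _ => ?_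
    rw [bilin_eq_sum q (e i) (e j)]
    simp only [Finset.mul_sum]
  have k3 : ∑ a, ∑ b, (∑ k, ∑ l, (G x)⁻¹ a k * (G x)⁻¹ l b *
      q (stdFrame n k) (stdFrame n l)) • A' x (stdFrame n a) (stdFrame n b) =
      ∑ i, ∑ j, q (e i) (e j) • A' x (e i) (e j) := by
    simp only [k2, Finset.sum_smul]
    rw [Finset.sum_congr rfl fun k _ => Finset.sum_comm, Finset.sum_comm]
    refine Finset.sum_congr rfl fun i _ => ?_
    rw [Finset.sum_congr rfl fun k _ => Finset.sum_comm, Finset.sum_comm]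
    refine Finset.sum_congr rfl fun j _ => ?_
    have := bilin_eq_sum B (e i) (e j)
    simp only [hB, LinearMap.mk₂_apply] at this
    rw [this]
    simp only [Finset.smul_sum, smul_smul]
    exact Finset.sum_congr rfl fun _ _ => Finset.sum_congr rfl fun _ _ => by rw [mul_comm]
  have k4 : ∑ i, ∑ j, q (e i) (e j) • A' x (e i) (e j) = (2 : ℝ) • ∑ i,
      A' x (e i) (tangentialPart (A x) e (A' x (e i)) v) := by
    have sx := sA.self_of_nhds
    simp only [hq', add_smul, Finset.sum_add_distrib, two_smul, tangentialPart_apply, map_sum,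
      map_smul, sx v]
    congr 1
    · rw [Finset.sum_comm]
      refine Finset.sum_congr rfl fun i _ => Finset.sum_congr rfl fun j _ => ?_
      rw [sx (e j) (e i)]
    · refine Finset.sum_congr rfl fun i _ => Finset.sum_congr rfl fun j _ => ?_
      rw [real_inner_comm]
  have k5 : ∀ a b, (-∑ k, ∑ l, ((G x)⁻¹ a k * (G x)⁻¹ l b) •
      (fderivInnerCLM ℝ (A x (stdFrame n k), A x (stdFrame n l))).comp
        (((A' x).flip (stdFrame n k)).prod ((A' x).flip (stdFrame n l)))) v =
      -∑ k, ∑ l, (G x)⁻¹ a k * (G x)⁻¹ l b * q (stdFrame n k) (stdFrame n l) := by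
    intro a b
    simp [hq', fderivInnerCLM_apply]
  simp only [sub_apply, sum_apply, add_apply, smul_apply, ContinuousLinearMap.flip_apply,
    ContinuousLinearMap.smulRight_apply, k5, neg_smul, Finset.sum_add_distrib,
    Finset.sum_neg_distrib, ContinuousLinearMap.comp_apply]
  rw [k1, k3, k4, sA.self_of_nhds v (w x)]
  abel

/-- The evolution equation, at a fixed time, of a function `Φ` of the differential of a map `f`
that moves with velocity `X = ∑ g^{ab} ∂_a ∂_b f - df(w)`. Because `Φ` is invariant under changes
of coordinates, the terms involving `w`, third derivatives of `f`, and the tangential parts of the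
second derivatives all cancel, and only the Hessian of `Φ` in normal directions is left. -/
theorem evolution_of_invariant {Φ : (Euc n →L[ℝ] V) → ℝ} {f X : Euc n → V} {w : Euc n → Euc n}
    {x : Euc n} {e : Fin n → Euc n} (hf : ContDiffAt ℝ ∞ f x)
    (hΦ : ContDiffAt ℝ ∞ Φ (fderiv ℝ f x))
    (hinv : ∀ᶠ C in 𝓝 (fderiv ℝ f x), ∀ B : Euc n →L[ℝ] Euc n, fderiv ℝ Φ C (C.comp B) = 0)
    (he : frameMat (innerSL ℝ) (fderiv ℝ f x) e = 1) (hw : DifferentiableAt ℝ w x)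
    (hX : X =ᶠ[𝓝 x] fun y =>
      ∑ a, ∑ b, (frameMat (innerSL ℝ) (fderiv ℝ f y) (stdFrame n))⁻¹ a b •
        fderiv ℝ (fderiv ℝ f) y (stdFrame n a) (stdFrame n b) - fderiv ℝ f y (w y)) :
    fderiv ℝ Φ (fderiv ℝ f x) (fderiv ℝ X x) =
      ∑ i, fderiv ℝ (fderiv ℝ fun y => Φ (fderiv ℝ f y)) x (e i) (e i)
        - fderiv ℝ (fun y => Φ (fderiv ℝ f y)) x (w x)
        - ∑ i, fderiv ℝ (fderiv ℝ Φ) (fderiv ℝ f x)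
            (normalPart (fderiv ℝ f x) e (fderiv ℝ (fderiv ℝ f) x (e i)))
            (normalPart (fderiv ℝ f x) e (fderiv ℝ (fderiv ℝ f) x (e i))) := by
  set A := fderiv ℝ f with hA
  set A' := fderiv ℝ A with hA'
  set A'' := fderiv ℝ A' with hA''
  have cA : ContDiffAt ℝ ∞ A x := hf.fderiv_right (by simp)
  have dA : HasFDerivAt A (A' x) x := (cA.differentiableAt (by simp)).hasFDerivAt
  have hX' : fderiv ℝ X x = ∑ i, A'' x (e i) (e i)
      - (2 : ℝ) • ∑ i, (A' x (e i)).comp (tangentialPart (A x) e (A' x (e i)))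
      - A' x (w x) - (A x).comp (fderiv ℝ w x) := fderiv_velocity hf he hw hX
  have cΦ0 := hinv.self_of_nhds
  have hu1 : fderiv ℝ (fun y => Φ (A y)) x (w x) = fderiv ℝ Φ (A x) (A' x (w x)) := by
    have := ((hΦ.differentiableAt (by simp)).hasFDerivAt.comp x dA).fderiv
    exact congrArg (fun T => T (w x)) this
  have hu2 : ∀ i, fderiv ℝ (fderiv ℝ Φ) (A x) (A' x (e i)) (A' x (e i)) =
      fderiv ℝ (fderiv ℝ Φ) (A x) (normalPart (A x) e (A' x (e i)))
        (normalPart (A x) e (A' x (e i)))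
      - 2 * fderiv ℝ Φ (A x) ((A' x (e i)).comp (tangentialPart (A x) e (A' x (e i)))) := by
    intro i
    set Γ := tangentialPart (A x) e (A' x (e i))
    set N := normalPart (A x) e (A' x (e i)) with hN
    have hAi : A' x (e i) = N + (A x).comp Γ := by simp [hN, normalPart, Γ]
    have hsym : ∀ Y Z, fderiv ℝ (fderiv ℝ Φ) (A x) Y Z = fderiv ℝ (fderiv ℝ Φ) (A x) Z Y :=
      (hΦ.of_le two_le_infty).isSymmSndFDerivAt (by simp)
    have h3 := fderiv_fderiv_comp_right hΦ hinv
    rw [hAi, (fderiv ℝ (fderiv ℝ Φ) (A x)).map_add₂, map_add, map_add, hsym ((A x).comp Γ) N, h3,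
      h3, ContinuousLinearMap.add_comp, map_add, ContinuousLinearMap.comp_assoc, cΦ0]
    ring
  have hu3 : ∀ i, fderiv ℝ (fderiv ℝ fun y => Φ (A y)) x (e i) (e i) =
      fderiv ℝ (fderiv ℝ Φ) (A x) (A' x (e i)) (A' x (e i))
        + fderiv ℝ Φ (A x) (A'' x (e i) (e i)) := fun i => fderiv_fderiv_comp hΦ cA _ _
  simp only [hu3, hu1, hX', map_sub, map_sum, map_smul, cΦ0, hu2,
    Finset.sum_add_distrib, Finset.sum_sub_distrib, ← Finset.mul_sum, smul_eq_mul]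
  ring

end Calculus

/-! ### The linear model and its adapted frames -/

section Model

variable {n : ℕ}

/-- The linear model of a flat Kähler splitting: a complex structure and two complementary
orthogonal projections of Euclidean space whose kernels are Lagrangian. -/
structure ModelSplitting (n : ℕ) where
  J : Euc (2 * n) →ₗ[ℝ] Euc (2 * n)
  π₁ : Euc (2 * n) →ₗ[ℝ] Euc (2 * n)
  π₂ : Euc (2 * n) →ₗ[ℝ] Euc (2 * n)
  J_sq : ∀ v, J (J v) = -v
  J_isometry : ∀ v w, inner ℝ (J v) (J w) = inner ℝ v w
  π₁_idem : ∀ v, π₁ (π₁ v) = π₁ v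
  π₁_symm : ∀ v w, inner ℝ (π₁ v) w = inner ℝ v (π₁ w)
  π_add : ∀ v, π₁ v + π₂ v = v
  finrank_ker_π₂ : Module.finrank ℝ (LinearMap.ker π₂) = n
  ω_ker_π₁ : ∀ v, π₁ v = 0 → ∀ w, π₁ w = 0 → inner ℝ (J v) w = 0
  ω_ker_π₂ : ∀ v, π₂ v = 0 → ∀ w, π₂ w = 0 → inner ℝ (J v) w = 0

namespace ModelSplitting

variable (K : ModelSplitting n)

theorem J_skew (v w : Euc (2 * n)) : inner ℝ (K.J v) w = -inner ℝ v (K.J w) := by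
  rw [← K.J_isometry, K.J_sq, inner_neg_left]

theorem π₂_eq (v : Euc (2 * n)) : K.π₂ v = v - K.π₁ v := by
  rw [eq_sub_iff_add_eq, add_comm, K.π_add]

theorem π₂_eq_zero {v : Euc (2 * n)} : K.π₂ v = 0 ↔ K.π₁ v = v := by
  rw [π₂_eq, sub_eq_zero, eq_comm]

theorem π₁_π₂ (v : Euc (2 * n)) : K.π₁ (K.π₂ v) = 0 := by
  rw [π₂_eq, map_sub, K.π₁_idem, sub_self]

/-- `J` maps the range of `π₁` into the kernel of `π₁`. -/
theorem π₁_J_of_π₁ {v : Euc (2 * n)} (hv : K.π₁ v = v) : K.π₁ (K.J v) = 0 := by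
  rw [← inner_self_eq_zero (𝕜 := ℝ), K.π₁_symm, K.π₁_idem]
  exact K.ω_ker_π₂ _ (K.π₂_eq_zero.2 hv) _ (K.π₂_eq_zero.2 (K.π₁_idem _))

theorem π₁_J_of_π₂ {v : Euc (2 * n)} (hv : K.π₁ v = 0) : K.π₁ (K.J v) = K.J v := by
  rw [← K.π₂_eq_zero, ← inner_self_eq_zero (𝕜 := ℝ)]
  have h : inner ℝ (K.π₂ (K.J v)) (K.π₁ (K.J v)) = 0 := by
    rw [← K.π₁_symm, K.π₁_π₂, inner_zero_left]
  have h2 : inner ℝ (K.π₂ (K.J v)) (K.J v) = 0 := by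
    rw [real_inner_comm]
    exact K.ω_ker_π₁ _ hv _ (K.π₁_π₂ _)
  nth_rewrite 2 [π₂_eq]
  rw [inner_sub_right, h, h2, sub_zero]

/-- The bilinear form `S(v, w) = ⟨J π₁ v, π₂ w⟩`. -/
def S : Euc (2 * n) →L[ℝ] Euc (2 * n) →L[ℝ] ℝ :=
  (innerSL ℝ).bilinearComp (K.J ∘ₗ K.π₁).toContinuousLinearMap K.π₂.toContinuousLinearMap

theorem S_apply (v w : Euc (2 * n)) : K.S v w = inner ℝ (K.J (K.π₁ v)) (K.π₂ w) := rfl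

/-- Adapted frames of a linear map into the model space. -/
structure IsAdapted (A : Euc n →L[ℝ] Euc (2 * n)) (e : Fin n → Euc n) (a : Fin n → Euc (2 * n))
    (lam : Fin n → ℝ) : Prop where
  mem_range : ∀ i, K.π₁ (a i) = a i
  orthonormal : ∀ i j, inner ℝ (a i) (a j) = if i = j then 1 else (0 : ℝ)
  frame_eq : ∀ i, A (e i) = (1 / Real.sqrt (1 + lam i ^ 2)) • (a i + lam i • K.J (a i))

variable {K} {A : Euc n →L[ℝ] Euc (2 * n)} {e : Fin n → Euc n} {a : Fin n → Euc (2 * n)}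
  {lam : Fin n → ℝ}

theorem one_add_sq_pos (x : ℝ) : 0 < 1 + x ^ 2 := by positivity

theorem inv_sqrt_mul_self (x : ℝ) :
    1 / Real.sqrt (1 + x ^ 2) * (1 / Real.sqrt (1 + x ^ 2)) = 1 / (1 + x ^ 2) := by
  rw [div_mul_div_comm, one_mul, Real.mul_self_sqrt (one_add_sq_pos x).le]

theorem angle_add (l m : ℝ) : l / (1 + l ^ 2) + m / (1 + m ^ 2) =
    (l + m) * (1 + l * m) / ((1 + l ^ 2) * (1 + m ^ 2)) := by
  have := (one_add_sq_pos l).ne'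
  have := (one_add_sq_pos m).ne'
  field_simp
  ring

namespace IsAdapted

theorem inner_J_J (h : K.IsAdapted A e a lam) (i j : Fin n) :
    inner ℝ (K.J (a i)) (K.J (a j)) = if i = j then 1 else (0 : ℝ) := by
  rw [K.J_isometry, h.orthonormal]

theorem inner_a_J (h : K.IsAdapted A e a lam) (i j : Fin n) : inner ℝ (a i) (K.J (a j)) = 0 := by
  rw [← h.mem_range i, K.π₁_symm, K.π₁_J_of_π₁ (h.mem_range j), inner_zero_right]

theorem inner_J_a (h : K.IsAdapted A e a lam) (i j : Fin n) : inner ℝ (K.J (a i)) (a j) = 0 := by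
  rw [real_inner_comm, h.inner_a_J]

theorem J_frame (h : K.IsAdapted A e a lam) (i : Fin n) :
    K.J (A (e i)) = (1 / Real.sqrt (1 + lam i ^ 2)) • (K.J (a i) - lam i • a i) := by
  rw [h.frame_eq, map_smul, map_add, map_smul, K.J_sq, smul_neg, sub_eq_add_neg]

theorem π₁_frame (h : K.IsAdapted A e a lam) (i : Fin n) :
    K.π₁ (A (e i)) = (1 / Real.sqrt (1 + lam i ^ 2)) • a i := by
  rw [h.frame_eq, map_smul, map_add, map_smul, h.mem_range, K.π₁_J_of_π₁ (h.mem_range i),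
    smul_zero, add_zero]

theorem π₂_frame (h : K.IsAdapted A e a lam) (i : Fin n) :
    K.π₂ (A (e i)) = (1 / Real.sqrt (1 + lam i ^ 2)) • lam i • K.J (a i) := by
  rw [K.π₂_eq, h.π₁_frame, h.frame_eq, smul_add, add_sub_cancel_left]

theorem π₁_J_frame (h : K.IsAdapted A e a lam) (i : Fin n) :
    K.π₁ (K.J (A (e i))) = -((1 / Real.sqrt (1 + lam i ^ 2)) • lam i • a i) := by
  rw [h.J_frame, map_smul, map_sub, map_smul, h.mem_range, K.π₁_J_of_π₁ (h.mem_range i),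
    zero_sub, smul_neg]

theorem π₂_J_frame (h : K.IsAdapted A e a lam) (i : Fin n) :
    K.π₂ (K.J (A (e i))) = (1 / Real.sqrt (1 + lam i ^ 2)) • K.J (a i) := by
  rw [K.π₂_eq, h.π₁_J_frame, h.J_frame, smul_sub, sub_neg_eq_add, sub_add_cancel]

theorem inner_frame (h : K.IsAdapted A e a lam) (i j : Fin n) :
    inner ℝ (A (e i)) (A (e j)) = if i = j then 1 else (0 : ℝ) := by
  rw [h.frame_eq, h.frame_eq]
  simp only [real_inner_smul_left, real_inner_smul_right, inner_add_left, inner_add_right,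
    h.orthonormal, h.inner_a_J, h.inner_J_a, h.inner_J_J]
  split_ifs with hij
  · subst hij
    have := inv_sqrt_mul_self (lam i)
    have h0 := (one_add_sq_pos (lam i)).ne'
    calc _ = (1 / Real.sqrt (1 + lam i ^ 2) * (1 / Real.sqrt (1 + lam i ^ 2))) *
          (1 + lam i ^ 2) := by ring
      _ = 1 := by rw [this]; field_simp
  · ring

theorem inner_frame_J (h : K.IsAdapted A e a lam) (i j : Fin n) :
    inner ℝ (A (e i)) (K.J (A (e j))) = 0 := by
  rw [h.frame_eq i, h.J_frame]
  simp only [real_inner_smul_left, real_inner_smul_right, inner_add_left, inner_sub_right,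
    h.orthonormal, h.inner_a_J, h.inner_J_a, h.inner_J_J]
  split_ifs with hij
  · subst hij; ring
  · ring

theorem frameMat_inner (h : K.IsAdapted A e a lam) : frameMat (innerSL ℝ) A e = 1 := by
  ext i j
  simp only [frameMat, Matrix.of_apply, Matrix.one_apply]
  exact h.inner_frame i j

theorem S_frame (h : K.IsAdapted A e a lam) (i j : Fin n) :
    K.S (A (e i)) (A (e j)) = if i = j then lam i / (1 + lam i ^ 2) else 0 := by
  rw [S_apply, h.π₁_frame, h.π₂_frame, map_smul]
  simp only [real_inner_smul_left, real_inner_smul_right, h.inner_J_J]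
  split_ifs with hij
  · subst hij
    have := inv_sqrt_mul_self (lam i)
    linear_combination lam i * this
  · ring

theorem S_J_frame (h : K.IsAdapted A e a lam) (i j : Fin n) :
    K.S (K.J (A (e i))) (A (e j)) = if i = j then -(lam i ^ 2 / (1 + lam i ^ 2)) else 0 := by
  rw [S_apply, h.π₁_J_frame, h.π₂_frame, map_neg, map_smul, map_smul]
  simp only [real_inner_smul_left, real_inner_smul_right, h.inner_J_J, inner_neg_left]
  split_ifs with hij
  · subst hij
    have := inv_sqrt_mul_self (lam i)
    linear_combination -lam i ^ 2 * this
  · ring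

theorem S_frame_J (h : K.IsAdapted A e a lam) (i j : Fin n) :
    K.S (A (e i)) (K.J (A (e j))) = if i = j then 1 / (1 + lam i ^ 2) else 0 := by
  rw [S_apply, h.π₁_frame, h.π₂_J_frame, map_smul]
  simp only [real_inner_smul_left, real_inner_smul_right, h.inner_J_J]
  split_ifs with hij
  · subst hij
    have := inv_sqrt_mul_self (lam i)
    linear_combination this
  · ring

theorem S_J_frame_J (h : K.IsAdapted A e a lam) (i j : Fin n) :
    K.S (K.J (A (e i))) (K.J (A (e j))) = if i = j then -(lam i / (1 + lam i ^ 2)) else 0 := by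
  rw [S_apply, h.π₁_J_frame, h.π₂_J_frame, map_neg, map_smul, map_smul]
  simp only [real_inner_smul_left, real_inner_smul_right, h.inner_J_J, inner_neg_left]
  split_ifs with hij
  · subst hij
    have := inv_sqrt_mul_self (lam i)
    linear_combination -lam i * this
  · ring

theorem frameMat_S (h : K.IsAdapted A e a lam) :
    frameMat K.S A e = Matrix.diagonal fun i => lam i / (1 + lam i ^ 2) := by
  ext i j
  simp only [frameMat, Matrix.of_apply, h.S_frame, Matrix.diagonal_apply]

theorem pullbackDet_eq_prod (h : K.IsAdapted A e a lam) :
    pullbackDet K.S A = ∏ i, ∏ j ∈ Finset.Ioi i,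
      (lam i + lam j) * (1 + lam i * lam j) / ((1 + lam i ^ 2) * (1 + lam j ^ 2)) := by
  rw [pullbackDet_eq K.S h.frameMat_inner, h.frameMat_S, det_secondCompound_diagonal]
  exact Finset.prod_congr rfl fun i _ => Finset.prod_congr rfl fun j _ => angle_add _ _

/-- The vectors `e_i` and `J e_i` of an adapted frame form an orthonormal basis. -/
theorem eq_sum (h : K.IsAdapted A e a lam) (Y : Euc (2 * n)) :
    Y = ∑ j, inner ℝ (A (e j)) Y • A (e j)
      + ∑ j, inner ℝ (K.J (A (e j))) Y • K.J (A (e j)) := by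
  set b : Fin n ⊕ Fin n → Euc (2 * n) := Sum.elim (fun j => A (e j)) fun j => K.J (A (e j)) with hb
  have ho : Orthonormal ℝ b := by
    rw [orthonormal_iff_ite]
    rintro (i | i) (j | j)
    · simp [hb, h.inner_frame]
    · simp [hb, h.inner_frame_J]
    · simp [hb, real_inner_comm, h.inner_frame_J]
    · simp [hb, K.J_isometry, h.inner_frame]
  have hc : Fintype.card (Fin n ⊕ Fin n) = Module.finrank ℝ (Euc (2 * n)) := by simp; ring
  let B := OrthonormalBasis.mk ho
    (ho.linearIndependent.span_eq_top_of_card_eq_finrank' hc).ge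
  have hB : ⇑B = b := OrthonormalBasis.coe_mk _ _
  have := B.sum_repr' Y
  rw [hB, Fintype.sum_sum_type] at this
  exact this.symm

end IsAdapted

end ModelSplitting

end Model

/-! ### The Hessian of `log det S^{[2]}` in normal directions -/

section Hessian

open Filter Topology

variable {n : ℕ}

theorem HasDerivAt.wedge {X Y : ℝ → Matrix (Fin n) (Fin n) ℝ} {X' Y' : Matrix (Fin n) (Fin n) ℝ}
    {s : ℝ} (hX : ∀ i j, HasDerivAt (fun r => X r i j) (X' i j) s)
    (hY : ∀ i j, HasDerivAt (fun r => Y r i j) (Y' i j) s) (α β : IndexPair n) :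
    HasDerivAt (fun r => wedge (X r) (Y r) α β)
      ((_root_.wedge X' (Y s) + _root_.wedge (X s) Y') α β) s := by
  have h := (((((hX α.1.1 β.1.1).mul (hY α.1.2 β.1.2)).add
    ((hX α.1.2 β.1.2).mul (hY α.1.1 β.1.1))).sub
    ((hX α.1.1 β.1.2).mul (hY α.1.2 β.1.1))).sub ((hX α.1.2 β.1.1).mul (hY α.1.1 β.1.2)))
  refine h.congr_deriv ?_
  simp only [_root_.wedge, Matrix.add_apply, Matrix.of_apply]
  ring

theorem HasDerivAt.minors {X : ℝ → Matrix (Fin n) (Fin n) ℝ} {X' : Matrix (Fin n) (Fin n) ℝ}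
    {s : ℝ} (hX : ∀ i j, HasDerivAt (fun r => X r i j) (X' i j) s) (α β : IndexPair n) :
    HasDerivAt (fun r => minors (X r) α β) (_root_.wedge (X s) X' α β) s := by
  have h := (((hX α.1.1 β.1.1).mul (hX α.1.2 β.1.2)).sub ((hX α.1.1 β.1.2).mul (hX α.1.2 β.1.1)))
  refine h.congr_deriv ?_
  simp only [_root_.wedge, Matrix.of_apply]
  ring

theorem contDiff_wedge {X Y : ℝ → Matrix (Fin n) (Fin n) ℝ}
    (hX : ∀ i j, ContDiff ℝ 1 fun r => X r i j) (hY : ∀ i j, ContDiff ℝ 1 fun r => Y r i j)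
    (α β : IndexPair n) : ContDiff ℝ 1 fun r => wedge (X r) (Y r) α β :=
  (((((hX _ _).mul (hY _ _)).add ((hX _ _).mul (hY _ _))).sub ((hX _ _).mul (hY _ _))).sub
    ((hX _ _).mul (hY _ _)))

theorem contDiff_minors {X : ℝ → Matrix (Fin n) (Fin n) ℝ}
    (hX : ∀ i j, ContDiff ℝ 1 fun r => X r i j) (α β : IndexPair n) :
    ContDiff ℝ 1 fun r => minors (X r) α β :=
  ((hX _ _).mul (hX _ _)).sub ((hX _ _).mul (hX _ _))

/-- Two-convexity of the numbers `lam`. -/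
def TwoConvexAngles (lam : Fin n → ℝ) : Prop :=
  ∀ i j, i ≠ j → 0 < lam i + lam j ∧ 0 < 1 + lam i * lam j

/-- The contribution of one direction of differentiation to the lower bound of the evolution of
`log det S^{[2]}`. -/
def evolutionQuadratic (lam : Fin n → ℝ) (H : Fin n → Fin n → ℝ) (i j : Fin n) : ℝ :=
  4 * H i j ^ 2
    + (1 + lam i ^ 2) * (1 + lam j ^ 2) / (lam i + lam j) ^ 2 * (H i i + H j j) ^ 2
    + (1 + lam i ^ 2) * (1 + lam j ^ 2) / (1 + lam i * lam j) ^ 2 * (H i i - H j j) ^ 2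

theorem TwoConvexAngles.add_pos {lam : Fin n → ℝ} (h : TwoConvexAngles lam) {i j : Fin n}
    (hij : i ≠ j) : 0 < lam i / (1 + lam i ^ 2) + lam j / (1 + lam j ^ 2) := by
  rw [ModelSplitting.angle_add]
  have := h i j hij
  have := ModelSplitting.one_add_sq_pos (lam i)
  have := ModelSplitting.one_add_sq_pos (lam j)
  exact div_pos (mul_pos (h i j hij).1 (h i j hij).2) (by positivity)

theorem four_add_four_le_evolutionQuadratic {lam : Fin n → ℝ} (h : TwoConvexAngles lam)
    (H : Fin n → Fin n → ℝ) {i j : Fin n} (hij : i ≠ j) :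
    4 * H i j ^ 2 + 2 * (H i i ^ 2 + H j j ^ 2) ≤ evolutionQuadratic lam H i j := by
  obtain ⟨h1, h2⟩ := h i j hij
  have c1 : 1 ≤ (1 + lam i ^ 2) * (1 + lam j ^ 2) / (lam i + lam j) ^ 2 := by
    rw [one_le_div (by positivity)]
    nlinarith [sq_nonneg (1 - lam i * lam j)]
  have c2 : 1 ≤ (1 + lam i ^ 2) * (1 + lam j ^ 2) / (1 + lam i * lam j) ^ 2 := by
    rw [one_le_div (by positivity)]
    nlinarith [sq_nonneg (lam i - lam j)]
  have d1 := mul_le_mul_of_nonneg_right c1 (sq_nonneg (H i i + H j j))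
  have d2 := mul_le_mul_of_nonneg_right c2 (sq_nonneg (H i i - H j j))
  rw [evolutionQuadratic]
  nlinarith

/-- The diagonal entry `H i i` occurs in the `n - 1 ≥ 1` pairs that contain `i`. -/
theorem two_mul_sum_sq_le (hn : 2 ≤ n) {lam : Fin n → ℝ} (h : TwoConvexAngles lam)
    {H : Fin n → Fin n → ℝ} (hH : ∀ i j, H i j = H j i) :
    2 * ∑ i, ∑ j, H i j ^ 2 ≤ ∑ i, ∑ j ∈ Finset.Ioi i, evolutionQuadratic lam H i j := by
  rw [← sum_indexPair (evolutionQuadratic lam H)]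
  have h1 := Finset.sum_le_sum fun (q : IndexPair n) (_ : q ∈ Finset.univ) =>
    four_add_four_le_evolutionQuadratic h H q.2.ne
  refine le_trans ?_ h1
  have h2 := sum_sum_eq_diag_add_indexPair fun i j => H i j ^ 2
  have h3 := sum_sum_eq_diag_add_indexPair fun i j => H i i ^ 2 + H j j ^ 2
  have h4 : ∑ i, ∑ j, (H i i ^ 2 + H j j ^ 2) = 2 * n * ∑ i, H i i ^ 2 := by
    simp only [Finset.sum_add_distrib, Finset.sum_const, Finset.card_univ, Fintype.card_fin,
      nsmul_eq_mul, ← Finset.mul_sum]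
    ring
  have h5 : ∀ q : IndexPair n, H q.1.1 q.1.2 ^ 2 + H q.1.2 q.1.1 ^ 2 = 2 * H q.1.1 q.1.2 ^ 2 :=
    fun q => by rw [hH q.1.2]; ring
  have h6 : ∀ q : IndexPair n, H q.1.1 q.1.1 ^ 2 + H q.1.2 q.1.2 ^ 2 +
      (H q.1.2 q.1.2 ^ 2 + H q.1.1 q.1.1 ^ 2) = 2 * (H q.1.1 q.1.1 ^ 2 + H q.1.2 q.1.2 ^ 2) :=
    fun q => by ring
  simp only [h5, ← Finset.mul_sum] at h2
  simp only [h6, ← Finset.mul_sum, h4, ← two_mul] at h3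
  rw [h2, Finset.sum_add_distrib, ← Finset.mul_sum, ← Finset.mul_sum]
  have h7 : (2 : ℝ) ≤ n := by exact_mod_cast hn
  have h8 : 0 ≤ ∑ i, H i i ^ 2 := Finset.sum_nonneg fun i _ => sq_nonneg _
  nlinarith [mul_nonneg (sub_nonneg.2 h7) h8]

/-- The right-hand side consists of the terms of minus the Hessian of `log det S^{[2]}` that belong
to the pair `i, j`; here `σ` are the eigenvalues of `S`. -/
theorem evolutionQuadratic_le {lam : Fin n → ℝ} (h : TwoConvexAngles lam)
    {H : Fin n → Fin n → ℝ} (hH : ∀ i j, H i j = H j i) {i j : Fin n} (hij : i ≠ j) {σ : Fin n → ℝ}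
    (hσ : ∀ i, σ i = lam i / (1 + lam i ^ 2)) :
    evolutionQuadratic lam H i j ≤
      2 * (∑ k, (H i k ^ 2 * (σ k + σ i) + H j k ^ 2 * (σ k + σ j))) / (σ i + σ j)
      + ((1 / (1 + lam i ^ 2) - lam i ^ 2 / (1 + lam i ^ 2)) * H i i
          + (1 / (1 + lam j ^ 2) - lam j ^ 2 / (1 + lam j ^ 2)) * H j j) ^ 2 / (σ i + σ j) ^ 2 := by
  have hpos : ∀ {i j}, i ≠ j → 0 < σ i + σ j := fun hij => by
    rw [hσ, hσ]; exact h.add_pos hij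
  -- All terms of the sum with `k ≠ i, j` are nonnegative.
  have h1 : 2 * H i j ^ 2 * (σ i + σ j) + 2 * H i i ^ 2 * σ i + 2 * H j j ^ 2 * σ j ≤
      ∑ k, (H i k ^ 2 * (σ k + σ i) + H j k ^ 2 * (σ k + σ j)) := by
    have h2 := Finset.sum_le_sum_of_subset_of_nonneg (s := {i, j}) (t := Finset.univ)
      (f := fun k => H i k ^ 2 * (σ k + σ i) + H j k ^ 2 * (σ k + σ j)) (Finset.subset_univ _)
      (fun k _ hk => by
        simp only [Finset.mem_insert, Finset.mem_singleton, not_or] at hk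
        have := hpos hk.1
        have := hpos hk.2
        positivity)
    rw [Finset.sum_pair hij, hH j i] at h2
    linarith
  have h3 := hpos hij
  have h4 : evolutionQuadratic lam H i j =
      2 * (2 * H i j ^ 2 * (σ i + σ j) + 2 * H i i ^ 2 * σ i + 2 * H j j ^ 2 * σ j) / (σ i + σ j)
      + ((1 / (1 + lam i ^ 2) - lam i ^ 2 / (1 + lam i ^ 2)) * H i i
          + (1 / (1 + lam j ^ 2) - lam j ^ 2 / (1 + lam j ^ 2)) * H j j) ^ 2
        / (σ i + σ j) ^ 2 := by
    obtain ⟨p1, p2⟩ := h i j hij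
    have q1 := (ModelSplitting.one_add_sq_pos (lam i)).ne'
    have q2 := (ModelSplitting.one_add_sq_pos (lam j)).ne'
    rw [evolutionQuadratic, hσ, hσ, ModelSplitting.angle_add]
    generalize lam i = l at *
    generalize lam j = m at *
    have p3 := p1.ne'
    have p4 := p2.ne'
    field_simp
    ring
  rw [h4]
  gcongr

/-- The Hessian of `log det S^{[2]}` in the direction of a normal-valued linear map `N`, such as
the second fundamental form of a Lagrangian immersion with one argument fixed. -/
theorem logPullbackDet_hessian_le {K : ModelSplitting n} {A N : Euc n →L[ℝ] Euc (2 * n)}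
    {e : Fin n → Euc n} {a : Fin n → Euc (2 * n)} {lam : Fin n → ℝ} (h : K.IsAdapted A e a lam)
    (hl : TwoConvexAngles lam) {H : Fin n → Fin n → ℝ} (hH : ∀ i j, H i j = H j i)
    (hN : ∀ i, N (e i) = ∑ k, H i k • K.J (A (e k)))
    (hΦ : ContDiffAt ℝ ∞ (logPullbackDet K.S) A) :
    fderiv ℝ (fderiv ℝ (logPullbackDet K.S)) A N N ≤
      -∑ i, ∑ j ∈ Finset.Ioi i, evolutionQuadratic lam H i j := by
  set σ : Fin n → ℝ := fun i => lam i / (1 + lam i ^ 2) with hσ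
  -- The matrices of `S` and of the metric along the line `A + s • N`.
  set K₁ : Matrix (Fin n) (Fin n) ℝ := Matrix.of fun i j =>
    (1 / (1 + lam i ^ 2) - lam j ^ 2 / (1 + lam j ^ 2)) * H i j with hK₁
  set R : Matrix (Fin n) (Fin n) ℝ := Matrix.of fun i j => ∑ k, H i k * H j k * σ k with hR
  set P : Matrix (Fin n) (Fin n) ℝ := Matrix.of fun i j => ∑ k, H i k * H j k with hP
  set X : ℝ → Matrix (Fin n) (Fin n) ℝ := fun s =>
    Matrix.diagonal σ + s • K₁ - s ^ 2 • R with hX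
  set Y : ℝ → Matrix (Fin n) (Fin n) ℝ := fun s => 1 + s ^ 2 • P with hY
  have hXs : ∀ s : ℝ, frameMat K.S (A + s • N) e = X s := by
    intro s
    ext i j
    simp only [frameMat, Matrix.of_apply, hX, Matrix.sub_apply, Matrix.add_apply,
      Matrix.smul_apply, smul_eq_mul, hK₁, hR, add_apply, smul_apply, hN, map_add, map_smul,
      map_sum, sum_apply, h.S_frame, h.S_J_frame, h.S_frame_J, h.S_J_frame_J, mul_ite, mul_zero,
      Finset.sum_ite_eq', Finset.mem_univ, if_true, Matrix.diagonal_apply, hσ]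
    simp only [mul_add, mul_ite, mul_zero, Finset.sum_add_distrib, Finset.sum_ite_eq,
      Finset.mem_univ, if_true]
    have : ∑ k, H j k * (s * (H i k * -(lam k / (1 + lam k ^ 2)))) =
        -(s * ∑ k, H i k * H j k * (lam k / (1 + lam k ^ 2))) := by
      rw [Finset.mul_sum, ← Finset.sum_neg_distrib]
      exact Finset.sum_congr rfl fun k _ => by ring
    rw [this, hH j i]
    ring
  have hYs : ∀ s : ℝ, frameMat (innerSL ℝ) (A + s • N) e = Y s := by
    intro s
    ext i j
    change inner ℝ ((A + s • N) (e i)) ((A + s • N) (e j)) = _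
    have hJ : ∀ i j, inner ℝ (K.J (A (e i))) (A (e j)) = 0 := fun i j => by
      rw [real_inner_comm, h.inner_frame_J]
    simp only [hY, Matrix.add_apply, Matrix.smul_apply, smul_eq_mul, hP, Matrix.of_apply,
      add_apply, smul_apply, hN, inner_add_left, inner_add_right, real_inner_smul_left,
      real_inner_smul_right, inner_sum, sum_inner, h.inner_frame, h.inner_frame_J, hJ,
      K.J_isometry, mul_ite, mul_one, mul_zero, Finset.sum_const_zero,
      Finset.sum_ite_eq', Finset.mem_univ, if_true, Matrix.one_apply]
    have : ∑ k, H j k * (s * H i k) = s * ∑ k, H i k * H j k := by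
      rw [Finset.mul_sum]
      exact Finset.sum_congr rfl fun k _ => by ring
    rw [this]
    ring
  have hline : ∀ s : ℝ, pullbackDet K.S (A + s • N) = compoundDet (X s) (Y s) := fun s => by
    rw [← hXs, ← hYs, compoundDet_frameMat _ _ (isUnit_det_frameCols h.frameMat_inner)]
  -- First and second derivatives of these matrices.
  have dX : ∀ s i j, HasDerivAt (fun r => X r i j) ((K₁ - (2 * s) • R) i j) s := by
    intro s i j
    have := (((hasDerivAt_id s).mul_const (K₁ i j)).const_add (Matrix.diagonal σ i j)).sub
      (((hasDerivAt_id s).pow 2).mul_const (R i j))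
    refine this.congr_deriv ?_
    simp
  have dY : ∀ s i j, HasDerivAt (fun r => Y r i j) (((2 * s) • P) i j) s := by
    intro s i j
    have := (((hasDerivAt_id s).pow 2).mul_const (P i j)).const_add
      ((1 : Matrix (Fin n) (Fin n) ℝ) i j)
    refine this.congr_deriv ?_
    simp
  have dX' : ∀ i j, HasDerivAt (fun r : ℝ => (K₁ - (2 * r) • R) i j) ((-(2 : ℝ) • R) i j) 0 := by
    intro i j
    have := (((hasDerivAt_id (0 : ℝ)).const_mul 2).mul_const (R i j)).const_sub (K₁ i j)
    refine this.congr_deriv ?_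
    simp
  have dY' : ∀ i j, HasDerivAt (fun r : ℝ => ((2 * r) • P) i j) (((2 : ℝ) • P) i j) 0 := by
    intro i j
    have := ((hasDerivAt_id (0 : ℝ)).const_mul 2).mul_const (P i j)
    refine this.congr_deriv ?_
    simp
  have cX : ∀ i j, ContDiff ℝ 1 fun r => X r i j := fun i j => by
    simp only [hX, Matrix.sub_apply, Matrix.add_apply, Matrix.smul_apply, smul_eq_mul]
    fun_prop
  have cY : ∀ i j, ContDiff ℝ 1 fun r => Y r i j := fun i j => by
    simp only [hY, Matrix.add_apply, Matrix.smul_apply, smul_eq_mul]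
    fun_prop
  have hX0 : X 0 = Matrix.diagonal σ := by simp [hX]
  have hY0 : Y 0 = 1 := by simp [hY]
  set d : IndexPair n → ℝ := fun q => σ q.1.1 + σ q.1.2 with hd
  have hd0 : ∀ q, 0 < d q := fun q => hl.add_pos q.2.ne
  have hM0 : wedge (X 0) (Y 0) = Matrix.diagonal d := by
    rw [hX0, hY0, ← secondCompound_eq_wedge, secondCompound_diagonal]
  have hC0 : minors (Y 0) = Matrix.diagonal fun _ => 1 := by
    rw [hY0, minors_one, Matrix.diagonal_one]
  have e1 := hasDerivAt_trace_inv_mul (M := fun s => wedge (X s) (Y s))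
    (M' := fun s => wedge (K₁ - (2 * s) • R) (Y s) + wedge (X s) ((2 * s) • P))
    (M'' := (wedge (-(2 : ℝ) • R) (Y 0) + wedge (K₁ - (2 * (0 : ℝ)) • R) ((2 * (0 : ℝ)) • P)) +
      (wedge (K₁ - (2 * (0 : ℝ)) • R) ((2 * (0 : ℝ)) • P) + wedge (X 0) ((2 : ℝ) • P)))
    (fun i j => (contDiff_wedge cX cY i j).contDiffAt)
    (HasDerivAt.wedge (dX 0) (dY 0))
    (fun α β => (HasDerivAt.wedge dX' (dY 0) α β).add (HasDerivAt.wedge (dX 0) dY' α β))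
    hM0 (fun q => (hd0 q).ne')
  have e2 := hasDerivAt_trace_inv_mul (M := fun s => minors (Y s))
    (M' := fun s => wedge (Y s) ((2 * s) • P))
    (fun i j => (contDiff_minors cY i j).contDiffAt)
    (HasDerivAt.minors (dY 0)) (HasDerivAt.wedge (dY 0) dY') hC0 (fun q => one_ne_zero)
  have m1 : ∀ᶠ s in 𝓝 (0 : ℝ), (wedge (X s) (Y s)).det ≠ 0 := by
    refine ContinuousAt.eventually_ne (g := fun s => (wedge (X s) (Y s)).det)
      (Continuous.matrix_det (continuous_matrix fun i j =>
        (contDiff_wedge cX cY i j).continuous)).continuousAt ?_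
    simp only [hM0, Matrix.det_diagonal]
    exact Finset.prod_ne_zero_iff.2 fun q _ => (hd0 q).ne'
  have m2 : ∀ᶠ s in 𝓝 (0 : ℝ), (minors (Y s)).det ≠ 0 := by
    refine ContinuousAt.eventually_ne (g := fun s => (minors (Y s)).det)
      (Continuous.matrix_det (continuous_matrix fun i j =>
        (contDiff_minors cY i j).continuous)).continuousAt ?_
    simp [hC0]
  have e3 : ∀ᶠ s in 𝓝 (0 : ℝ), HasDerivAt (fun r : ℝ => logPullbackDet K.S (A + r • N))
      (((wedge (X s) (Y s))⁻¹ * (wedge (K₁ - (2 * s) • R) (Y s) + wedge (X s) ((2 * s) • P))).trace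
        - ((minors (Y s))⁻¹ * wedge (Y s) ((2 * s) • P)).trace) s := by
    filter_upwards [m1.eventually_nhds, m2.eventually_nhds] with s h1 h2
    refine ((hasDerivAt_log_det (HasDerivAt.wedge (dX s) (dY s)) h1.self_of_nhds).sub
      (hasDerivAt_log_det (HasDerivAt.minors (dY s)) h2.self_of_nhds)).congr_of_eventuallyEq ?_
    filter_upwards [h1, h2] with r g1 g2
    rw [logPullbackDet, hline, compoundDet, Real.log_div g1 g2, Pi.sub_apply]
  rw [fderiv_fderiv_eq_of_hasDerivAt hΦ e3 (e1.sub e2)]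
  rw [← sum_indexPair (evolutionQuadratic lam H)]
  -- Both entries are `(1 - λ_i² λ_j²) / ((1 + λ_i²) (1 + λ_j²))` times `H i j`.
  have hKs : ∀ i j, K₁ i j = K₁ j i := by
    intro i j
    simp only [hK₁, Matrix.of_apply, hH j i]
    have := (ModelSplitting.one_add_sq_pos (lam i)).ne'
    have := (ModelSplitting.one_add_sq_pos (lam j)).ne'
    field_simp
    ring
  have w1 : ∀ Z, wedge Z (0 : Matrix (Fin n) (Fin n) ℝ) = 0 := fun Z => by
    ext; simp [wedge]
  simp only [zero_smul, w1, sub_zero, add_zero, zero_add, Matrix.zero_apply, mul_zero, zero_div,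
    Finset.sum_const_zero, hX0, hY0, div_one]
  -- The matrix `wedge K₁ 1` is symmetric, so its off-diagonal entries contribute squares.
  have hsq : ∑ q, ((K₁ q.1.1 q.1.1 + K₁ q.1.2 q.1.2) ^ 2 / d q ^ 2) ≤
      ∑ p, ∑ q, wedge K₁ 1 p q * wedge K₁ 1 q p / (d p * d q) := by
    have hs : ∀ p q, wedge K₁ 1 q p = wedge K₁ 1 p q := fun p q => by
      have h1 : K₁.transpose = K₁ := by ext i j; exact hKs j i
      have := congrFun (congrFun (wedge_transpose K₁ 1) p) q
      rwa [h1, Matrix.transpose_one] at this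
    refine Finset.sum_le_sum fun p _ => ?_
    refine le_trans (le_of_eq ?_) (Finset.single_le_sum (fun q _ => ?_) (Finset.mem_univ p))
    · have : wedge K₁ 1 p p = K₁ p.1.1 p.1.1 + K₁ p.1.2 p.1.2 := by
        simp [wedge, p.2.ne, p.2.ne']
      rw [this]
      ring
    · rw [hs p q]
      exact div_nonneg (mul_self_nonneg _) (mul_pos (hd0 p) (hd0 q)).le
  have hmain : ∀ q : IndexPair n, evolutionQuadratic lam H q.1.1 q.1.2 ≤
      -((wedge (-(2 : ℝ) • R) 1 + wedge (Matrix.diagonal σ) ((2 : ℝ) • P)) q q / d q)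
        + wedge 1 ((2 : ℝ) • P) q q + (K₁ q.1.1 q.1.1 + K₁ q.1.2 q.1.2) ^ 2 / d q ^ 2 := by
    intro q
    refine (evolutionQuadratic_le hl hH q.2.ne (σ := σ) fun _ => rfl).trans (le_of_eq ?_)
    simp only [wedge, Matrix.add_apply, Matrix.of_apply, Matrix.smul_apply, smul_eq_mul,
      Matrix.one_apply_eq, Matrix.one_apply_ne q.2.ne, Matrix.one_apply_ne q.2.ne',
      Matrix.diagonal_apply_eq, Matrix.diagonal_apply_ne _ q.2.ne,
      Matrix.diagonal_apply_ne _ q.2.ne', hK₁, hR, hP]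
    congr 1
    have h0 := (hd0 q).ne'
    have e : ∑ k, (H q.1.1 k ^ 2 * (σ k + σ q.1.1) + H q.1.2 k ^ 2 * (σ k + σ q.1.2)) =
        ∑ k, H q.1.1 k * H q.1.1 k * σ k + (∑ k, H q.1.1 k * H q.1.1 k) * σ q.1.1
        + (∑ k, H q.1.2 k * H q.1.2 k * σ k + (∑ k, H q.1.2 k * H q.1.2 k) * σ q.1.2) := by
      simp only [Finset.sum_mul, ← Finset.sum_add_distrib]
      exact Finset.sum_congr rfl fun k _ => by ring
    rw [e]
    simp only [hd] at h0 ⊢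
    field_simp
    ring
  have hfin := Finset.sum_le_sum fun q (_ : q ∈ Finset.univ) => hmain q
  simp only [Finset.sum_add_distrib, Finset.sum_neg_distrib] at hfin
  linarith

end Hessian

/-! ### Two-convexity as a condition on planes -/

section TwoConvexity

open Filter Topology

variable {n : ℕ}

/-- Lagrange's identity for two diagonal quadratic forms. -/
theorem lagrange_identity (f g c d : Fin n → ℝ) :
    (∑ i, f i * (c i * c i)) * (∑ i, g i * (d i * d i))
      + (∑ i, f i * (d i * d i)) * (∑ i, g i * (c i * c i))
      - 2 * ((∑ i, f i * (c i * d i)) * ∑ i, g i * (c i * d i)) =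
    ∑ q : IndexPair n, (f q.1.1 * g q.1.2 + f q.1.2 * g q.1.1) *
      (c q.1.1 * d q.1.2 - c q.1.2 * d q.1.1) ^ 2 := by
  have h := sum_sum_eq_diag_add_indexPair fun i j => f i * g j * (c i * d j - c j * d i) ^ 2
  have h0 : ∀ i, f i * g i * (c i * d i - c i * d i) ^ 2 = 0 := fun i => by ring
  simp only [h0, Finset.sum_const_zero, zero_add] at h
  have h2 : ∀ q : IndexPair n, f q.1.1 * g q.1.2 * (c q.1.1 * d q.1.2 - c q.1.2 * d q.1.1) ^ 2
      + f q.1.2 * g q.1.1 * (c q.1.2 * d q.1.1 - c q.1.1 * d q.1.2) ^ 2 =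
      (f q.1.1 * g q.1.2 + f q.1.2 * g q.1.1) * (c q.1.1 * d q.1.2 - c q.1.2 * d q.1.1) ^ 2 :=
    fun q => by ring
  simp only [h2] at h
  rw [← h, Finset.sum_mul_sum, Finset.sum_mul_sum, Finset.sum_mul_sum, Finset.mul_sum,
    ← Finset.sum_add_distrib, ← Finset.sum_sub_distrib]
  refine Finset.sum_congr rfl fun i _ => ?_
  rw [Finset.mul_sum, ← Finset.sum_add_distrib, ← Finset.sum_sub_distrib]
  exact Finset.sum_congr rfl fun j _ => by ring

namespace ModelSplitting

variable (K : ModelSplitting n)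

/-- The metric on `ℝⁿ` for which `π₁ ∘ A` is an isometry. -/
def graphMetric (A : Euc n →L[ℝ] Euc (2 * n)) (v w : Euc n) : ℝ :=
  inner ℝ (K.π₁ (A v)) (K.π₁ (A w))

/-- The trace over the plane spanned by `v` and `w` of the symmetric form of which the image of `A`
is the graph, up to a positive factor. -/
def planeTrace (A : Euc n →L[ℝ] Euc (2 * n)) (v w : Euc n) : ℝ :=
  K.S (A v) (A v) * K.graphMetric A w w + K.S (A w) (A w) * K.graphMetric A v v
    - 2 * (K.S (A v) (A w) * K.graphMetric A v w)

/-- One plus the determinant over the plane spanned by `v` and `w` of the symmetric form of which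
the image of `A` is the graph, up to a positive factor. -/
def planeDet (A : Euc n →L[ℝ] Euc (2 * n)) (v w : Euc n) : ℝ :=
  (K.graphMetric A v v * K.graphMetric A w w - K.graphMetric A v w ^ 2)
    + (K.S (A v) (A v) * K.S (A w) (A w) - K.S (A v) (A w) ^ 2)

/-- Two-convexity of a linear map without reference to adapted frames: the form of which its image
is the graph has positive trace, and determinant larger than `-1`, over every plane. -/
def IsTwoConvexMap (A : Euc n →L[ℝ] Euc (2 * n)) : Prop :=
  ∀ v w : Euc n, ‖v‖ = 1 → ‖w‖ = 1 → inner ℝ v w = (0 : ℝ) →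
    0 < K.planeTrace A v w ∧ 0 < K.planeDet A v w

variable {K} {A : Euc n →L[ℝ] Euc (2 * n)} {e : Fin n → Euc n} {a : Fin n → Euc (2 * n)}
  {lam : Fin n → ℝ}

/-- The coordinates of a vector in a frame. -/
def frameCoord (e : Fin n → Euc n) (v : Euc n) : Fin n → ℝ := (frameCols e)⁻¹.mulVec v

theorem frameCoord_add (v w : Euc n) : frameCoord e (v + w) = frameCoord e v + frameCoord e w := by
  simp [frameCoord, Matrix.mulVec_add]

theorem frameCoord_smul (r : ℝ) (v : Euc n) : frameCoord e (r • v) = r • frameCoord e v := by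
  simp [frameCoord, Matrix.mulVec_smul]

theorem eq_sum_frameCoord (he : IsUnit (frameCols e).det) (v : Euc n) :
    v = ∑ i, frameCoord e v i • e i := by
  ext b
  have h : (frameCols e).mulVec (frameCoord e v) = v := by
    rw [frameCoord, Matrix.mulVec_mulVec, Matrix.mul_nonsing_inv _ he, Matrix.one_mulVec]
  rw [← congrFun h b]
  simp [Matrix.mulVec, dotProduct, frameCols, mul_comm]

namespace IsAdapted

theorem S_eq_sum (h : K.IsAdapted A e a lam) (v w : Euc n) : K.S (A v) (A w) =
    ∑ i, lam i / (1 + lam i ^ 2) * (frameCoord e v i * frameCoord e w i) := by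
  have he := isUnit_det_frameCols h.frameMat_inner
  conv_lhs => rw [eq_sum_frameCoord he v, eq_sum_frameCoord he w]
  simp only [map_sum, map_smul, sum_apply, smul_apply, h.S_frame, smul_eq_mul, mul_ite, mul_zero,
    Finset.sum_ite_eq', Finset.mem_univ, if_true]
  exact Finset.sum_congr rfl fun i _ => by ring

theorem graphMetric_frame (h : K.IsAdapted A e a lam) (i j : Fin n) :
    K.graphMetric A (e i) (e j) = if i = j then 1 / (1 + lam i ^ 2) else 0 := by
  rw [graphMetric, h.π₁_frame, h.π₁_frame, real_inner_smul_left, real_inner_smul_right,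
    h.orthonormal]
  split_ifs with hij
  · subst hij
    rw [mul_one, inv_sqrt_mul_self]
  · ring

theorem graphMetric_eq_sum (h : K.IsAdapted A e a lam) (v w : Euc n) : K.graphMetric A v w =
    ∑ i, 1 / (1 + lam i ^ 2) * (frameCoord e v i * frameCoord e w i) := by
  have he := isUnit_det_frameCols h.frameMat_inner
  have h1 := h.graphMetric_frame
  rw [graphMetric]
  simp only [graphMetric] at h1
  conv_lhs => rw [eq_sum_frameCoord he v, eq_sum_frameCoord he w]
  simp only [map_sum, map_smul, sum_inner, inner_sum, real_inner_smul_left, real_inner_smul_right,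
    h1, mul_ite, mul_zero, Finset.sum_ite_eq', Finset.mem_univ, if_true]
  exact Finset.sum_congr rfl fun i _ => by ring

theorem planeTrace_eq_sum (h : K.IsAdapted A e a lam) (v w : Euc n) : K.planeTrace A v w =
    ∑ q : IndexPair n, (lam q.1.1 + lam q.1.2) / ((1 + lam q.1.1 ^ 2) * (1 + lam q.1.2 ^ 2)) *
      (frameCoord e v q.1.1 * frameCoord e w q.1.2
        - frameCoord e v q.1.2 * frameCoord e w q.1.1) ^ 2 := by
  rw [planeTrace]
  simp only [h.S_eq_sum, h.graphMetric_eq_sum]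
  rw [lagrange_identity]
  refine Finset.sum_congr rfl fun q _ => ?_
  have := (one_add_sq_pos (lam q.1.1)).ne'
  have := (one_add_sq_pos (lam q.1.2)).ne'
  congr 1
  field_simp

theorem planeDet_eq_sum (h : K.IsAdapted A e a lam) (v w : Euc n) : K.planeDet A v w =
    ∑ q : IndexPair n, (1 + lam q.1.1 * lam q.1.2) / ((1 + lam q.1.1 ^ 2) * (1 + lam q.1.2 ^ 2)) *
      (frameCoord e v q.1.1 * frameCoord e w q.1.2
        - frameCoord e v q.1.2 * frameCoord e w q.1.1) ^ 2 := by
  have h1 := lagrange_identity (fun i => 1 / (1 + lam i ^ 2)) (fun i => 1 / (1 + lam i ^ 2))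
    (frameCoord e v) (frameCoord e w)
  have h2 := lagrange_identity (fun i => lam i / (1 + lam i ^ 2))
    (fun i => lam i / (1 + lam i ^ 2)) (frameCoord e v) (frameCoord e w)
  have h3 : 2 * K.planeDet A v w = ∑ q : IndexPair n, 2 * ((1 + lam q.1.1 * lam q.1.2) /
      ((1 + lam q.1.1 ^ 2) * (1 + lam q.1.2 ^ 2)) *
      (frameCoord e v q.1.1 * frameCoord e w q.1.2
        - frameCoord e v q.1.2 * frameCoord e w q.1.1) ^ 2) := by
    rw [planeDet]
    simp only [h.S_eq_sum, h.graphMetric_eq_sum]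
    have h4 := congrArg₂ (· + ·) h1 h2
    simp only [← Finset.sum_add_distrib] at h4
    refine Eq.trans ?_ (h4.trans (Finset.sum_congr rfl fun q _ => ?_))
    · ring
    · have := (one_add_sq_pos (lam q.1.1)).ne'
      have := (one_add_sq_pos (lam q.1.2)).ne'
      field_simp
      ring
  rw [← Finset.mul_sum] at h3
  exact mul_left_cancel₀ two_ne_zero h3

theorem isTwoConvexMap (h : K.IsAdapted A e a lam) (hl : TwoConvexAngles lam) :
    K.IsTwoConvexMap A := by
  intro v w hv hw hvw
  have he := isUnit_det_frameCols h.frameMat_inner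
  -- As `v` and `w` are linearly independent, one of their minors does not vanish.
  have hp : ∃ q : IndexPair n, frameCoord e v q.1.1 * frameCoord e w q.1.2
        - frameCoord e v q.1.2 * frameCoord e w q.1.1 ≠ 0 := by
    by_contra! hq
    have hq' : ∀ i j, frameCoord e v i * frameCoord e w j =
        frameCoord e w i * frameCoord e v j := by
      intro i j
      rcases lt_trichotomy i j with hij | hij | hij
      · linarith [hq ⟨(i, j), hij⟩]
      · subst hij; ring
      · linarith [hq ⟨(j, i), hij⟩]
    have h1 : ∀ i, frameCoord e v i • w = frameCoord e w i • v := by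
      intro i
      conv_lhs => rw [eq_sum_frameCoord he w]
      conv_rhs => rw [eq_sum_frameCoord he v]
      simp only [Finset.smul_sum, smul_smul, hq']
    have h2 : ∀ i, frameCoord e v i = 0 := by
      intro i
      have := congrArg (inner ℝ w) (h1 i)
      rw [inner_smul_right, inner_smul_right, real_inner_self_eq_norm_sq, hw, real_inner_comm,
        hvw] at this
      simpa using this
    have h3 : v = 0 := by
      rw [eq_sum_frameCoord he v]
      simp [h2]
    rw [h3, norm_zero] at hv
    exact zero_ne_one hv
  obtain ⟨q₀, hq₀⟩ := hp
  have hk : ∀ q : IndexPair n, 0 < (1 + lam q.1.1 ^ 2) * (1 + lam q.1.2 ^ 2) := fun q =>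
    mul_pos (one_add_sq_pos _) (one_add_sq_pos _)
  rw [h.planeTrace_eq_sum, h.planeDet_eq_sum]
  constructor
  · exact Finset.sum_pos'
      (fun q _ => mul_nonneg (div_pos (hl _ _ q.2.ne).1 (hk q)).le (sq_nonneg _))
      ⟨q₀, Finset.mem_univ _, mul_pos (div_pos (hl _ _ q₀.2.ne).1 (hk q₀)) (by positivity)⟩
  · exact Finset.sum_pos'
      (fun q _ => mul_nonneg (div_pos (hl _ _ q.2.ne).2 (hk q)).le (sq_nonneg _))
      ⟨q₀, Finset.mem_univ _, mul_pos (div_pos (hl _ _ q₀.2.ne).2 (hk q₀)) (by positivity)⟩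

/-- The values of `planeTrace` and `planeDet` on the plane of two frame vectors, up to a positive
factor, are attained at an orthonormal pair. -/
theorem exists_orthonormal_pair (h : K.IsAdapted A e a lam) {i j : Fin n} (hij : i ≠ j) :
    ∃ v w : Euc n, ‖v‖ = 1 ∧ ‖w‖ = 1 ∧ inner ℝ v w = (0 : ℝ) ∧ ∃ r : ℝ, 0 < r ∧
      r * K.planeTrace A v w = lam i + lam j ∧ r * K.planeDet A v w = 1 + lam i * lam j := by
  -- Orthonormalize `e i`, `e j` with respect to the Euclidean metric of `ℝⁿ`.
  have h0 : e i ≠ 0 := by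
    intro h0
    have := h.inner_frame i i
    rw [h0, map_zero, inner_zero_left, if_pos rfl] at this
    exact zero_ne_one this
  set α := ‖e i‖ with hα
  have hα0 : 0 < α := norm_pos_iff.2 h0
  obtain ⟨v, hv⟩ : ∃ v : Euc n, v = α⁻¹ • e i := ⟨_, rfl⟩
  have hvi : e i = α • v := by rw [hv, smul_smul, mul_inv_cancel₀ hα0.ne', one_smul]
  have hv1 : ‖v‖ = 1 := by
    rw [hv, norm_smul, norm_inv, norm_norm, inv_mul_cancel₀ hα0.ne']
  set β : ℝ := inner ℝ v (e j) with hβ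
  obtain ⟨u, hu⟩ : ∃ u : Euc n, u = e j - β • v := ⟨_, rfl⟩
  have hu0 : u ≠ 0 := by
    intro hu0
    have h1 : e j = (β * α⁻¹) • e i := by
      rw [← smul_smul, ← hv, ← sub_eq_zero, ← hu, hu0]
    have h2 := h.inner_frame j j
    have h3 := h.inner_frame i j
    nth_rewrite 1 [h1] at h2
    rw [map_smul, real_inner_smul_left, h3, if_neg hij, mul_zero, if_pos rfl] at h2
    exact zero_ne_one h2
  set γ := ‖u‖ with hγ
  have hγ0 : 0 < γ := norm_pos_iff.2 hu0
  obtain ⟨w, hw⟩ : ∃ w : Euc n, w = γ⁻¹ • u := ⟨_, rfl⟩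
  have hwj : e j = β • v + γ • w := by
    rw [hw, smul_smul, mul_inv_cancel₀ hγ0.ne', one_smul, hu, add_sub_cancel]
  have hw1 : ‖w‖ = 1 := by
    rw [hw, norm_smul, norm_inv, norm_norm, inv_mul_cancel₀ hγ0.ne']
  have hvw : inner ℝ v w = (0 : ℝ) := by
    rw [hw, hu, inner_smul_right, inner_sub_right, inner_smul_right, real_inner_self_eq_norm_sq,
      hv1, ← hβ]
    ring
  have hp : ∀ k l, frameCoord e (e i) k * frameCoord e (e j) l
      - frameCoord e (e i) l * frameCoord e (e j) k =
      α * γ * (frameCoord e v k * frameCoord e w l - frameCoord e v l * frameCoord e w k) := by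
    intro k l
    rw [hvi, hwj, frameCoord_add, frameCoord_smul, frameCoord_smul, frameCoord_smul]
    simp only [Pi.add_apply, Pi.smul_apply, smul_eq_mul]
    ring
  have hT : K.planeTrace A (e i) (e j) = (α * γ) ^ 2 * K.planeTrace A v w := by
    rw [h.planeTrace_eq_sum, h.planeTrace_eq_sum, Finset.mul_sum]
    exact Finset.sum_congr rfl fun q _ => by rw [hp]; ring
  have hD : K.planeDet A (e i) (e j) = (α * γ) ^ 2 * K.planeDet A v w := by
    rw [h.planeDet_eq_sum, h.planeDet_eq_sum, Finset.mul_sum]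
    exact Finset.sum_congr rfl fun q _ => by rw [hp]; ring
  have k1 := one_add_sq_pos (lam i)
  have k2 := one_add_sq_pos (lam j)
  refine ⟨v, w, hv1, hw1, hvw, (1 + lam i ^ 2) * (1 + lam j ^ 2) * (α * γ) ^ 2, by positivity,
    ?_, ?_⟩
  · rw [mul_assoc, ← hT, planeTrace]
    simp only [h.S_frame, h.graphMetric_frame, if_true, if_neg hij]
    field_simp
    ring
  · rw [mul_assoc, ← hD, planeDet]
    simp only [h.S_frame, h.graphMetric_frame, if_true, if_neg hij]
    field_simp
    ring

theorem twoConvexAngles (h : K.IsAdapted A e a lam) (hA : K.IsTwoConvexMap A) :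
    TwoConvexAngles lam := by
  intro i j hij
  obtain ⟨v, w, hv, hw, hvw, r, hr, h1, h2⟩ := h.exists_orthonormal_pair hij
  obtain ⟨h3, h4⟩ := hA v w hv hw hvw
  rw [← h1, ← h2]
  exact ⟨mul_pos hr h3, mul_pos hr h4⟩

theorem pullbackDet_pos (h : K.IsAdapted A e a lam) (hl : TwoConvexAngles lam) :
    0 < pullbackDet K.S A := by
  rw [h.pullbackDet_eq_prod]
  refine Finset.prod_pos fun i _ => Finset.prod_pos fun j hj => ?_
  have hij := (Finset.mem_Ioi.1 hj).ne
  exact div_pos (mul_pos (hl i j hij).1 (hl i j hij).2)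
    (mul_pos (one_add_sq_pos _) (one_add_sq_pos _))

/-- If the inequalities of two-convexity hold in the weak sense, they are strict when
`det S^{[2]} ≠ 0`, since `det S^{[2]}` has all the quantities in question as factors. -/
theorem twoConvexAngles_of_limit (h : K.IsAdapted A e a lam)
    (hA : ∀ v w : Euc n, ‖v‖ = 1 → ‖w‖ = 1 → inner ℝ v w = (0 : ℝ) →
      0 ≤ K.planeTrace A v w ∧ 0 ≤ K.planeDet A v w)
    (hdet : pullbackDet K.S A ≠ 0) : TwoConvexAngles lam := by
  intro i j hij
  obtain ⟨v, w, hv, hw, hvw, r, hr, h1, h2⟩ := h.exists_orthonormal_pair hij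
  obtain ⟨h3, h4⟩ := hA v w hv hw hvw
  have h5 : 0 ≤ lam i + lam j := h1 ▸ mul_nonneg hr.le h3
  have h6 : 0 ≤ 1 + lam i * lam j := h2 ▸ mul_nonneg hr.le h4
  rw [h.pullbackDet_eq_prod, Finset.prod_ne_zero_iff] at hdet
  have key : ∀ i j, i < j → lam i + lam j ≠ 0 ∧ 1 + lam i * lam j ≠ 0 := by
    intro i j hij
    have := Finset.prod_ne_zero_iff.1 (hdet i (Finset.mem_univ _)) j (Finset.mem_Ioi.2 hij)
    exact ⟨left_ne_zero_of_mul (div_ne_zero_iff.1 this).1,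
      right_ne_zero_of_mul (div_ne_zero_iff.1 this).1⟩
  rcases lt_or_gt_of_ne hij with hlt | hlt
  · exact ⟨lt_of_le_of_ne h5 (key i j hlt).1.symm, lt_of_le_of_ne h6 (key i j hlt).2.symm⟩
  · have := key j i hlt
    rw [add_comm, mul_comm (lam j)] at this
    exact ⟨lt_of_le_of_ne h5 this.1.symm, lt_of_le_of_ne h6 this.2.symm⟩

/-- A limit of two-convex maps with `det S^{[2]}` bounded away from zero is two-convex. -/
theorem twoConvexAngles_of_tendsto (h : K.IsAdapted A e a lam) {ι : Type*} {l : Filter ι} [l.NeBot]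
    {B : ι → Euc n →L[ℝ] Euc (2 * n)} (hB : Tendsto B l (𝓝 A))
    (hconv : ∀ᶠ i in l, K.IsTwoConvexMap (B i)) (hdet : pullbackDet K.S A ≠ 0) :
    TwoConvexAngles lam := by
  refine h.twoConvexAngles_of_limit (fun v w hv hw hvw => ?_) hdet
  have h0 : Continuous K.π₁ := K.π₁.continuous_of_finiteDimensional
  have h1 : Continuous fun A : Euc n →L[ℝ] Euc (2 * n) => K.planeTrace A v w := by
    simp only [planeTrace, graphMetric]
    fun_prop
  have h2 : Continuous fun A : Euc n →L[ℝ] Euc (2 * n) => K.planeDet A v w := by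
    simp only [planeDet, graphMetric]
    fun_prop
  exact ⟨ge_of_tendsto ((h1.tendsto A).comp hB) (hconv.mono fun i hi => (hi v w hv hw hvw).1.le),
    ge_of_tendsto ((h2.tendsto A).comp hB) (hconv.mono fun i hi => (hi v w hv hw hvw).2.le)⟩

end IsAdapted

theorem continuous_planeTrace :
    Continuous fun p : (Euc n →L[ℝ] Euc (2 * n)) × Euc n × Euc n =>
      K.planeTrace p.1 p.2.1 p.2.2 := by
  have h : Continuous K.π₁ := K.π₁.continuous_of_finiteDimensional
  simp only [planeTrace, graphMetric]
  fun_prop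

theorem continuous_planeDet :
    Continuous fun p : (Euc n →L[ℝ] Euc (2 * n)) × Euc n × Euc n =>
      K.planeDet p.1 p.2.1 p.2.2 := by
  have h : Continuous K.π₁ := K.π₁.continuous_of_finiteDimensional
  simp only [planeDet, graphMetric]
  fun_prop

theorem isOpen_isTwoConvexMap : IsOpen {A | K.IsTwoConvexMap A} := by
  rw [isOpen_iff_mem_nhds]
  intro A hA
  set s : Set (Euc n × Euc n) :=
    (Metric.sphere 0 1 ×ˢ Metric.sphere 0 1) ∩ {p | inner ℝ p.1 p.2 = (0 : ℝ)} with hs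
  have hc : IsCompact s := ((isCompact_sphere _ _).prod (isCompact_sphere _ _)).inter_right
    (isClosed_eq (by fun_prop) continuous_const)
  have hP : ∀ p ∈ s, ∀ᶠ z : (Euc n →L[ℝ] Euc (2 * n)) × (Euc n × Euc n) in 𝓝 (A, p),
      0 < K.planeTrace z.1 z.2.1 z.2.2 ∧ 0 < K.planeDet z.1 z.2.1 z.2.2 := by
    rintro ⟨v, w⟩ ⟨⟨hv, hw⟩, hvw⟩
    have h0 := hA v w (by simpa using hv) (by simpa using hw) hvw
    have c1 : Tendsto _ (𝓝 (A, v, w)) _ := (continuous_planeTrace (K := K)).continuousAt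
    have c2 : Tendsto _ (𝓝 (A, v, w)) _ := (continuous_planeDet (K := K)).continuousAt
    exact (c1.eventually (lt_mem_nhds h0.1)).and (c2.eventually (lt_mem_nhds h0.2))
  have h := hc.eventually_forall_of_forall_eventually (x₀ := A)
    (P := fun B p => 0 < K.planeTrace B p.1 p.2 ∧ 0 < K.planeDet B p.1 p.2) hP
  filter_upwards [h] with B hB v w hv hw hvw
  exact hB (v, w) ⟨⟨by simpa using hv, by simpa using hw⟩, hvw⟩

/-- A Lagrangian subspace that is a graph over the range of `π₁` has an adapted frame: diagonalize
the symmetric map of which it is the graph. -/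
theorem exists_isAdapted (K : ModelSplitting n) {A : Euc n →L[ℝ] Euc (2 * n)}
    (hA : Function.Injective fun v => K.π₁ (A v))
    (hω : ∀ v w, inner ℝ (K.J (A v)) (A w) = (0 : ℝ)) : ∃ e a lam, K.IsAdapted A e a lam := by
  have hB0 : ∀ v, K.π₁ (A v) ∈ LinearMap.ker K.π₂ := fun v => K.π₂_eq_zero.2 (K.π₁_idem _)
  have hdim : Module.finrank ℝ (Euc n) = Module.finrank ℝ (LinearMap.ker K.π₂) := by
    rw [K.finrank_ker_π₂, finrank_euclideanSpace_fin]
  obtain ⟨B, hB⟩ : ∃ B : Euc n ≃ₗ[ℝ] LinearMap.ker K.π₂,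
      ∀ v, (B v : Euc (2 * n)) = K.π₁ (A v) :=
    ⟨((K.π₁ ∘ₗ A.toLinearMap).codRestrict _ hB0).linearEquivOfInjective
      (fun v w h => hA (congrArg Subtype.val h)) hdim, fun v => rfl⟩
  obtain ⟨T, hT⟩ : ∃ T : LinearMap.ker K.π₂ →ₗ[ℝ] LinearMap.ker K.π₂,
      ∀ x, (T x : Euc (2 * n)) = -K.J (K.π₂ (A (B.symm x))) :=
    ⟨(-(K.J ∘ₗ K.π₂ ∘ₗ A.toLinearMap ∘ₗ B.symm.toLinearMap)).codRestrict _ fun x => by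
      change K.π₂ (-K.J (K.π₂ (A (B.symm x)))) = 0
      rw [map_neg, K.π₂_eq_zero.2 (K.π₁_J_of_π₂ (K.π₁_π₂ _)), neg_zero], fun x => rfl⟩
  have hsymm : T.IsSymmetric := by
    intro x y
    obtain ⟨v, rfl⟩ := B.surjective x
    obtain ⟨w, rfl⟩ := B.surjective y
    rw [Submodule.coe_inner, Submodule.coe_inner, hT, hT, hB, hB, B.symm_apply_apply,
      B.symm_apply_apply]
    have h1 := hω v w
    have h2 : inner ℝ (K.J (K.π₁ (A v))) (K.π₁ (A w)) = (0 : ℝ) :=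
      K.ω_ker_π₂ _ (hB0 v) _ (hB0 w)
    have h3 : inner ℝ (K.J (K.π₂ (A v))) (K.π₂ (A w)) = (0 : ℝ) :=
      K.ω_ker_π₁ _ (K.π₁_π₂ _) _ (K.π₁_π₂ _)
    rw [← K.π_add (A v), ← K.π_add (A w), map_add, inner_add_left, inner_add_right,
      inner_add_right, h2, h3, K.J_skew (K.π₁ (A v))] at h1
    rw [inner_neg_left, inner_neg_right]
    linarith
  have hfin : Module.finrank ℝ (LinearMap.ker K.π₂) = n := K.finrank_ker_π₂
  obtain ⟨b, lam, hb⟩ : ∃ (b : OrthonormalBasis (Fin n) ℝ (LinearMap.ker K.π₂))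
      (lam : Fin n → ℝ), ∀ i, T (b i) = lam i • b i :=
    ⟨hsymm.eigenvectorBasis hfin, hsymm.eigenvalues hfin, hsymm.apply_eigenvectorBasis hfin⟩
  refine ⟨fun i => (1 / Real.sqrt (1 + lam i ^ 2)) • B.symm (b i), fun i => b i, lam, ?_, ?_, ?_⟩
  · exact fun i => K.π₂_eq_zero.1 (b i).2
  · intro i j
    have := orthonormal_iff_ite.1 b.orthonormal i j
    rwa [Submodule.coe_inner] at this
  · intro i
    have h2 := hT (b i)
    rw [hb, Submodule.coe_smul] at h2
    have h3 : K.π₂ (A (B.symm (b i))) = lam i • K.J (b i) := by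
      rw [← map_smul, h2, map_neg, K.J_sq, neg_neg]
    have h4 : K.π₁ (A (B.symm (b i))) = b i := by rw [← hB, B.apply_symm_apply]
    rw [map_smul, ← K.π_add (A (B.symm (b i))), h3, h4]

end ModelSplitting

end TwoConvexity

/-! ### Mean curvature in a flat space -/

section LocalFlow

open Filter Topology

variable {n : ℕ}

section MeanCurvature

variable {V : Type*} [NormedAddCommGroup V] [InnerProductSpace ℝ V]

/-- The contraction `∑ g^{ab} ∂_a ∂_b f` of the second derivatives with the induced metric. -/
def hessianTrace (f : Euc n → V) (y : Euc n) : V :=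
  ∑ a, ∑ b, (frameMat (innerSL ℝ) (fderiv ℝ f y) (stdFrame n))⁻¹ a b •
    fderiv ℝ (fderiv ℝ f) y (stdFrame n a) (stdFrame n b)

/-- The coordinates `∑ g^{ab} Γ^c_{ab}` of the tangential part of `hessianTrace`. -/
def contractedChristoffel (f : Euc n → V) (y : Euc n) : Euc n :=
  ∑ c, (∑ d, (frameMat (innerSL ℝ) (fderiv ℝ f y) (stdFrame n))⁻¹ c d *
    inner ℝ (fderiv ℝ f y (stdFrame n d)) (hessianTrace f y)) • stdFrame n c

theorem hessianTrace_eq {f : Euc n → V} {y : Euc n} {e : Fin n → Euc n}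
    (he : frameMat (innerSL ℝ) (fderiv ℝ f y) e = 1) :
    hessianTrace f y = ∑ i, fderiv ℝ (fderiv ℝ f) y (e i) (e i) :=
  sum_gram_inv_smul he (LinearMap.mk₂ ℝ (fun u v => fderiv ℝ (fderiv ℝ f) y u v)
    (by simp) (by simp) (by simp) (by simp))

theorem contractedChristoffel_eq {f : Euc n → V} {y : Euc n} {e : Fin n → Euc n}
    (he : frameMat (innerSL ℝ) (fderiv ℝ f y) e = 1) :
    contractedChristoffel f y =
      ∑ j, inner ℝ (fderiv ℝ f y (e j)) (hessianTrace f y) • e j := by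
  have h1 : ∀ j, inner ℝ (fderiv ℝ f y (e j)) (hessianTrace f y) =
      ∑ d, e j d * inner ℝ (fderiv ℝ f y (stdFrame n d)) (hessianTrace f y) := by
    intro j
    conv_lhs => rw [euc_eq_sum (e j)]
    simp only [map_sum, map_smul, sum_inner, real_inner_smul_left]
  have h2 : ∀ (r : ℝ) j, r • e j = ∑ c, (r * e j c) • stdFrame n c := fun r j => by
    conv_lhs => rw [euc_eq_sum (e j)]
    simp only [Finset.smul_sum, smul_smul]
  simp only [contractedChristoffel, gram_inv_apply he, h1, h2, Finset.sum_mul]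
  rw [Finset.sum_comm]
  refine Finset.sum_congr rfl fun c _ => ?_
  rw [← Finset.sum_smul, Finset.sum_comm]
  congr 1
  exact Finset.sum_congr rfl fun j _ => Finset.sum_congr rfl fun d _ => by ring

theorem differentiableAt_contractedChristoffel {f : Euc n → V} {x : Euc n}
    (hf : ContDiffAt ℝ ∞ f x)
    (hG : IsUnit (frameMat (innerSL ℝ) (fderiv ℝ f x) (stdFrame n)).det) :
    DifferentiableAt ℝ (contractedChristoffel f) x := by
  have cA : ContDiffAt ℝ ∞ (fderiv ℝ f) x := hf.fderiv_right (by simp)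
  have dA : DifferentiableAt ℝ (fderiv ℝ f) x := cA.differentiableAt (by simp)
  have cA' : ContDiffAt ℝ ∞ (fderiv ℝ (fderiv ℝ f)) x := cA.fderiv_right (by simp)
  have dA' : DifferentiableAt ℝ (fderiv ℝ (fderiv ℝ f)) x := cA'.differentiableAt (by simp)
  have dG : ∀ a b, DifferentiableAt ℝ
      (fun y => (frameMat (innerSL ℝ) (fderiv ℝ f y) (stdFrame n))⁻¹ a b) x := fun a b => by
    refine ContDiffAt.differentiableAt (n := ∞) ?_ (by simp)
    rw [← contDiffWithinAt_univ]
    exact ContDiffWithinAt.matrix_inv (M := fun y => frameMat (innerSL ℝ) (fderiv ℝ f y)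
      (stdFrame n)) (fun a b => ((contDiff_frameMat (innerSL ℝ) (stdFrame n) a b).contDiffAt.comp x
      cA).contDiffWithinAt) hG.ne_zero a b
  have dT : DifferentiableAt ℝ (hessianTrace f) x := by
    refine DifferentiableAt.fun_sum fun a _ => DifferentiableAt.fun_sum fun b _ => ?_
    exact (dG a b).smul ((dA'.clm_apply (differentiableAt_const _)).clm_apply
      (differentiableAt_const _))
  refine DifferentiableAt.fun_sum fun c _ => DifferentiableAt.smul_const
    (DifferentiableAt.fun_sum fun d _ => ?_) _
  exact (dG c d).mul ((dA.clm_apply (differentiableAt_const _)).inner ℝ dT)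

/-- The Laplace-Beltrami operator of the metric `G` in coordinates. -/
def coordLaplacian (G : Euc n → Matrix (Fin n) (Fin n) ℝ) (u : Euc n → ℝ) (x : Euc n) : ℝ :=
  ∑ a, ∑ b, (G x)⁻¹ a b * (pderiv a (pderiv b u) x - ∑ c, (1 / 2) * (∑ d, (G x)⁻¹ c d *
    (pderiv a (fun y => G y b d) x + pderiv b (fun y => G y a d) x
      - pderiv d (fun y => G y a b) x)) * pderiv c u x)

theorem coordLaplacian_congr {G G' : Euc n → Matrix (Fin n) (Fin n) ℝ} {u u' : Euc n → ℝ}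
    {x : Euc n} (hG : G =ᶠ[𝓝 x] G') (hu : u =ᶠ[𝓝 x] u') :
    coordLaplacian G u x = coordLaplacian G' u' x := by
  have h1 : ∀ a, pderiv a u x = pderiv a u' x := fun a => by rw [pderiv, pderiv, hu.fderiv_eq]
  have h2 : ∀ a b, pderiv a (pderiv b u) x = pderiv a (pderiv b u') x := fun a b => by
    have : pderiv b u =ᶠ[𝓝 x] pderiv b u' := by
      filter_upwards [hu.fderiv (𝕜 := ℝ)] with y hy
      rw [pderiv, pderiv, hy]
    rw [pderiv, pderiv, this.fderiv_eq]
  have h3 : ∀ a b c, pderiv a (fun y => G y b c) x = pderiv a (fun y => G' y b c) x :=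
    fun a b c => by
      have : (fun y => G y b c) =ᶠ[𝓝 x] fun y => G' y b c := hG.mono fun y hy => by
        simp only [hy]
      rw [pderiv, pderiv, this.fderiv_eq]
  simp only [coordLaplacian, h1, h2, h3, hG.self_of_nhds]

/-- The Laplacian of the metric induced by `f`, in a frame that `fderiv ℝ f x` maps to an
orthonormal one. -/
theorem coordLaplacian_eq {f : Euc n → V} {u : Euc n → ℝ} {x : Euc n} {e : Fin n → Euc n}
    (hf : ContDiffAt ℝ ∞ f x) (hu : ContDiffAt ℝ ∞ u x)
    (he : frameMat (innerSL ℝ) (fderiv ℝ f x) e = 1) :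
    coordLaplacian (fun y => frameMat (innerSL ℝ) (fderiv ℝ f y) (stdFrame n)) u x =
      ∑ i, fderiv ℝ (fderiv ℝ u) x (e i) (e i) - fderiv ℝ u x (contractedChristoffel f x) := by
  have cA : ContDiffAt ℝ ∞ (fderiv ℝ f) x := hf.fderiv_right (by simp)
  have dA := (cA.differentiableAt (by simp)).hasFDerivAt
  have du := (((hu.fderiv_right (m := ∞) (by simp)).differentiableAt (by simp))).hasFDerivAt
  have h1 : ∀ a b, pderiv a (pderiv b u) x =
      fderiv ℝ (fderiv ℝ u) x (stdFrame n a) (stdFrame n b) := fun a b => by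
    have h : HasFDerivAt (pderiv b u) _ x := du.apply_const (stdFrame n b)
    rw [pderiv, h.fderiv]
    rfl
  have sA : ∀ v w, fderiv ℝ (fderiv ℝ f) x v w = fderiv ℝ (fderiv ℝ f) x w v :=
    (hf.of_le two_le_infty).isSymmSndFDerivAt (by simp)
  set A := fderiv ℝ f x
  set A' := fderiv ℝ (fderiv ℝ f) x
  set G := frameMat (innerSL ℝ) A (stdFrame n)
  have h2 : ∀ a b c, pderiv a (fun y => frameMat (innerSL ℝ) (fderiv ℝ f y) (stdFrame n) b c) x =
      inner ℝ (A (stdFrame n b)) (A' (stdFrame n a) (stdFrame n c))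
        + inner ℝ (A' (stdFrame n a) (stdFrame n b)) (A (stdFrame n c)) := fun a b c => by
    have h : HasFDerivAt (fun y => frameMat (innerSL ℝ) (fderiv ℝ f y) (stdFrame n) b c) _ x :=
      (dA.apply_const (stdFrame n b)).inner ℝ (dA.apply_const (stdFrame n c))
    rw [pderiv, h.fderiv]
    simp [fderivInnerCLM_apply, A, A']
  have h3 : ∀ a b c, (1 / 2 : ℝ) * ∑ d, G⁻¹ c d *
      (pderiv a (fun y => frameMat (innerSL ℝ) (fderiv ℝ f y) (stdFrame n) b d) x
      + pderiv b (fun y => frameMat (innerSL ℝ) (fderiv ℝ f y) (stdFrame n) a d) x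
      - pderiv d (fun y => frameMat (innerSL ℝ) (fderiv ℝ f y) (stdFrame n) a b) x) =
      ∑ d, G⁻¹ c d * inner ℝ (A (stdFrame n d)) (A' (stdFrame n a) (stdFrame n b)) := by
    intro a b c
    rw [Finset.mul_sum]
    refine Finset.sum_congr rfl fun d _ => ?_
    rw [h2, h2, h2, sA (stdFrame n b) (stdFrame n a), sA (stdFrame n d) (stdFrame n a),
      sA (stdFrame n d) (stdFrame n b),
      real_inner_comm (A (stdFrame n d)) (A' (stdFrame n a) (stdFrame n b)),
      real_inner_comm (A' (stdFrame n a) (stdFrame n d)) (A (stdFrame n b))]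
    ring
  have h4 := sum_gram_inv_smul he (LinearMap.mk₂ ℝ (fun v w => fderiv ℝ (fderiv ℝ u) x v w)
    (by simp) (by simp) (by simp) (by simp))
  simp only [LinearMap.mk₂_apply, smul_eq_mul] at h4
  rw [← h4]
  have h5 : fderiv ℝ u x (contractedChristoffel f x) = ∑ a, ∑ b, G⁻¹ a b * ∑ c,
      (∑ d, G⁻¹ c d * inner ℝ (A (stdFrame n d)) (A' (stdFrame n a) (stdFrame n b))) *
        pderiv c u x := by
    simp only [contractedChristoffel, hessianTrace, map_sum, map_smul, smul_eq_mul, inner_sum,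
      real_inner_smul_right, Finset.mul_sum, Finset.sum_mul]
    simp only [pderiv]
    rw [Finset.sum_congr rfl fun c _ => Finset.sum_comm, Finset.sum_comm]
    refine Finset.sum_congr rfl fun a _ => ?_
    rw [Finset.sum_congr rfl fun c _ => Finset.sum_comm, Finset.sum_comm]
    refine Finset.sum_congr rfl fun b _ => ?_
    exact Finset.sum_congr rfl fun c _ => Finset.sum_congr rfl fun d _ => by ring
  rw [h5, coordLaplacian, ← Finset.sum_sub_distrib]
  refine Finset.sum_congr rfl fun a _ => ?_
  rw [← Finset.sum_sub_distrib]
  refine Finset.sum_congr rfl fun b _ => ?_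
  rw [← mul_sub, ← h1]
  congr 2
  exact Finset.sum_congr rfl fun c _ => congrArg (· * pderiv c u x) (h3 a b c)

end MeanCurvature

variable {K : ModelSplitting n} {f X : Euc n → Euc (2 * n)} {x : Euc n} {e : Fin n → Euc n}
  {a : Fin n → Euc (2 * n)} {lam : Fin n → ℝ}

/-- In a flat space, the mean curvature vector is the Laplacian of the immersion. -/
theorem velocity_eq {H : Euc (2 * n)} (h : K.IsAdapted (fderiv ℝ f x) e a lam)
    (hH : ∀ i, inner ℝ H (fderiv ℝ f x (e i)) = (0 : ℝ))
    (hH' : ∀ k, inner ℝ H (K.J (fderiv ℝ f x (e k))) =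
      ∑ i, (inner ℝ (fderiv ℝ (fderiv ℝ f) x (e i) (e i)) (K.J (fderiv ℝ f x (e k))) : ℝ)) :
    H = hessianTrace f x - fderiv ℝ f x (contractedChristoffel f x) := by
  rw [eq_sub_iff_add_eq, contractedChristoffel_eq h.frameMat_inner, h.eq_sum H]
  conv_rhs => rw [h.eq_sum (hessianTrace f x)]
  have h1 : ∀ k, inner ℝ (K.J (fderiv ℝ f x (e k))) H =
      (inner ℝ (K.J (fderiv ℝ f x (e k))) (hessianTrace f x) : ℝ) := fun k => by
    rw [hessianTrace_eq h.frameMat_inner, real_inner_comm, hH', real_inner_comm, sum_inner]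
  have h2 : ∀ k, inner ℝ (fderiv ℝ f x (e k)) H = (0 : ℝ) := fun k => by
    rw [real_inner_comm, hH]
  simp only [h1, h2, zero_smul, Finset.sum_const_zero, zero_add, map_sum, map_smul]
  rw [add_comm]

/-- The second fundamental form of a Lagrangian immersion is symmetric in its last two entries. -/
theorem inner_hessian_J_symm (hf : ContDiffAt ℝ ∞ f x)
    (hω : ∀ᶠ y in 𝓝 x, ∀ v w, inner ℝ (K.J (fderiv ℝ f y v)) (fderiv ℝ f y w) = (0 : ℝ))
    (z v w : Euc n) :
    inner ℝ (fderiv ℝ (fderiv ℝ f) x z v) (K.J (fderiv ℝ f x w)) =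
      (inner ℝ (fderiv ℝ (fderiv ℝ f) x z w) (K.J (fderiv ℝ f x v)) : ℝ) := by
  have cA : ContDiffAt ℝ ∞ (fderiv ℝ f) x := hf.fderiv_right (by simp)
  have dA := (cA.differentiableAt (by simp)).hasFDerivAt
  have h1 : HasFDerivAt (fun y => K.J (fderiv ℝ f y v))
      (K.J.toContinuousLinearMap.comp ((fderiv ℝ (fderiv ℝ f) x).flip v)) x :=
    K.J.toContinuousLinearMap.hasFDerivAt.comp x (dA.apply_const v)
  have h2 := (h1.inner ℝ (dA.apply_const w)).unique
    ((hasFDerivAt_const (0 : ℝ) x).congr_of_eventuallyEq (hω.mono fun y hy => hy v w))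
  have h3 := congrArg (fun T => T z) h2
  simp only [ContinuousLinearMap.comp_apply, ContinuousLinearMap.prod_apply,
    fderivInnerCLM_apply, ContinuousLinearMap.flip_apply, LinearMap.coe_toContinuousLinearMap',
    zero_apply] at h3
  rw [K.J_skew (fderiv ℝ (fderiv ℝ f) x z v),
    real_inner_comm (fderiv ℝ (fderiv ℝ f) x z w)] at h3
  linarith

/-- The evolution inequality of `log det S^{[2]}`, at a fixed time, for a Lagrangian immersion of
Euclidean space that moves with its mean curvature. -/
theorem evolution_inequality (hf : ContDiffAt ℝ ∞ f x)
    (hω : ∀ᶠ y in 𝓝 x, ∀ v w, inner ℝ (K.J (fderiv ℝ f y v)) (fderiv ℝ f y w) = (0 : ℝ))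
    (hX : X =ᶠ[𝓝 x] fun y => hessianTrace f y - fderiv ℝ f y (contractedChristoffel f y))
    (h : K.IsAdapted (fderiv ℝ f x) e a lam) (hl : TwoConvexAngles lam) :
    ∑ k, ∑ i, ∑ j ∈ Finset.Ioi i, evolutionQuadratic lam (fun i j =>
      inner ℝ (fderiv ℝ (fderiv ℝ f) x (e k) (e i)) (K.J (fderiv ℝ f x (e j)))) i j ≤
    fderiv ℝ (logPullbackDet K.S) (fderiv ℝ f x) (fderiv ℝ X x) -
      coordLaplacian (fun y => frameMat (innerSL ℝ) (fderiv ℝ f y) (stdFrame n))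
        (fun y => logPullbackDet K.S (fderiv ℝ f y)) x := by
  have hG := isUnit_det_gram h.frameMat_inner
  have hΦ := contDiffAt_logPullbackDet K.S hG (h.pullbackDet_pos hl).ne'
  have hinv : ∀ᶠ C in 𝓝 (fderiv ℝ f x), ∀ B : Euc n →L[ℝ] Euc n,
      fderiv ℝ (logPullbackDet K.S) C (C.comp B) = 0 :=
    hΦ.eventually_differentiableAt.mono fun C hC B => fderiv_logPullbackDet_comp K.S hC B
  have cA : ContDiffAt ℝ ∞ (fderiv ℝ f) x := hf.fderiv_right (by simp)
  have hu : ContDiffAt ℝ ∞ (fun y => logPullbackDet K.S (fderiv ℝ f y)) x := hΦ.comp x cA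
  rw [evolution_of_invariant hf hΦ hinv h.frameMat_inner
    (differentiableAt_contractedChristoffel hf hG) hX,
    coordLaplacian_eq hf hu h.frameMat_inner, sub_sub_cancel_left,
    ← Finset.sum_neg_distrib]
  refine Finset.sum_le_sum fun k _ => ?_
  rw [le_neg]
  refine logPullbackDet_hessian_le h hl (fun i j => inner_hessian_J_symm hf hω _ _ _)
    (fun i => ?_) hΦ
  rw [normalPart, sub_apply, ContinuousLinearMap.comp_apply, tangentialPart_apply,
    sub_eq_iff_eq_add]
  conv_lhs => rw [h.eq_sum (fderiv ℝ (fderiv ℝ f) x (e k) (e i))]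
  rw [add_comm]
  simp only [map_sum, map_smul]
  congr 1
  exact Finset.sum_congr rfl fun j _ => by rw [real_inner_comm]

end LocalFlow

/-! ### Families of maps that depend smoothly on time -/

section MixedPartials

open Filter Topology

variable {E V : Type*} [NormedAddCommGroup E] [NormedSpace ℝ E] [NormedAddCommGroup V]
  [NormedSpace ℝ V] {F : ℝ × E → V} {I : Set ℝ} {U : Set E}

theorem fderiv_slice (hU : IsOpen U) (hF : ContDiffOn ℝ ∞ F (I ×ˢ U)) {t : ℝ} (ht : t ∈ I) {x : E}
    (hx : x ∈ U) : HasFDerivAt (fun y => F (t, y))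
      ((fderivWithin ℝ F (I ×ˢ U) (t, x)).comp (ContinuousLinearMap.inr ℝ ℝ E)) x := by
  have h1 : HasFDerivWithinAt F (fderivWithin ℝ F (I ×ˢ U) (t, x)) (I ×ˢ U) (t, x) :=
    ((hF (t, x) ⟨ht, hx⟩).differentiableWithinAt (by simp)).hasFDerivWithinAt
  exact (h1.comp x (hasFDerivAt_prodMk_right t x).hasFDerivWithinAt
    (fun y hy => ⟨ht, hy⟩)).hasFDerivAt (hU.mem_nhds hx)

theorem derivWithin_slice (hI : UniqueDiffOn ℝ I) (hF : ContDiffOn ℝ ∞ F (I ×ˢ U)) {t : ℝ}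
    (ht : t ∈ I) {x : E} (hx : x ∈ U) :
    derivWithin (fun s => F (s, x)) I t = fderivWithin ℝ F (I ×ˢ U) (t, x) (1, 0) := by
  have h1 : HasFDerivWithinAt F (fderivWithin ℝ F (I ×ˢ U) (t, x)) (I ×ˢ U) (t, x) :=
    ((hF (t, x) ⟨ht, hx⟩).differentiableWithinAt (by simp)).hasFDerivWithinAt
  have h2 : HasDerivWithinAt (fun s : ℝ => (s, x)) ((1 : ℝ), (0 : E)) I t :=
    (hasDerivWithinAt_id t I).prodMk (hasDerivWithinAt_const t I x)
  exact (h1.comp_hasDerivWithinAt t h2 fun s hs => Set.mk_mem_prod hs hx).derivWithin (hI t ht)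

theorem contDiffOn_fderiv_slice (hI : UniqueDiffOn ℝ I) (hU : IsOpen U)
    (hF : ContDiffOn ℝ ∞ F (I ×ˢ U)) :
    ContDiffOn ℝ ∞ (fun q : ℝ × E => fderiv ℝ (fun y => F (q.1, y)) q.2) (I ×ˢ U) := by
  have h := hF.fderivWithin (m := ∞) (hI.prod hU.uniqueDiffOn) (by simp)
  refine (h.clm_comp (contDiffOn_const (c := ContinuousLinearMap.inr ℝ ℝ E))).congr ?_
  rintro ⟨t, x⟩ ⟨ht, hx⟩
  exact (fderiv_slice hU hF ht hx).fderiv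

/-- Mixed partial derivatives commute, up to the boundary of the time interval. -/
theorem hasDerivWithinAt_fderiv_slice (hI : UniqueDiffOn ℝ I) (hI' : I ⊆ closure (interior I))
    (hU : IsOpen U) (hF : ContDiffOn ℝ ∞ F (I ×ˢ U)) {t : ℝ} (ht : t ∈ I) {x : E} (hx : x ∈ U) :
    HasDerivWithinAt (fun s => fderiv ℝ (fun y => F (s, y)) x)
      (fderiv ℝ (fun y => derivWithin (fun s => F (s, y)) I t) x) I t := by
  have hΩ : UniqueDiffOn ℝ (I ×ˢ U) := hI.prod hU.uniqueDiffOn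
  set Λ := fderivWithin ℝ F (I ×ˢ U) with hΛ
  have cΛ : ContDiffOn ℝ ∞ Λ (I ×ˢ U) := hF.fderivWithin hΩ (by simp)
  have dΛ : HasFDerivWithinAt Λ (fderivWithin ℝ Λ (I ×ˢ U) (t, x)) (I ×ˢ U) (t, x) :=
    ((cΛ (t, x) ⟨ht, hx⟩).differentiableWithinAt (by simp)).hasFDerivWithinAt
  have hsymm : IsSymmSndFDerivWithinAt ℝ F (I ×ˢ U) (t, x) := by
    refine (hF (t, x) ⟨ht, hx⟩).isSymmSndFDerivWithinAt (by simp; exact two_le_infty) hΩ ?_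
      ⟨ht, hx⟩
    rw [interior_prod_eq, closure_prod_eq]
    exact ⟨hI' ht, subset_closure (hU.interior_eq.symm ▸ hx)⟩
  have h1 : HasDerivWithinAt (fun s : ℝ => (s, x)) ((1 : ℝ), (0 : E)) I t :=
    (hasDerivWithinAt_id t I).prodMk (hasDerivWithinAt_const t I x)
  have h2 : HasDerivWithinAt (fun s => Λ (s, x)) (fderivWithin ℝ Λ (I ×ˢ U) (t, x) (1, 0)) I t :=
    dΛ.comp_hasDerivWithinAt t h1 fun s hs => Set.mk_mem_prod hs hx
  have h3 : HasDerivWithinAt (fun s => (Λ (s, x)).comp (ContinuousLinearMap.inr ℝ ℝ E))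
      ((fderivWithin ℝ Λ (I ×ˢ U) (t, x) (1, 0)).comp (ContinuousLinearMap.inr ℝ ℝ E)) I t :=
    ((ContinuousLinearMap.compL ℝ E (ℝ × E) V).flip
      (ContinuousLinearMap.inr ℝ ℝ E)).hasFDerivAt.comp_hasDerivWithinAt t h2
  have h4 : fderiv ℝ (fun y => derivWithin (fun s => F (s, y)) I t) x =
      (fderivWithin ℝ Λ (I ×ˢ U) (t, x) (1, 0)).comp (ContinuousLinearMap.inr ℝ ℝ E) := by
    have h5 : HasFDerivAt (fun y => Λ (t, y))
        ((fderivWithin ℝ Λ (I ×ˢ U) (t, x)).comp (ContinuousLinearMap.inr ℝ ℝ E)) x :=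
      fderiv_slice hU cΛ ht hx
    have h6 := (h5.apply_const ((1 : ℝ), (0 : E))).congr_of_eventuallyEq
      (f₁ := fun y => derivWithin (fun s => F (s, y)) I t) (by
        filter_upwards [hU.mem_nhds hx] with y hy
        exact derivWithin_slice hI hF ht hy)
    rw [h6.fderiv]
    ext v
    exact hsymm _ _
  rw [h4]
  refine h3.congr_of_mem (fun s hs => ?_) ht
  exact (fderiv_slice hU hF hs hx).fderiv

end MixedPartials

/-! ### Charts, and parallel bundle maps in flat charts -/

section Charts

open Filter Topology

variable {m : ℕ} {X : Type*} [TopologicalSpace X] [ChartedSpace (Euc m) X]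
  {φ : OpenPartialHomeomorph X (Euc m)}

theorem mdifferentiable_of_mem_maximalAtlas (hφ : φ ∈ IsManifold.maximalAtlas (𝓡 m) ∞ X) :
    φ.MDifferentiable (𝓡 m) 𝓘(ℝ, Euc m) :=
  ⟨(contMDiffOn_of_mem_maximalAtlas hφ).mdifferentiableOn (by simp),
    (contMDiffOn_symm_of_mem_maximalAtlas hφ).mdifferentiableOn (by simp)⟩

/-- The differential of a chart, as a linear isomorphism. -/
def chartEquiv (hφ : φ ∈ IsManifold.maximalAtlas (𝓡 m) ∞ X) {p : X} (hp : p ∈ φ.source) :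
    Tan m p ≃ₗ[ℝ] Euc m :=
  ((mdifferentiable_of_mem_maximalAtlas hφ).mfderiv hp).toLinearEquiv

theorem chartEquiv_apply (hφ : φ ∈ IsManifold.maximalAtlas (𝓡 m) ∞ X) {p : X} (hp : p ∈ φ.source)
    (v : Tan m p) : chartEquiv hφ hp v = chartD φ p v := rfl

theorem chartD_chartSymmD (hφ : φ ∈ IsManifold.maximalAtlas (𝓡 m) ∞ X) {y : Euc m}
    (hy : y ∈ φ.target) (w : Euc m) : chartD φ (φ.symm y) (chartSymmD φ y w) = w :=
  congrArg (fun T => T w) ((mdifferentiable_of_mem_maximalAtlas hφ).comp_symm_deriv hy)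

theorem chartSymmD_chartD (hφ : φ ∈ IsManifold.maximalAtlas (𝓡 m) ∞ X) {y : Euc m}
    (hy : y ∈ φ.target) (v : Tan m (φ.symm y)) :
    chartSymmD φ y (chartD φ (φ.symm y) v) = v := by
  apply (chartEquiv hφ (φ.map_target hy)).injective
  rw [chartEquiv_apply, chartEquiv_apply, chartD_chartSymmD hφ hy]

theorem chartD_surjective (hφ : φ ∈ IsManifold.maximalAtlas (𝓡 m) ∞ X) {p : X}
    (hp : p ∈ φ.source) : Function.Surjective (chartD φ p) := (chartEquiv hφ hp).surjective

variable [IsManifold (𝓡 m) ∞ X]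

/-- A parallel bundle map has constant coefficients in a flat chart, near any point. -/
theorem IsParallel.exists_const {g : SmoothMetric m X}
    {A : ∀ p : X, Tan m p →ₗ[ℝ] Tan m p} (hA : IsParallel g A)
    {ψ : OpenPartialHomeomorph X (Euc m)} (hψ : IsFlatChart g ψ) {p : X} (hp : p ∈ ψ.source) :
    ∃ A₀ : Euc m →ₗ[ℝ] Euc m, ∀ᶠ q in 𝓝 p, ∀ v : Tan m q,
      chartD ψ q (A q v) = A₀ (chartD ψ q v) := by
  obtain ⟨r, hr, hball⟩ := Metric.isOpen_iff.1 ψ.open_target (ψ p) (ψ.map_source hp)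
  refine ⟨(chartEquiv hψ.1 hp).toLinearMap ∘ₗ A p ∘ₗ (chartEquiv hψ.1 hp).symm.toLinearMap, ?_⟩
  have hnear : ∀ᶠ q in 𝓝 p, q ∈ ψ.source ∧ ψ q ∈ Metric.ball (ψ p) r :=
    (ψ.open_source.mem_nhds hp |> fun h => (eventually_mem_set.2 h)).and
      ((ψ.continuousAt hp).eventually (Metric.ball_mem_nhds _ hr))
  -- In the chart, the coefficients have zero derivative on a ball.
  have hconst : ∀ z ∈ Metric.ball (ψ p) r, ∀ z' ∈ Metric.ball (ψ p) r, ∀ w,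
      chartD ψ (ψ.symm z) (A (ψ.symm z) (chartSymmD ψ z w)) =
        chartD ψ (ψ.symm z') (A (ψ.symm z') (chartSymmD ψ z' w)) := by
    intro z hz z' hz' w
    refine Metric.isOpen_ball.is_const_of_fderiv_eq_zero (𝕜 := ℝ)
      (f := fun z => chartD ψ (ψ.symm z) (A (ψ.symm z) (chartSymmD ψ z w)))
      (convex_ball (ψ p) r).isPreconnected (fun y hy => ?_) (fun y hy => ?_) hz hz'
    · exact (hA ψ hψ y (hball hy) w).differentiableAt.differentiableWithinAt
    · exact (hA ψ hψ y (hball hy) w).fderiv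
  have key : ∀ q q', q ∈ ψ.source → ψ q ∈ Metric.ball (ψ p) r → q' ∈ ψ.source →
      ψ q' ∈ Metric.ball (ψ p) r → ∀ (v : Tan m q) (v' : Tan m q'),
      chartD ψ q v = chartD ψ q' v' → chartD ψ q (A q v) = chartD ψ q' (A q' v') := by
    intro q q' hq hqr hq' hqr' v v' hv
    obtain ⟨z, hz, rfl⟩ : ∃ z ∈ ψ.target, ψ.symm z = q := ⟨ψ q, ψ.map_source hq, ψ.left_inv hq⟩
    obtain ⟨z', hz', rfl⟩ : ∃ z ∈ ψ.target, ψ.symm z = q' :=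
      ⟨ψ q', ψ.map_source hq', ψ.left_inv hq'⟩
    rw [ψ.right_inv hz] at hqr
    rw [ψ.right_inv hz'] at hqr'
    have h := hconst z hqr z' hqr' (chartD ψ (ψ.symm z) v)
    rw [chartSymmD_chartD hψ.1 hz, hv, chartSymmD_chartD hψ.1 hz'] at h
    exact h
  filter_upwards [hnear] with q hq v
  refine key q p hq.1 hq.2 hp (Metric.mem_ball_self hr) v
    ((chartEquiv hψ.1 hp).symm (chartD ψ q v)) ?_
  exact ((chartEquiv hψ.1 hp).apply_symm_apply _).symm

end Charts

section ModelOf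

open Filter Topology

variable {n : ℕ} {M : Type*} [TopologicalSpace M] [ChartedSpace (Euc (2 * n)) M]
  [IsManifold (𝓡 (2 * n)) ∞ M]

/-- The chart `ψ` identifies the structure of `K` at `q` with that of the linear model `N`. -/
structure Represents (K : FlatKahlerSplitting n M) (ψ : OpenPartialHomeomorph M (Euc (2 * n)))
    (N : ModelSplitting n) (q : M) : Prop where
  mem_source : q ∈ ψ.source
  J_eq : ∀ v : Tan (2 * n) q, chartD ψ q (K.J q v) = N.J (chartD ψ q v)
  π₁_eq : ∀ v : Tan (2 * n) q, chartD ψ q (K.π₁ q v) = N.π₁ (chartD ψ q v)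
  π₂_eq : ∀ v : Tan (2 * n) q, chartD ψ q (K.π₂ q v) = N.π₂ (chartD ψ q v)

/-- In a flat chart, the structure of `M` is that of a linear model with constant coefficients. -/
theorem exists_represents (K : FlatKahlerSplitting n M) {ψ : OpenPartialHomeomorph M (Euc (2 * n))}
    (hψ : IsFlatChart K.g ψ) {p : M} (hp : p ∈ ψ.source) :
    ∃ N : ModelSplitting n, ∀ᶠ q in 𝓝 p, Represents K ψ N q := by
  obtain ⟨J, hJ⟩ := K.J_parallel.exists_const hψ hp
  obtain ⟨P₁, hP₁⟩ := K.π₁_parallel.exists_const hψ hp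
  obtain ⟨P₂, hP₂⟩ := K.π₂_parallel.exists_const hψ hp
  have hs := chartD_surjective hψ.1 hp
  have hi := fun v w => hψ.2 p hp v w
  have e1 := hJ.self_of_nhds
  have e2 := hP₁.self_of_nhds
  have e3 := hP₂.self_of_nhds
  have hadd : ∀ v w : Tan (2 * n) p, chartD ψ p (v + w) = chartD ψ p v + chartD ψ p w :=
    (chartEquiv hψ.1 hp).map_add
  have hinj : ∀ v : Tan (2 * n) p, chartD ψ p v = 0 → v = 0 := fun v hv =>
    (chartEquiv hψ.1 hp).map_eq_zero_iff.1 hv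
  have hker : LinearMap.ker P₂ =
      (LinearMap.ker (K.π₂ p)).map (chartEquiv hψ.1 hp).toLinearMap := by
    ext w
    obtain ⟨v, rfl⟩ := hs w
    rw [LinearMap.mem_ker, ← e3]
    constructor
    · exact fun h => ⟨v, hinj _ h, rfl⟩
    · rintro ⟨v', hv', h⟩
      have : v' = v := (chartEquiv hψ.1 hp).injective h
      rw [← this, LinearMap.mem_ker.1 hv']
      exact (chartEquiv hψ.1 hp).map_zero
  refine ⟨⟨J, P₁, P₂, ?_, ?_, ?_, ?_, ?_, ?_, ?_, ?_⟩, ?_⟩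
  · intro w
    obtain ⟨v, rfl⟩ := hs w
    rw [← e1, ← e1, K.J_sq]
    exact (chartEquiv hψ.1 hp).map_neg v
  · intro w w'
    obtain ⟨v, rfl⟩ := hs w
    obtain ⟨v', rfl⟩ := hs w'
    rw [← e1, ← e1, hi, hi, K.J_isometry]
  · intro w
    obtain ⟨v, rfl⟩ := hs w
    rw [← e2, ← e2, K.π₁_idem]
  · intro w w'
    obtain ⟨v, rfl⟩ := hs w
    obtain ⟨v', rfl⟩ := hs w'
    rw [← e2, ← e2, hi, hi, K.π₁_symm]
  · intro w
    obtain ⟨v, rfl⟩ := hs w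
    rw [← e2, ← e3, ← hadd, K.π_add]
  · rw [hker]
    exact ((chartEquiv hψ.1 hp).finrank_map_eq _).trans (K.finrank_ker_π₂ p)
  · intro w hw w' hw'
    obtain ⟨v, rfl⟩ := hs w
    obtain ⟨v', rfl⟩ := hs w'
    rw [← e2] at hw hw'
    rw [← e1, hi]
    exact K.ω_ker_π₁ p v (hinj _ hw) v' (hinj _ hw')
  · intro w hw w' hw'
    obtain ⟨v, rfl⟩ := hs w
    obtain ⟨v', rfl⟩ := hs w'
    rw [← e3] at hw hw'
    rw [← e1, hi]
    exact K.ω_ker_π₂ p v (hinj _ hw) v' (hinj _ hw')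
  · filter_upwards [hJ, hP₁, hP₂, ψ.open_source.mem_nhds hp] with q h1 h2 h3 h4
    exact ⟨h4, h1, h2, h3⟩

end ModelOf

/-! ### Immersions in charts, at a point -/

section PointModel

open Filter Topology

variable {n : ℕ} {M L : Type*} [TopologicalSpace M] [ChartedSpace (Euc (2 * n)) M]
  [IsManifold (𝓡 (2 * n)) ∞ M] [TopologicalSpace L] [ChartedSpace (Euc n) L]

/-- The map `f` in the charts `φ` and `ψ`. -/
def localMap (φ : OpenPartialHomeomorph L (Euc n)) (ψ : OpenPartialHomeomorph M (Euc (2 * n)))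
    (f : L → M) (x : Euc n) : Euc (2 * n) := ψ (f (φ.symm x))

/-- The differential of `f` at `p` in the charts `φ` and `ψ`. -/
abbrev localD (φ : OpenPartialHomeomorph L (Euc n)) (ψ : OpenPartialHomeomorph M (Euc (2 * n)))
    (f : L → M) (p : L) : Euc n →L[ℝ] Euc (2 * n) := fderiv ℝ (localMap φ ψ f) (φ p)

/-- `f` is graphical and Lagrangian at `p`, and the charts `φ` around `p` and `ψ` around `f p`
identify its geometry there with that of a linear map into the linear model `N`. -/
structure IsPointModel (K : FlatKahlerSplitting n M) (f : L → M)
    (φ : OpenPartialHomeomorph L (Euc n)) (ψ : OpenPartialHomeomorph M (Euc (2 * n)))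
    (N : ModelSplitting n) (p : L) : Prop where
  chart : φ ∈ IsManifold.maximalAtlas (𝓡 n) ∞ L
  mem_source : p ∈ φ.source
  flat : IsFlatChart K.g ψ
  represents : Represents K ψ N (f p)
  mdifferentiableAt : MDifferentiableAt (𝓡 n) (𝓡 (2 * n)) f p
  graphical : Function.Injective fun v : Tan n p => K.π₁ (f p) (tangentD f p v)
  lagrangian : ∀ X Y : Tan n p, K.ω (f p) (tangentD f p X) (tangentD f p Y) = 0

namespace IsPointModel

variable {K : FlatKahlerSplitting n M} {f : L → M}
  {φ : OpenPartialHomeomorph L (Euc n)} {ψ : OpenPartialHomeomorph M (Euc (2 * n))}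
  {N : ModelSplitting n} {p : L}

theorem chartD_tangentD (h : IsPointModel K f φ ψ N p) (v : Tan n p) :
    chartD ψ (f p) (tangentD f p v) = localD φ ψ f p (chartD φ p v) := by
  have hφ := mdifferentiable_of_mem_maximalAtlas h.chart
  have hψ := mdifferentiable_of_mem_maximalAtlas h.flat.1
  obtain ⟨x, hx, hxp⟩ : ∃ x ∈ φ.target, φ.symm x = p :=
    ⟨φ p, φ.map_source h.mem_source, φ.left_inv h.mem_source⟩
  have hf := h.mdifferentiableAt
  have hs := h.represents.mem_source
  have hc := h.chart
  clear h
  subst hxp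
  rw [localD, φ.right_inv hx]
  have h1 : HasMFDerivAt 𝓘(ℝ, Euc n) 𝓘(ℝ, Euc (2 * n)) (localMap φ ψ f) x _ :=
    (hψ.mdifferentiableAt hs).hasMFDerivAt.comp x
      (hf.hasMFDerivAt.comp x (hφ.mdifferentiableAt_symm hx).hasMFDerivAt)
  have h2 : fderiv ℝ (localMap φ ψ f) x = _ := mfderiv_eq_fderiv.symm.trans h1.mfderiv
  have hv : chartSymmD φ x (chartD φ (φ.symm x) v) = v := chartSymmD_chartD hc hx v
  refine Eq.trans ?_ (congrArg (fun A => A (chartD φ (φ.symm x) v)) h2.symm)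
  change _ = mfderiv (𝓡 (2 * n)) 𝓘(ℝ, Euc (2 * n)) ψ (f (φ.symm x))
    (mfderiv (𝓡 n) (𝓡 (2 * n)) f (φ.symm x) (chartSymmD φ x (chartD φ (φ.symm x) v)))
  rw [hv]
  rfl

theorem inner_tangentD (h : IsPointModel K f φ ψ N p) (v w : Tan n p) :
    K.g.inner (f p) (tangentD f p v) (tangentD f p w) =
      inner ℝ (localD φ ψ f p (chartD φ p v)) (localD φ ψ f p (chartD φ p w)) := by
  rw [← h.flat.2 _ h.represents.mem_source, h.chartD_tangentD, h.chartD_tangentD]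

theorem isOrthonormalFrame_iff (h : IsPointModel K f φ ψ N p) {e : Fin n → Tan n p} :
    IsOrthonormalFrame K f p e ↔
      frameMat (innerSL ℝ) (localD φ ψ f p) (fun i => chartD φ p (e i)) = 1 := by
  rw [IsOrthonormalFrame, ← Matrix.ext_iff]
  refine forall_congr' fun i => forall_congr' fun j => ?_
  rw [h.inner_tangentD, Matrix.one_apply]
  rfl

theorem matrixS_eq (h : IsPointModel K f φ ψ N p) (e : Fin n → Tan n p) :
    matrixS K f p e = frameMat N.S (localD φ ψ f p) (fun i => chartD φ p (e i)) := by
  ext i j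
  rw [matrixS, Matrix.of_apply, FlatKahlerSplitting.S, ← h.flat.2 _ h.represents.mem_source,
    h.represents.J_eq, h.represents.π₁_eq, h.represents.π₂_eq, h.chartD_tangentD,
    h.chartD_tangentD]
  rfl

theorem isAdaptedFrame_iff (h : IsPointModel K f φ ψ N p) {e : Fin n → Tan n p}
    {a : Fin n → Tan (2 * n) (f p)} {lam : Fin n → ℝ} :
    IsAdaptedFrame K f p e a lam ↔ N.IsAdapted (localD φ ψ f p) (fun i => chartD φ p (e i))
      (fun i => chartD ψ (f p) (a i)) lam := by
  have hinj : ∀ {v w : Tan (2 * n) (f p)}, chartD ψ (f p) v = chartD ψ (f p) w ↔ v = w :=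
    (chartEquiv h.flat.1 h.represents.mem_source).injective.eq_iff
  have hadd : ∀ (r s : ℝ) (v w : Tan (2 * n) (f p)), chartD ψ (f p) (r • (v + s • w)) =
      r • (chartD ψ (f p) v + s • chartD ψ (f p) w) := fun r s v w => by
    exact ((chartEquiv h.flat.1 h.represents.mem_source).map_smul r _).trans (congrArg (r • ·)
      (((chartEquiv h.flat.1 h.represents.mem_source).map_add _ _).trans (congrArg (_ + ·)
        ((chartEquiv h.flat.1 h.represents.mem_source).map_smul s w))))
  constructor
  · rintro ⟨h1, h2, h3⟩
    refine ⟨fun i => ?_, fun i j => ?_, fun i => ?_⟩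
    · rw [← h.represents.π₁_eq, h1]
    · rw [h.flat.2 _ h.represents.mem_source, h2]
    · rw [← h.chartD_tangentD, h3, hadd, h.represents.J_eq]
  · rintro ⟨h1, h2, h3⟩
    refine ⟨fun i => ?_, fun i j => ?_, fun i => ?_⟩
    · rw [← hinj, h.represents.π₁_eq]
      exact h1 i
    · rw [← h.flat.2 _ h.represents.mem_source]
      exact h2 i j
    · rw [← hinj, h.chartD_tangentD, hadd, h.represents.J_eq]
      exact h3 i

theorem logDetS2_eq (h : IsPointModel K f φ ψ N p) {E : Fin n → Euc n}
    (hE : frameMat (innerSL ℝ) (localD φ ψ f p) E = 1) :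
    logDetS2 K f p = logPullbackDet N.S (localD φ ψ f p) := by
  have hex : ∃ e : Fin n → Tan n p, IsOrthonormalFrame K f p e := by
    refine ⟨fun i => (chartEquiv h.chart h.mem_source).symm (E i), h.isOrthonormalFrame_iff.2 ?_⟩
    simp only [← chartEquiv_apply h.chart h.mem_source, LinearEquiv.apply_symm_apply, hE]
  rw [logDetS2, dif_pos hex, h.matrixS_eq, logPullbackDet,
    pullbackDet_eq N.S (h.isOrthonormalFrame_iff.1 hex.choose_spec)]

theorem exists_isAdapted (h : IsPointModel K f φ ψ N p) :
    ∃ E a lam, N.IsAdapted (localD φ ψ f p) E a lam := by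
  refine ModelSplitting.exists_isAdapted N ?_ ?_
  · intro V W hVW
    obtain ⟨v, rfl⟩ := chartD_surjective h.chart h.mem_source V
    obtain ⟨w, rfl⟩ := chartD_surjective h.chart h.mem_source W
    simp only [← h.chartD_tangentD, ← h.represents.π₁_eq] at hVW
    rw [h.graphical ((chartEquiv h.flat.1 h.represents.mem_source).injective hVW)]
  · intro V W
    obtain ⟨v, rfl⟩ := chartD_surjective h.chart h.mem_source V
    obtain ⟨w, rfl⟩ := chartD_surjective h.chart h.mem_source W
    rw [← h.chartD_tangentD, ← h.chartD_tangentD, ← h.represents.J_eq,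
      h.flat.2 _ h.represents.mem_source]
    exact h.lagrangian v w

theorem inner_J_localD (h : IsPointModel K f φ ψ N p)
    (V W : Euc n) :
    inner ℝ (N.J (localD φ ψ f p V)) (localD φ ψ f p W) = (0 : ℝ) := by
  obtain ⟨v, rfl⟩ := chartD_surjective h.chart h.mem_source V
  obtain ⟨w, rfl⟩ := chartD_surjective h.chart h.mem_source W
  rw [← h.chartD_tangentD, ← h.chartD_tangentD, ← h.represents.J_eq,
    h.flat.2 _ h.represents.mem_source]
  exact h.lagrangian v w

theorem exists_isAdaptedFrame (h : IsPointModel K f φ ψ N p) {E : Fin n → Euc n}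
    {b : Fin n → Euc (2 * n)} {lam : Fin n → ℝ} (hE : N.IsAdapted (localD φ ψ f p) E b lam) :
    ∃ (e : Fin n → Tan n p) (a : Fin n → Tan (2 * n) (f p)), IsAdaptedFrame K f p e a lam := by
  refine ⟨fun i => (chartEquiv h.chart h.mem_source).symm (E i),
    fun i => (chartEquiv h.flat.1 h.represents.mem_source).symm (b i),
    h.isAdaptedFrame_iff.2 ?_⟩
  simp only [← chartEquiv_apply h.chart h.mem_source,
    ← chartEquiv_apply h.flat.1 h.represents.mem_source, LinearEquiv.apply_symm_apply]
  exact hE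

/-- The condition of two-convexity at the point `p`, in terms of the linear model. -/
theorem isTwoConvexMap_iff (h : IsPointModel K f φ ψ N p) {E : Fin n → Euc n}
    {b : Fin n → Euc (2 * n)} {lam : Fin n → ℝ} (hE : N.IsAdapted (localD φ ψ f p) E b lam) :
    N.IsTwoConvexMap (localD φ ψ f p) ↔
      ∀ (e : Fin n → Tan n p) (a : Fin n → Tan (2 * n) (f p)) (lam : Fin n → ℝ),
        IsAdaptedFrame K f p e a lam → TwoConvexAngles lam := by
  constructor
  · exact fun hN e a lam hea => (h.isAdaptedFrame_iff.1 hea).twoConvexAngles hN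
  · intro hN
    obtain ⟨e, a, hea⟩ := h.exists_isAdaptedFrame hE
    exact hE.isTwoConvexMap (hN e a lam hea)

/-- The mean curvature vector in the linear model. -/
theorem chartD_meanCurvatureVector (h : IsPointModel K f φ ψ N p)
    {E : Fin n → Euc n} {b : Fin n → Euc (2 * n)} {lam : Fin n → ℝ}
    (hE : N.IsAdapted (localD φ ψ f p) E b lam) {H : Tan (2 * n) (f p)}
    (hH : IsMeanCurvatureVector K f p H) :
    chartD ψ (f p) H = hessianTrace (localMap φ ψ f) (φ p)
      - localD φ ψ f p (contractedChristoffel (localMap φ ψ f) (φ p)) := by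
  have hi := fun v w => h.flat.2 _ h.represents.mem_source v w
  obtain ⟨e, he⟩ : ∃ e : Fin n → Tan n p, ∀ i, chartD φ p (e i) = E i :=
    ⟨fun i => (chartEquiv h.chart h.mem_source).symm (E i), fun i =>
      (chartEquiv h.chart h.mem_source).apply_symm_apply _⟩
  have hframe : IsOrthonormalFrame K f p e := h.isOrthonormalFrame_iff.2 (by
    simp only [he]
    exact hE.frameMat_inner)
  refine velocity_eq hE (fun i => ?_) fun k => ?_
  · rw [← he, ← h.chartD_tangentD, hi]
    exact hH.1 _
  · have hJ : N.J (localD φ ψ f p (E k)) = chartD ψ (f p) (K.J (f p) (tangentD f p (e k))) := by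
      rw [h.represents.J_eq, h.chartD_tangentD, he]
    have h1 := hH.2 φ ψ ⟨h.chart, h.mem_source⟩ h.flat h.represents.mem_source e hframe
      (K.J (f p) (tangentD f p (e k))) fun X => h.lagrangian _ _
    change inner ℝ _ (N.J (localD φ ψ f p (E k))) = ∑ i, inner ℝ _ (N.J (localD φ ψ f p (E k)))
    rw [hJ, hi, h1]
    refine Finset.sum_congr rfl fun i _ => ?_
    rw [secondFF, he]
    rfl

end IsPointModel

end PointModel

/-! ### The flow in charts -/

section TimeInterval

variable {T : EReal}

theorem convex_timeInterval : Convex ℝ (timeInterval T) := by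
  refine Set.OrdConnected.convex ⟨?_⟩
  rintro s ⟨hs, -⟩ t ⟨-, ht⟩ r ⟨hsr, hrt⟩
  exact ⟨hs.trans hsr, lt_of_le_of_lt (EReal.coe_le_coe_iff.2 hrt) ht⟩

theorem Icc_subset_timeInterval {s t : ℝ} (hs : s ∈ timeInterval T) (ht : t ∈ timeInterval T) :
    Set.Icc s t ⊆ timeInterval T :=
  (convex_timeInterval (T := T)).ordConnected.out hs ht

theorem nonempty_interior_timeInterval {t : ℝ} (ht : t ∈ timeInterval T) :
    (interior (timeInterval T)).Nonempty := by
  obtain ⟨r, htr, hr⟩ := EReal.lt_iff_exists_real_btwn.1 ht.2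
  have htr' : t < r := EReal.coe_lt_coe_iff.1 htr
  refine ⟨(t + r) / 2, ?_⟩
  rw [mem_interior]
  refine ⟨Set.Ioo t r, fun s hs => ⟨ht.1.trans hs.1.le,
    lt_trans (EReal.coe_lt_coe_iff.2 hs.2) hr⟩, isOpen_Ioo, ?_⟩
  constructor <;> linarith

theorem uniqueDiffOn_timeInterval : UniqueDiffOn ℝ (timeInterval T) := fun _ ht =>
  uniqueDiffOn_convex convex_timeInterval (nonempty_interior_timeInterval ht) _ ht

theorem timeInterval_subset_closure_interior :
    timeInterval T ⊆ closure (interior (timeInterval T)) := fun t ht => by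
  rw [convex_timeInterval.closure_interior_eq_closure_of_nonempty_interior
    (nonempty_interior_timeInterval ht)]
  exact subset_closure ht

end TimeInterval

section FlowModel

open Filter Topology

variable {n : ℕ} {M L : Type*} [TopologicalSpace M] [ChartedSpace (Euc (2 * n)) M]
  [IsManifold (𝓡 (2 * n)) ∞ M] [TopologicalSpace L] [ChartedSpace (Euc n) L]

/-- In the charts `φ` and `ψ`, the flow `F` is a smooth family of graphical Lagrangian maps into the
linear model `N`, for times in `I` and points with coordinates in the open set `U`. -/
structure IsFlowModel (K : FlatKahlerSplitting n M) (F : ℝ → L → M)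
    (φ : OpenPartialHomeomorph L (Euc n)) (ψ : OpenPartialHomeomorph M (Euc (2 * n)))
    (N : ModelSplitting n) (I : Set ℝ) (U : Set (Euc n)) : Prop where
  isOpen : IsOpen U
  subset_target : U ⊆ φ.target
  uniqueDiffOn : UniqueDiffOn ℝ I
  subset_closure : I ⊆ closure (interior I)
  contDiffOn : ContDiffOn ℝ ∞ (fun q : ℝ × Euc n => localMap φ ψ (F q.1) q.2) (I ×ˢ U)
  model : ∀ s ∈ I, ∀ x ∈ U, IsPointModel K (F s) φ ψ N (φ.symm x)

theorem IsLagrangianMCF.contMDiff {K : FlatKahlerSplitting n M} {T : EReal} {F : ℝ → L → M}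
    (hF : IsLagrangianMCF K T F) {t : ℝ} (ht : t ∈ timeInterval T) :
    ContMDiff (𝓡 n) (𝓡 (2 * n)) ∞ (F t) := by
  rw [← contMDiffOn_univ]
  exact hF.smooth.comp (t := timeInterval T ×ˢ Set.univ) (f := fun p : L => (t, p))
    (contMDiff_const.prodMk contMDiff_id).contMDiffOn fun p _ => ⟨ht, trivial⟩

/-- Near any point in space and time, the flow has a model in any chart of `L` and any flat chart
of `M`. Its times form a neighbourhood of `t` within `[0, T)`. -/
theorem IsLagrangianMCF.exists_isFlowModel {K : FlatKahlerSplitting n M} {T : EReal}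
    {F : ℝ → L → M} (hF : IsLagrangianMCF K T F)
    (hgraph : ∀ t ∈ timeInterval T, IsGraphical K (F t)) {t : ℝ} (ht : t ∈ timeInterval T) {p : L}
    {φ : OpenPartialHomeomorph L (Euc n)} (hφ : IsChartAround φ p)
    {ψ : OpenPartialHomeomorph M (Euc (2 * n))} (hψ : IsFlatChart K.g ψ)
    (hp : F t p ∈ ψ.source) :
    ∃ N O U, IsOpen O ∧ t ∈ O ∧ φ p ∈ U ∧ IsFlowModel K F φ ψ N (timeInterval T ∩ O) U := by
  obtain ⟨N, hN⟩ := exists_represents K hψ hp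
  have hc : ContinuousWithinAt (fun q : ℝ × Euc n => F q.1 (φ.symm q.2))
      (timeInterval T ×ˢ φ.target) (t, φ p) := by
    have h1 : ContinuousWithinAt (fun q : ℝ × L => F q.1 q.2) (timeInterval T ×ˢ Set.univ)
        (t, φ.symm (φ p)) := hF.smooth.continuousOn _ ⟨ht, trivial⟩
    refine ContinuousWithinAt.comp (f := fun q : ℝ × Euc n => (q.1, φ.symm q.2))
      (t := timeInterval T ×ˢ Set.univ) (x := (t, φ p)) h1 ?_ fun q hq => ⟨hq.1, trivial⟩
    refine continuousWithinAt_fst.prodMk ?_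
    exact (φ.continuousAt_symm (φ.map_source hφ.2)).comp_continuousWithinAt (f := Prod.snd)
      (x := (t, φ p)) continuousWithinAt_snd
  have hev : ∀ᶠ q : ℝ × Euc n in 𝓝[timeInterval T ×ˢ φ.target] (t, φ p),
      Represents K ψ N (F q.1 (φ.symm q.2)) := by
    refine hc.eventually ?_
    change ∀ᶠ y in 𝓝 (F t (φ.symm (φ p))), _
    rwa [φ.left_inv hφ.2]
  rw [eventually_nhdsWithin_iff, eventually_iff, mem_nhds_prod_iff'] at hev
  obtain ⟨O, U, hO, htO, hU, hpU, hOU⟩ := hev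
  have hrep : ∀ s ∈ timeInterval T ∩ O, ∀ x ∈ U ∩ φ.target,
      Represents K ψ N (F s (φ.symm x)) := fun s hs x hx =>
    hOU (a := (s, x)) ⟨hs.2, hx.1⟩ ⟨hs.1, hx.2⟩
  refine ⟨N, O, U ∩ φ.target, hO, htO, ⟨hpU, φ.map_source hφ.2⟩, hU.inter φ.open_target,
    Set.inter_subset_right, uniqueDiffOn_timeInterval.inter hO, ?_, ?_, ?_⟩
  · rw [interior_inter, hO.interior_eq]
    exact fun s hs => hO.closure_inter ⟨timeInterval_subset_closure_interior hs.1, hs.2⟩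
  · have hs : ContMDiffOn 𝓘(ℝ, ℝ × Euc n) ((𝓘(ℝ, ℝ)).prod (𝓡 n)) ∞
        (fun q : ℝ × Euc n => (q.1, φ.symm q.2)) ((timeInterval T ∩ O) ×ˢ (U ∩ φ.target)) := by
      refine ContMDiffOn.prodMk contDiff_fst.contMDiff.contMDiffOn ?_
      exact (contMDiffOn_symm_of_mem_maximalAtlas hφ.1).comp (f := Prod.snd)
        contDiff_snd.contMDiff.contMDiffOn fun q hq => hq.2.2
    have h2 := hF.smooth.comp hs fun q hq => ⟨hq.1.1, trivial⟩
    exact ((contMDiffOn_of_mem_maximalAtlas hψ.1).comp h2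
      fun q hq => (hrep q.1 hq.1 q.2 hq.2).mem_source).contDiffOn
  · exact fun s hs x hx => ⟨hφ.1, φ.map_target hx.2, hψ, hrep s hs x hx,
      (hF.contMDiff hs.1).mdifferentiableAt (by simp), hgraph s hs.1 _, hF.lagrangian s hs.1 _⟩

namespace IsFlowModel

variable {K : FlatKahlerSplitting n M} {T : EReal} {F : ℝ → L → M}
  {φ : OpenPartialHomeomorph L (Euc n)} {ψ : OpenPartialHomeomorph M (Euc (2 * n))}
  {N : ModelSplitting n} {O : Set ℝ} {U : Set (Euc n)} {I : Set ℝ}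

theorem localD_eq (h : IsFlowModel K F φ ψ N I U) {x : Euc n} (hx : x ∈ U) (s : ℝ) :
    localD φ ψ (F s) (φ.symm x) = fderiv ℝ (localMap φ ψ (F s)) x := by
  rw [localD, φ.right_inv (h.subset_target hx)]

theorem contDiffAt (h : IsFlowModel K F φ ψ N I U) {t : ℝ} (ht : t ∈ I) {x : Euc n}
    (hx : x ∈ U) : ContDiffAt ℝ ∞ (localMap φ ψ (F t)) x := by
  have h1 : ContDiffOn ℝ ∞ (fun y => localMap φ ψ (F t) y) U :=
    h.contDiffOn.comp (f := fun y : Euc n => (t, y)) (by fun_prop) fun y hy => ⟨ht, hy⟩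
  exact h1.contDiffAt (h.isOpen.mem_nhds hx)

theorem contDiffOn_fderiv (h : IsFlowModel K F φ ψ N I U) :
    ContDiffOn ℝ ∞ (fun q : ℝ × Euc n => fderiv ℝ (localMap φ ψ (F q.1)) q.2) (I ×ˢ U) :=
  contDiffOn_fderiv_slice h.uniqueDiffOn h.isOpen h.contDiffOn

/-- The velocity of the flow in the charts. -/
theorem chartD_velocity (h : IsFlowModel K F φ ψ N (timeInterval T ∩ O) U)
    (hF : IsLagrangianMCF K T F) {t : ℝ} (ht : t ∈ timeInterval T ∩ O) {x : Euc n}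
    (hx : x ∈ U) :
    chartD ψ (F t (φ.symm x)) (mfderivWithin 𝓘(ℝ, ℝ) (𝓡 (2 * n)) (fun s => F s (φ.symm x))
      (timeInterval T) t (1 : ℝ)) =
    derivWithin (fun s => localMap φ ψ (F s) x) (timeInterval T ∩ O) t := by
  have hm := h.model t ht x hx
  have h1 : ContMDiffOn 𝓘(ℝ, ℝ) (𝓡 (2 * n)) ∞ (fun s => F s (φ.symm x)) (timeInterval T) :=
    hF.smooth.comp (t := timeInterval T ×ˢ Set.univ) (f := fun s : ℝ => (s, φ.symm x))
      (contMDiff_id.prodMk contMDiff_const).contMDiffOn fun s hs => ⟨hs, trivial⟩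
  have h2 := ((mdifferentiable_of_mem_maximalAtlas hm.flat.1).mdifferentiableAt
    hm.represents.mem_source).hasMFDerivAt.comp_hasMFDerivWithinAt t
    ((h1 t ht.1).mdifferentiableWithinAt (by simp)).hasMFDerivWithinAt
  have h3 : mfderivWithin 𝓘(ℝ, ℝ) 𝓘(ℝ, Euc (2 * n)) (fun s => localMap φ ψ (F s) x)
      (timeInterval T ∩ O) t = _ :=
    (h2.mono Set.inter_subset_left).mfderivWithin (h.uniqueDiffOn t ht).uniqueMDiffWithinAt
  exact (congrArg (fun A => A (1 : ℝ)) (mfderivWithin_eq_fderivWithin.symm.trans h3)).symm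

end IsFlowModel

end FlowModel

/-! ### The evolution of `log det S^{[2]}` in charts -/

section FlowModelEvolution

open Filter Topology

variable {n : ℕ} {M L : Type*} [TopologicalSpace M] [ChartedSpace (Euc (2 * n)) M]
  [IsManifold (𝓡 (2 * n)) ∞ M] [TopologicalSpace L] [ChartedSpace (Euc n) L]

/-- Two-convexity at a point. -/
def IsTwoConvexAt (K : FlatKahlerSplitting n M) (f : L → M) (p : L) : Prop :=
  ∀ (e : Fin n → Tan n p) (a : Fin n → Tan (2 * n) (f p)) (lam : Fin n → ℝ),
    IsAdaptedFrame K f p e a lam → TwoConvexAngles lam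

namespace IsFlowModel

variable {K : FlatKahlerSplitting n M} {T : EReal} {F : ℝ → L → M}
  {φ : OpenPartialHomeomorph L (Euc n)} {ψ : OpenPartialHomeomorph M (Euc (2 * n))}
  {N : ModelSplitting n} {I O : Set ℝ} {U : Set (Euc n)} {t : ℝ} {x : Euc n}

theorem exists_isAdapted (h : IsFlowModel K F φ ψ N I U) (ht : t ∈ I) (hx : x ∈ U) :
    ∃ E a lam, N.IsAdapted (fderiv ℝ (localMap φ ψ (F t)) x) E a lam := by
  rw [← h.localD_eq hx]
  exact (h.model t ht x hx).exists_isAdapted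

theorem logDetS2_eq (h : IsFlowModel K F φ ψ N I U) (ht : t ∈ I) (hx : x ∈ U) :
    logDetS2 K (F t) (φ.symm x) = logPullbackDet N.S (fderiv ℝ (localMap φ ψ (F t)) x) := by
  obtain ⟨E, a, lam, hE⟩ := h.exists_isAdapted ht hx
  rw [← h.localD_eq hx] at hE ⊢
  exact (h.model t ht x hx).logDetS2_eq hE.frameMat_inner

theorem isTwoConvexAt_iff (h : IsFlowModel K F φ ψ N I U) (ht : t ∈ I) (hx : x ∈ U) :
    IsTwoConvexAt K (F t) (φ.symm x) ↔
      N.IsTwoConvexMap (fderiv ℝ (localMap φ ψ (F t)) x) := by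
  obtain ⟨E, a, lam, hE⟩ := h.exists_isAdapted ht hx
  rw [← h.localD_eq hx] at hE ⊢
  exact ((h.model t ht x hx).isTwoConvexMap_iff hE).symm

theorem contDiffAt_logPullbackDet (h : IsFlowModel K F φ ψ N I U) (ht : t ∈ I) (hx : x ∈ U)
    (hA : N.IsTwoConvexMap (fderiv ℝ (localMap φ ψ (F t)) x)) :
    ContDiffAt ℝ ∞ (logPullbackDet N.S) (fderiv ℝ (localMap φ ψ (F t)) x) := by
  obtain ⟨E, a, lam, hE⟩ := h.exists_isAdapted ht hx
  exact _root_.contDiffAt_logPullbackDet N.S (isUnit_det_gram hE.frameMat_inner)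
    (hE.pullbackDet_pos (hE.twoConvexAngles hA)).ne'

theorem contDiffWithinAt_logDetS2 (h : IsFlowModel K F φ ψ N I U) (ht : t ∈ I) (hx : x ∈ U)
    (hA : N.IsTwoConvexMap (fderiv ℝ (localMap φ ψ (F t)) x)) :
    ContDiffWithinAt ℝ ∞ (fun q : ℝ × Euc n => logDetS2 K (F q.1) (φ.symm q.2)) (I ×ˢ U)
      (t, x) := by
  have h1 := (h.contDiffAt_logPullbackDet ht hx hA).comp_contDiffWithinAt (t, x)
    (h.contDiffOn_fderiv (t, x) ⟨ht, hx⟩)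
  exact h1.congr (fun q hq => h.logDetS2_eq hq.1 hq.2) (h.logDetS2_eq ht hx)

theorem inducedMetric_eq (h : IsFlowModel K F φ ψ N I U) (ht : t ∈ I) (hx : x ∈ U) :
    inducedMetric K (F t) φ x =
      frameMat (innerSL ℝ) (fderiv ℝ (localMap φ ψ (F t)) x) (stdFrame n) := by
  have hm := h.model t ht x hx
  ext a b
  rw [inducedMetric, Matrix.of_apply, hm.inner_tangentD,
    chartD_chartSymmD hm.chart (h.subset_target hx),
    chartD_chartSymmD hm.chart (h.subset_target hx), h.localD_eq hx]
  rfl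

theorem laplaceBeltrami_eq (h : IsFlowModel K F φ ψ N I U) (ht : t ∈ I) (hx : x ∈ U) :
    laplaceBeltrami K (F t) φ (logDetS2 K (F t)) (φ.symm x) =
      coordLaplacian
        (fun y => frameMat (innerSL ℝ) (fderiv ℝ (localMap φ ψ (F t)) y) (stdFrame n))
        (fun y => logPullbackDet N.S (fderiv ℝ (localMap φ ψ (F t)) y)) x := by
  have h1 : laplaceBeltrami K (F t) φ (logDetS2 K (F t)) (φ.symm x) =
      coordLaplacian (inducedMetric K (F t) φ) (fun y => logDetS2 K (F t) (φ.symm y)) x := by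
    rw [laplaceBeltrami, φ.right_inv (h.subset_target hx)]
    rfl
  rw [h1]
  refine coordLaplacian_congr ?_ ?_
  · filter_upwards [h.isOpen.mem_nhds hx] with y hy using h.inducedMetric_eq ht hy
  · filter_upwards [h.isOpen.mem_nhds hx] with y hy using h.logDetS2_eq ht hy

theorem eventually_inner_J (h : IsFlowModel K F φ ψ N I U) (ht : t ∈ I) (hx : x ∈ U) :
    ∀ᶠ y in 𝓝 x, ∀ v w, inner ℝ (N.J (fderiv ℝ (localMap φ ψ (F t)) y v))
      (fderiv ℝ (localMap φ ψ (F t)) y w) = (0 : ℝ) := by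
  filter_upwards [h.isOpen.mem_nhds hx] with y hy v w
  rw [← h.localD_eq hy]
  exact (h.model t ht y hy).inner_J_localD v w

/-- The equation of mean curvature flow in charts. -/
theorem derivWithin_eq (h : IsFlowModel K F φ ψ N (timeInterval T ∩ O) U)
    (hF : IsLagrangianMCF K T F) (ht : t ∈ timeInterval T ∩ O) (hx : x ∈ U) :
    derivWithin (fun s => localMap φ ψ (F s) x) (timeInterval T ∩ O) t =
      hessianTrace (localMap φ ψ (F t)) x - fderiv ℝ (localMap φ ψ (F t)) x
        (contractedChristoffel (localMap φ ψ (F t)) x) := by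
  obtain ⟨E, a, lam, hE⟩ := h.exists_isAdapted ht hx
  rw [← h.localD_eq hx] at hE
  rw [← h.chartD_velocity hF ht hx, (h.model t ht x hx).chartD_meanCurvatureVector hE
    (hF.flow t ht.1 _), h.localD_eq hx, φ.right_inv (h.subset_target hx)]

theorem hasDerivWithinAt_logDetS2 (h : IsFlowModel K F φ ψ N I U) (ht : t ∈ I) (hx : x ∈ U)
    (hA : N.IsTwoConvexMap (fderiv ℝ (localMap φ ψ (F t)) x)) :
    HasDerivWithinAt (fun s => logDetS2 K (F s) (φ.symm x))
      (fderiv ℝ (logPullbackDet N.S) (fderiv ℝ (localMap φ ψ (F t)) x)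
        (fderiv ℝ (fun y => derivWithin (fun s => localMap φ ψ (F s) y) I t) x)) I t := by
  have h1 : HasDerivWithinAt (fun s => fderiv ℝ (localMap φ ψ (F s)) x) _ I t :=
    hasDerivWithinAt_fderiv_slice h.uniqueDiffOn h.subset_closure h.isOpen h.contDiffOn ht hx
  have h2 := ((h.contDiffAt_logPullbackDet ht hx hA).differentiableAt
    (by simp)).hasFDerivAt.comp_hasDerivWithinAt t h1
  exact h2.congr (fun s hs => h.logDetS2_eq hs hx) (h.logDetS2_eq ht hx)

/-- The evolution inequality, in charts. -/
theorem le_derivWithin_sub_laplaceBeltrami (h : IsFlowModel K F φ ψ N (timeInterval T ∩ O) U)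
    (hO : IsOpen O) (hF : IsLagrangianMCF K T F) (ht : t ∈ timeInterval T ∩ O) (hx : x ∈ U)
    {E : Fin n → Euc n} {b : Fin n → Euc (2 * n)} {lam : Fin n → ℝ}
    (hE : N.IsAdapted (fderiv ℝ (localMap φ ψ (F t)) x) E b lam) (hl : TwoConvexAngles lam) :
    ∑ k, ∑ i, ∑ j ∈ Finset.Ioi i, evolutionQuadratic lam (fun i j =>
      inner ℝ (fderiv ℝ (fderiv ℝ (localMap φ ψ (F t))) x (E k) (E i))
        (N.J (fderiv ℝ (localMap φ ψ (F t)) x (E j)))) i j ≤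
    derivWithin (fun s => logDetS2 K (F s) (φ.symm x)) (timeInterval T) t
      - laplaceBeltrami K (F t) φ (logDetS2 K (F t)) (φ.symm x) := by
  rw [h.laplaceBeltrami_eq ht hx, ← derivWithin_inter (hO.mem_nhds ht.2),
    (h.hasDerivWithinAt_logDetS2 ht hx (hE.isTwoConvexMap hl)).derivWithin (h.uniqueDiffOn t ht)]
  refine evolution_inequality (h.contDiffAt ht hx) (h.eventually_inner_J ht hx) ?_ hE hl
  filter_upwards [h.isOpen.mem_nhds hx] with y hy using h.derivWithin_eq hF ht hy

end IsFlowModel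
end FlowModelEvolution

/-! ### The evolution of `log det S^{[2]}` on the manifold -/

section PointwiseEvolution

open Filter Topology

variable {n : ℕ} {M L : Type*} [TopologicalSpace M] [ChartedSpace (Euc (2 * n)) M]
  [IsManifold (𝓡 (2 * n)) ∞ M] [TopologicalSpace L] [ChartedSpace (Euc n) L]
  {K : FlatKahlerSplitting n M} {T : EReal} {F : ℝ → L → M}

/-- The second fundamental form in the linear model. -/
theorem IsPointModel.hComp_eq {f : L → M} {φ : OpenPartialHomeomorph L (Euc n)}
    {ψ : OpenPartialHomeomorph M (Euc (2 * n))} {N : ModelSplitting n} {p : L}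
    (h : IsPointModel K f φ ψ N p) (e : Fin n → Tan n p) (i j k : Fin n) :
    hComp K φ ψ f p e i j k =
      inner ℝ (fderiv ℝ (fderiv ℝ (localMap φ ψ f)) (φ p) (chartD φ p (e i)) (chartD φ p (e j)))
        (N.J (localD φ ψ f p (chartD φ p (e k)))) := by
  rw [hComp, secondFF, h.represents.J_eq, h.chartD_tangentD]
  rfl

/-- The evolution inequality at a point where the flow is two-convex. -/
theorem IsLagrangianMCF.evolution_logDetS2 (hn : 2 ≤ n) (hF : IsLagrangianMCF K T F)
    (hgraph : ∀ t ∈ timeInterval T, IsGraphical K (F t)) {t : ℝ} (ht : t ∈ timeInterval T) {p : L}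
    (hp : IsTwoConvexAt K (F t) p) {e : Fin n → Tan n p} {a : Fin n → Tan (2 * n) (F t p)}
    {lam : Fin n → ℝ} (he : IsAdaptedFrame K (F t) p e a lam)
    {φ : OpenPartialHomeomorph L (Euc n)} {ψ : OpenPartialHomeomorph M (Euc (2 * n))}
    (hφ : IsChartAround φ p) (hψ : IsFlatChart K.g ψ) (hpψ : F t p ∈ ψ.source) :
    ∑ k, ∑ i, ∑ j ∈ Finset.Ioi i, evolutionQuadratic lam (hComp K φ ψ (F t) p e k) i j ≤
        derivWithin (fun s => logDetS2 K (F s) p) (timeInterval T) t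
          - laplaceBeltrami K (F t) φ (logDetS2 K (F t)) p ∧
      2 * ∑ i, ∑ j, ∑ k, hComp K φ ψ (F t) p e i j k ^ 2 ≤
        ∑ k, ∑ i, ∑ j ∈ Finset.Ioi i, evolutionQuadratic lam (hComp K φ ψ (F t) p e k) i j := by
  obtain ⟨N, O, U, hO, htO, hpU, hM⟩ := hF.exists_isFlowModel hgraph ht hφ hψ hpψ
  have hm := hM.model t ⟨ht, htO⟩ _ hpU
  have hE := (φ.left_inv hφ.2 ▸ hm : IsPointModel K (F t) φ ψ N p)
  have hl := hp e a lam he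
  have hE' := hE.isAdaptedFrame_iff.1 he
  have heq : ∀ k, hComp K φ ψ (F t) p e k = fun i j =>
      inner ℝ (fderiv ℝ (fderiv ℝ (localMap φ ψ (F t))) (φ p) (chartD φ p (e k))
        (chartD φ p (e i))) (N.J (fderiv ℝ (localMap φ ψ (F t)) (φ p) (chartD φ p (e j)))) :=
    fun k => funext fun i => funext fun j => hE.hComp_eq e k i j
  constructor
  · have h := hM.le_derivWithin_sub_laplaceBeltrami hO hF ⟨ht, htO⟩ hpU hE' hl
    rw [φ.left_inv hφ.2] at h
    simpa only [heq] using h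
  · rw [Finset.mul_sum]
    refine Finset.sum_le_sum fun k _ => ?_
    refine two_mul_sum_sq_le hn hl fun i j => ?_
    simp only [heq]
    exact inner_hessian_J_symm (hM.contDiffAt ⟨ht, htO⟩ hpU)
      (hM.eventually_inner_J ⟨ht, htO⟩ hpU) _ _ _

variable [IsManifold (𝓡 n) ∞ L]

theorem IsLagrangianMCF.exists_isFlowModel_chartAt (hF : IsLagrangianMCF K T F)
    (hgraph : ∀ t ∈ timeInterval T, IsGraphical K (F t)) {t : ℝ} (ht : t ∈ timeInterval T)
    (p : L) : ∃ ψ N O U, IsOpen O ∧ t ∈ O ∧ chartAt (Euc n) p p ∈ U ∧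
      IsFlowModel K F (chartAt (Euc n) p) ψ N (timeInterval T ∩ O) U := by
  obtain ⟨ψ, hψ, hp⟩ := K.flat (F t p)
  exact ⟨ψ, hF.exists_isFlowModel hgraph ht (φ := chartAt (Euc n) p)
    ⟨IsManifold.chart_mem_maximalAtlas p, mem_chart_source _ p⟩ hψ hp⟩

theorem IsLagrangianMCF.exists_isPointModel (hF : IsLagrangianMCF K T F)
    (hgraph : ∀ t ∈ timeInterval T, IsGraphical K (F t)) {t : ℝ} (ht : t ∈ timeInterval T)
    (p : L) : ∃ ψ N, IsPointModel K (F t) (chartAt (Euc n) p) ψ N p := by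
  obtain ⟨ψ, N, O, U, hO, htO, hpU, h⟩ := hF.exists_isFlowModel_chartAt hgraph ht p
  refine ⟨ψ, N, ?_⟩
  have := h.model t ⟨ht, htO⟩ _ hpU
  rwa [(chartAt (Euc n) p).left_inv (mem_chart_source _ p)] at this

theorem IsLagrangianMCF.exists_isAdaptedFrame (hF : IsLagrangianMCF K T F)
    (hgraph : ∀ t ∈ timeInterval T, IsGraphical K (F t)) {t : ℝ} (ht : t ∈ timeInterval T)
    (p : L) : ∃ (e : Fin n → Tan n p) (a : Fin n → Tan (2 * n) (F t p)) (lam : Fin n → ℝ),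
      IsAdaptedFrame K (F t) p e a lam := by
  obtain ⟨ψ, N, h⟩ := hF.exists_isPointModel hgraph ht p
  obtain ⟨E, b, lam, hE⟩ := h.exists_isAdapted
  obtain ⟨e, a, hea⟩ := h.exists_isAdaptedFrame hE
  exact ⟨e, a, lam, hea⟩

theorem IsLagrangianMCF.logDetS2_eq_log_prod (hF : IsLagrangianMCF K T F)
    (hgraph : ∀ t ∈ timeInterval T, IsGraphical K (F t)) {t : ℝ} (ht : t ∈ timeInterval T)
    {p : L} {e : Fin n → Tan n p} {a : Fin n → Tan (2 * n) (F t p)} {lam : Fin n → ℝ}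
    (he : IsAdaptedFrame K (F t) p e a lam) :
    logDetS2 K (F t) p = Real.log (∏ i, ∏ j ∈ Finset.Ioi i,
      (lam i + lam j) * (1 + lam i * lam j) / ((1 + lam i ^ 2) * (1 + lam j ^ 2))) := by
  obtain ⟨ψ, N, h⟩ := hF.exists_isPointModel hgraph ht p
  have hE := h.isAdaptedFrame_iff.1 he
  rw [h.logDetS2_eq hE.frameMat_inner, logPullbackDet, hE.pullbackDet_eq_prod]

theorem IsLagrangianMCF.contMDiffWithinAt_logDetS2 (hF : IsLagrangianMCF K T F)
    (hgraph : ∀ t ∈ timeInterval T, IsGraphical K (F t)) {t : ℝ} (ht : t ∈ timeInterval T)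
    {p : L} (hp : IsTwoConvexAt K (F t) p) :
    ContMDiffWithinAt (𝓘(ℝ, ℝ).prod (𝓡 n)) 𝓘(ℝ, ℝ) ∞ (fun q : ℝ × L => logDetS2 K (F q.1) q.2)
      (timeInterval T ×ˢ Set.univ) (t, p) := by
  obtain ⟨ψ, N, O, U, hO, htO, hpU, h⟩ := hF.exists_isFlowModel_chartAt hgraph ht p
  set φ := chartAt (Euc n) p with hφ
  have hps : p ∈ φ.source := mem_chart_source _ p
  have hA : N.IsTwoConvexMap (fderiv ℝ (localMap φ ψ (F t)) (φ p)) := by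
    rw [← h.isTwoConvexAt_iff ⟨ht, htO⟩ hpU, φ.left_inv hps]
    exact hp
  have h1 := (h.contDiffWithinAt_logDetS2 ⟨ht, htO⟩ hpU hA).contMDiffWithinAt
  have h2 : ContMDiffWithinAt (𝓘(ℝ, ℝ).prod (𝓡 n)) 𝓘(ℝ, ℝ × Euc n) ∞
      (fun q : ℝ × L => (q.1, φ q.2)) ((timeInterval T ∩ O) ×ˢ (φ.source ∩ φ ⁻¹' U)) (t, p) := by
    refine ContMDiffWithinAt.prodMk_space contMDiffWithinAt_fst ?_
    exact (contMDiffOn_of_mem_maximalAtlas (IsManifold.chart_mem_maximalAtlas p) p hps).comp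
      (t, p) (f := Prod.snd) contMDiffWithinAt_snd fun q hq => hq.2.1
  have h3 := ContMDiffWithinAt.comp (t, p) h1 h2 fun q hq => Set.mk_mem_prod hq.1 hq.2.2
  have h4 : (timeInterval T ∩ O) ×ˢ (φ.source ∩ φ ⁻¹' U) ∈
      𝓝[timeInterval T ×ˢ Set.univ] (t, p) := by
    rw [nhdsWithin_prod_eq, nhdsWithin_univ]
    exact prod_mem_prod (inter_mem self_mem_nhdsWithin
      (mem_nhdsWithin_of_mem_nhds (hO.mem_nhds htO)))
      ((φ.isOpen_inter_preimage h.isOpen).mem_nhds ⟨hps, hpU⟩)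
  refine (h3.congr (fun q hq => ?_) ?_).mono_of_mem_nhdsWithin h4
  · exact congrArg (logDetS2 K (F q.1)) (φ.left_inv hq.2.1).symm
  · exact congrArg (logDetS2 K (F t)) (φ.left_inv hps).symm

end PointwiseEvolution

/-! ### The maximum principle -/

section MaximumPrinciple

open Filter Topology

/-- The Hessian is nonnegative at a local minimum. -/
theorem IsLocalMin.fderiv_fderiv_nonneg {E : Type*} [NormedAddCommGroup E] [NormedSpace ℝ E]
    {u : E → ℝ} {x : E} (h : IsLocalMin u x) (hu : ContDiffAt ℝ ∞ u x) (v : E) :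
    0 ≤ fderiv ℝ (fderiv ℝ u) x v v := by
  have hγ : ∀ s : ℝ, HasDerivAt (fun s : ℝ => x + s • v) v s := fun s => by
    simpa using ((hasDerivAt_id s).smul_const v).const_add x
  have hx : x + (0 : ℝ) • v = x := by simp
  have hlim : Tendsto (fun s : ℝ => x + s • v) (𝓝 0) (𝓝 x) := by
    have := (hγ 0).continuousAt
    rwa [ContinuousAt, hx] at this
  set g : ℝ → ℝ := fun s => u (x + s • v) with hg
  have hd : ∀ᶠ s in 𝓝 (0 : ℝ), HasDerivAt g (fderiv ℝ u (x + s • v) v) s :=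
    (hlim.eventually hu.eventually_differentiableAt).mono fun s hs =>
      hs.hasFDerivAt.comp_hasDerivAt s (hγ s)
  have hdd : HasDerivAt (deriv g) (fderiv ℝ (fderiv ℝ u) x v v) 0 := by
    have h1 : DifferentiableAt ℝ (fderiv ℝ u) (x + (0 : ℝ) • v) := by
      rw [hx]
      exact (hu.fderiv_right (m := ∞) (by simp)).differentiableAt (by simp)
    have h2 := (h1.hasFDerivAt.apply_const v).comp_hasDerivAt (0 : ℝ) (hγ 0)
    rw [hx] at h2
    exact h2.congr_of_eventuallyEq (hd.mono fun s hs => hs.deriv)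
  have hgmin : IsLocalMin g 0 := by
    have h1 : ∀ᶠ s : ℝ in 𝓝 0, u x ≤ u (x + s • v) := hlim.eventually h
    filter_upwards [h1] with s hs
    rw [hg]
    simpa using hs
  have hcg : ContinuousAt g 0 := hd.self_of_nhds.continuousAt
  -- Otherwise the minimum would also be a maximum, and `g` would be locally constant.
  by_contra! hneg
  have hmax : IsLocalMax g 0 :=
    isLocalMax_of_deriv_deriv_neg (hdd.deriv.symm ▸ hneg) hgmin.deriv_eq_zero hcg
  have hconst : g =ᶠ[𝓝 0] fun _ => g 0 := by
    filter_upwards [hgmin, hmax] with s h1 h2 using le_antisymm h2 h1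
  have h0 : deriv (deriv g) 0 = 0 := by
    rw [hconst.deriv.deriv_eq]
    simp
  rw [hdd.deriv] at h0
  exact hneg.ne h0

/-- At a minimum over the past, the time derivative is nonpositive. -/
theorem nonpos_of_hasDerivWithinAt_of_isMinOn {w : ℝ → ℝ} {d a τ : ℝ} (haτ : a < τ)
    (hd : HasDerivWithinAt w d (Set.Icc a τ) τ) (hmin : IsMinOn w (Set.Icc a τ) τ) : d ≤ 0 := by
  have h1 : a - τ ∈ posTangentConeAt (Set.Icc a τ) τ := by
    refine mem_posTangentConeAt_of_segment_subset ?_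
    rw [add_sub_cancel, segment_symm, segment_eq_Icc haτ.le]
  have h2 := hmin.localize.hasFDerivWithinAt_nonneg hd.hasFDerivWithinAt h1
  simp only [ContinuousLinearMap.toSpanSingleton_apply, smul_eq_mul] at h2
  nlinarith

variable {n : ℕ} {M L : Type*} [TopologicalSpace M] [ChartedSpace (Euc (2 * n)) M]
  [IsManifold (𝓡 (2 * n)) ∞ M] [TopologicalSpace L] [ChartedSpace (Euc n) L]
  {K : FlatKahlerSplitting n M} {T : EReal} {F : ℝ → L → M}

theorem IsFlowModel.laplaceBeltrami_nonneg {φ : OpenPartialHomeomorph L (Euc n)}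
    {ψ : OpenPartialHomeomorph M (Euc (2 * n))} {N : ModelSplitting n} {I : Set ℝ}
    {U : Set (Euc n)} {t : ℝ} {x : Euc n} (h : IsFlowModel K F φ ψ N I U) (ht : t ∈ I)
    (hx : x ∈ U) (hA : N.IsTwoConvexMap (fderiv ℝ (localMap φ ψ (F t)) x))
    (hmin : ∀ p, logDetS2 K (F t) (φ.symm x) ≤ logDetS2 K (F t) p) :
    0 ≤ laplaceBeltrami K (F t) φ (logDetS2 K (F t)) (φ.symm x) := by
  obtain ⟨E, a, lam, hE⟩ := h.exists_isAdapted ht hx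
  have cf := h.contDiffAt ht hx
  have hu : ContDiffAt ℝ ∞ (fun y => logPullbackDet N.S (fderiv ℝ (localMap φ ψ (F t)) y)) x :=
    (h.contDiffAt_logPullbackDet ht hx hA).comp x (cf.fderiv_right (by simp))
  have hloc : IsLocalMin (fun y => logPullbackDet N.S (fderiv ℝ (localMap φ ψ (F t)) y)) x := by
    filter_upwards [h.isOpen.mem_nhds hx] with y hy
    rw [← h.logDetS2_eq ht hx, ← h.logDetS2_eq ht hy]
    exact hmin _
  rw [h.laplaceBeltrami_eq ht hx, coordLaplacian_eq cf hu hE.frameMat_inner, hloc.fderiv_eq_zero,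
    zero_apply, sub_zero]
  exact Finset.sum_nonneg fun i _ => hloc.fderiv_fderiv_nonneg hu _

variable [IsManifold (𝓡 n) ∞ L]

theorem IsLagrangianMCF.continuousOn_logDetS2 (hF : IsLagrangianMCF K T F)
    (hgraph : ∀ t ∈ timeInterval T, IsGraphical K (F t)) {J : Set ℝ} (hJ : J ⊆ timeInterval T)
    (hp : ∀ t ∈ J, ∀ p, IsTwoConvexAt K (F t) p) :
    ContinuousOn (fun q : ℝ × L => logDetS2 K (F q.1) q.2) (J ×ˢ Set.univ) := fun q hq =>
  (hF.contMDiffWithinAt_logDetS2 hgraph (hJ hq.1) (hp q.1 hq.1 q.2)).continuousWithinAt.mono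
    (Set.prod_mono hJ subset_rfl)

/-- At a spatial minimum of `log det S^{[2]}`, this function has a nonnegative time derivative. -/
theorem IsLagrangianMCF.exists_hasDerivWithinAt_of_isMin (hn : 2 ≤ n) (hF : IsLagrangianMCF K T F)
    (hgraph : ∀ t ∈ timeInterval T, IsGraphical K (F t)) {t : ℝ} (ht : t ∈ timeInterval T) {p : L}
    (hp : IsTwoConvexAt K (F t) p) (hmin : ∀ q, logDetS2 K (F t) p ≤ logDetS2 K (F t) q) :
    ∃ d, 0 ≤ d ∧ HasDerivWithinAt (fun s => logDetS2 K (F s) p) d (timeInterval T) t := by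
  obtain ⟨ψ, hψ, hpψ⟩ := K.flat (F t p)
  obtain ⟨x, φ, hx, hφ, rfl⟩ : ∃ (x : Euc n) (φ : OpenPartialHomeomorph L (Euc n)),
      x ∈ φ.target ∧ φ ∈ IsManifold.maximalAtlas (𝓡 n) ∞ L ∧ φ.symm x = p :=
    ⟨_, chartAt (Euc n) p, mem_chart_target _ p, IsManifold.chart_mem_maximalAtlas p,
      (chartAt (Euc n) p).left_inv (mem_chart_source _ p)⟩
  obtain ⟨N, O, U, hO, htO, hpU, h⟩ :=
    hF.exists_isFlowModel hgraph ht ⟨hφ, φ.map_target hx⟩ hψ hpψ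
  rw [φ.right_inv hx] at hpU
  have hA := (h.isTwoConvexAt_iff ⟨ht, htO⟩ hpU).1 hp
  obtain ⟨e, a, lam, he⟩ := hF.exists_isAdaptedFrame hgraph ht (φ.symm x)
  obtain ⟨h1, h2⟩ := hF.evolution_logDetS2 hn hgraph ht hp he ⟨hφ, φ.map_target hx⟩ hψ hpψ
  have h3 := h.laplaceBeltrami_nonneg ⟨ht, htO⟩ hpU hA hmin
  have h4 : 0 ≤ ∑ i, ∑ j, ∑ k, hComp K φ ψ (F t) (φ.symm x) e i j k ^ 2 :=
    Finset.sum_nonneg fun i _ => Finset.sum_nonneg fun j _ => Finset.sum_nonneg fun k _ =>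
      sq_nonneg _
  refine ⟨derivWithin (fun s => logDetS2 K (F s) (φ.symm x)) (timeInterval T) t, by linarith, ?_⟩
  exact ((hasDerivWithinAt_inter (hO.mem_nhds htO)).1
    (h.hasDerivWithinAt_logDetS2 ⟨ht, htO⟩ hpU hA)).differentiableWithinAt.hasDerivWithinAt

/-- The maximum principle: the minimum of `log det S^{[2]}` does not decrease, as long as the flow
is two-convex. -/
theorem IsLagrangianMCF.exists_logDetS2_le [CompactSpace L] (hn : 2 ≤ n)
    (hF : IsLagrangianMCF K T F) (hgraph : ∀ t ∈ timeInterval T, IsGraphical K (F t)) {a b : ℝ}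
    (hab : a ≤ b) (hJ : Set.Icc a b ⊆ timeInterval T)
    (hp : ∀ t ∈ Set.Icc a b, ∀ p, IsTwoConvexAt K (F t) p) {m : ℝ}
    (hm : ∀ q, m ≤ logDetS2 K (F a) q) (p : L) : m ≤ logDetS2 K (F b) p := by
  have hcont := hF.continuousOn_logDetS2 hgraph hJ hp
  have key : ∀ ε > 0, m ≤ logDetS2 K (F b) p + ε * (b - a) := by
    intro ε hε
    -- The perturbation makes the time derivative at a minimum strictly positive.
    obtain ⟨⟨τ, q⟩, ⟨hτ, -⟩, hmin⟩ := (isCompact_Icc.prod isCompact_univ).exists_isMinOn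
      (s := Set.Icc a b ×ˢ (Set.univ : Set L)) ⟨(b, p), ⟨⟨hab, le_rfl⟩, trivial⟩⟩
      (f := fun z : ℝ × L => logDetS2 K (F z.1) z.2 + ε * (z.1 - a))
      (hcont.add (by fun_prop))
    have hmin' : ∀ s ∈ Set.Icc a b, ∀ r, logDetS2 K (F τ) q + ε * (τ - a) ≤
        logDetS2 K (F s) r + ε * (s - a) := fun s hs r => hmin (a := (s, r)) ⟨hs, trivial⟩
    rcases hτ.1.eq_or_lt with rfl | haτ
    · have := hmin' b ⟨hab, le_rfl⟩ p
      rw [sub_self, mul_zero, add_zero] at this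
      exact (hm q).trans this
    · exfalso
      obtain ⟨d, hd0, hd⟩ := hF.exists_hasDerivWithinAt_of_isMin hn hgraph (hJ hτ) (hp τ hτ q)
        fun r => by simpa using hmin' τ hτ r
      have hsub : Set.Icc a τ ⊆ Set.Icc a b := Set.Icc_subset_Icc le_rfl hτ.2
      have hd' := (hd.mono (hsub.trans hJ)).add
        (((hasDerivWithinAt_id τ (Set.Icc a τ)).sub_const a).const_mul ε)
      have := nonpos_of_hasDerivWithinAt_of_isMinOn haτ hd' fun s hs => hmin' s (hsub hs) q
      linarith
  have hlim : Tendsto (fun ε : ℝ => logDetS2 K (F b) p + ε * (b - a)) (𝓝[>] 0)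
      (𝓝 (logDetS2 K (F b) p + 0 * (b - a))) :=
    ((by fun_prop : Continuous fun ε : ℝ => logDetS2 K (F b) p + ε * (b - a)).tendsto 0).mono_left
      nhdsWithin_le_nhds
  rw [zero_mul, add_zero] at hlim
  exact ge_of_tendsto hlim (eventually_mem_nhdsWithin.mono fun ε hε => key ε hε)

end MaximumPrinciple

/-! ### Preservation of two-convexity -/

section Preservation

open Filter Topology

variable {n : ℕ} {M L : Type*} [TopologicalSpace M] [ChartedSpace (Euc (2 * n)) M]
  [IsManifold (𝓡 (2 * n)) ∞ M] [TopologicalSpace L] [ChartedSpace (Euc n) L]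
  [IsManifold (𝓡 n) ∞ L] {K : FlatKahlerSplitting n M} {T : EReal} {F : ℝ → L → M}

theorem IsLagrangianMCF.eventually_isTwoConvexAt (hF : IsLagrangianMCF K T F)
    (hgraph : ∀ t ∈ timeInterval T, IsGraphical K (F t)) {t : ℝ} (ht : t ∈ timeInterval T) {p : L}
    (hp : IsTwoConvexAt K (F t) p) :
    ∀ᶠ z : ℝ × L in 𝓝 (t, p), z.1 ∈ timeInterval T → IsTwoConvexAt K (F z.1) z.2 := by
  obtain ⟨ψ, N, O, U, hO, htO, hpU, h⟩ := hF.exists_isFlowModel_chartAt hgraph ht p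
  set φ := chartAt (Euc n) p with hφ
  have hps : p ∈ φ.source := mem_chart_source _ p
  have hA : N.IsTwoConvexMap (fderiv ℝ (localMap φ ψ (F t)) (φ p)) := by
    rw [← h.isTwoConvexAt_iff ⟨ht, htO⟩ hpU, φ.left_inv hps]
    exact hp
  have h1 : ∀ᶠ z : ℝ × Euc n in 𝓝[(timeInterval T ∩ O) ×ˢ U] (t, φ p),
      N.IsTwoConvexMap (fderiv ℝ (localMap φ ψ (F z.1)) z.2) :=
    (h.contDiffOn_fderiv.continuousOn (t, φ p) ⟨⟨ht, htO⟩, hpU⟩).eventually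
      (ModelSplitting.isOpen_isTwoConvexMap.mem_nhds hA)
  have h2 : Tendsto (fun z : ℝ × L => (z.1, φ z.2)) (𝓝 (t, p)) (𝓝 (t, φ p)) :=
    continuousAt_fst.prodMk ((φ.continuousAt hps).comp (f := Prod.snd) (x := (t, p))
      continuousAt_snd)
  have h3 : ∀ᶠ z : ℝ × L in 𝓝 (t, p), z.1 ∈ O ∧ z.2 ∈ φ.source ∩ φ ⁻¹' U :=
    (hO.prod (φ.isOpen_inter_preimage h.isOpen)).mem_nhds ⟨htO, hps, hpU⟩
  filter_upwards [h2.eventually (eventually_nhdsWithin_iff.1 h1), h3] with z hz hz' hzT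
  have hzI : z.1 ∈ timeInterval T ∩ O := ⟨hzT, hz'.1⟩
  rw [← φ.left_inv hz'.2.1, h.isTwoConvexAt_iff hzI hz'.2.2]
  exact hz ⟨hzI, hz'.2.2⟩

/-- Two-convexity on a compact manifold is an open condition in time. -/
theorem IsLagrangianMCF.eventually_forall_isTwoConvexAt [CompactSpace L]
    (hF : IsLagrangianMCF K T F) (hgraph : ∀ t ∈ timeInterval T, IsGraphical K (F t)) {t : ℝ}
    (ht : t ∈ timeInterval T) (hp : ∀ p, IsTwoConvexAt K (F t) p) :
    ∀ᶠ s in 𝓝 t, s ∈ timeInterval T → ∀ p, IsTwoConvexAt K (F s) p := by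
  have h := isCompact_univ.eventually_forall_of_forall_eventually (x₀ := t)
    (P := fun s p => s ∈ timeInterval T → IsTwoConvexAt K (F s) p)
    fun p (_ : p ∈ (Set.univ : Set L)) => hF.eventually_isTwoConvexAt hgraph ht (hp p)
  exact h.mono fun s hs hsT p => hs p trivial hsT

/-- A lower bound for `log det S^{[2]}` keeps two-convexity in the limit of increasing times. -/
theorem IsLagrangianMCF.isTwoConvexAt_of_limit (hF : IsLagrangianMCF K T F)
    (hgraph : ∀ t ∈ timeInterval T, IsGraphical K (F t)) {a b : ℝ} (hab : a < b)
    (ha : a ∈ timeInterval T) (hb : b ∈ timeInterval T) {p : L}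
    (hp : ∀ t ∈ Set.Ico a b, IsTwoConvexAt K (F t) p) {m : ℝ}
    (hm : ∀ t ∈ Set.Ico a b, m ≤ logDetS2 K (F t) p) : IsTwoConvexAt K (F b) p := by
  obtain ⟨ψ, N, O, U, hO, hbO, hpU, h⟩ := hF.exists_isFlowModel_chartAt hgraph hb p
  set φ := chartAt (Euc n) p with hφ
  have hps : p ∈ φ.source := mem_chart_source _ p
  obtain ⟨E, c, lam, hE⟩ := h.exists_isAdapted ⟨hb, hbO⟩ hpU
  have : (𝓝[<] b).NeBot := inferInstance
  have hev : ∀ᶠ s in 𝓝[<] b, s ∈ Set.Ico a b ∧ s ∈ timeInterval T ∩ O := by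
    filter_upwards [Ico_mem_nhdsLT hab, mem_nhdsWithin_of_mem_nhds (hO.mem_nhds hbO)] with s h1 h2
    exact ⟨h1, Icc_subset_timeInterval ha hb (Set.Ico_subset_Icc_self h1), h2⟩
  set A : ℝ → Euc n →L[ℝ] Euc (2 * n) := fun s => fderiv ℝ (localMap φ ψ (F s)) (φ p) with hA
  have hlim : Tendsto A (𝓝[<] b) (𝓝 (A b)) := by
    have h1 : ContinuousWithinAt A (timeInterval T ∩ O) b :=
      (h.contDiffOn_fderiv.continuousOn (b, φ p) ⟨⟨hb, hbO⟩, hpU⟩).comp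
        (f := fun s : ℝ => (s, φ p)) (by fun_prop) fun s hs => ⟨hs, hpU⟩
    exact h1.tendsto.mono_left (le_inf nhdsWithin_le_nhds
      (le_principal_iff.2 (hev.mono fun s hs => hs.2)))
  have hconv : ∀ᶠ s in 𝓝[<] b, N.IsTwoConvexMap (A s) ∧ Real.exp m ≤ pullbackDet N.S (A s) := by
    filter_upwards [hev] with s hs
    have h1 : IsTwoConvexAt K (F s) (φ.symm (φ p)) := (φ.left_inv hps).symm ▸ hp s hs.1
    have h2 := (h.isTwoConvexAt_iff hs.2 hpU).1 h1
    obtain ⟨E', c', lam', hE'⟩ := h.exists_isAdapted hs.2 hpU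
    have h3 := hE'.pullbackDet_pos (hE'.twoConvexAngles h2)
    refine ⟨h2, ?_⟩
    rw [← Real.le_log_iff_exp_le h3]
    have h4 := hm s hs.1
    rwa [← φ.left_inv hps, h.logDetS2_eq hs.2 hpU] at h4
  have hl : TwoConvexAngles lam := by
    refine hE.twoConvexAngles_of_tendsto hlim (hconv.mono fun s hs => hs.1) ?_
    have h1 : ContinuousAt (pullbackDet N.S) (A b) :=
      (contDiffAt_pullbackDet N.S (isUnit_det_gram hE.frameMat_inner)).continuousAt
    have h2 : Real.exp m ≤ pullbackDet N.S (A b) :=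
      ge_of_tendsto (h1.tendsto.comp hlim) (hconv.mono fun s hs => hs.2)
    exact ((Real.exp_pos m).trans_le h2).ne'
  rw [← φ.left_inv hps, h.isTwoConvexAt_iff ⟨hb, hbO⟩ hpU]
  exact hE.isTwoConvexMap hl

theorem IsLagrangianMCF.exists_isLeast [CompactSpace L] [Nonempty L]
    (hF : IsLagrangianMCF K T F) (hgraph : ∀ t ∈ timeInterval T, IsGraphical K (F t)) {t : ℝ}
    (ht : t ∈ timeInterval T) (hp : ∀ p, IsTwoConvexAt K (F t) p) :
    ∃ p, ∀ q, logDetS2 K (F t) p ≤ logDetS2 K (F t) q := by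
  have h1 := hF.continuousOn_logDetS2 hgraph (J := {t}) (by simpa using ht)
    (by rintro _ rfl; exact hp)
  have h2 : Continuous fun q : L => logDetS2 K (F t) q := by
    rw [← continuousOn_univ]
    exact h1.comp (f := fun q : L => (t, q)) (by fun_prop) fun q _ => ⟨rfl, trivial⟩
  obtain ⟨p, -, hmin⟩ := isCompact_univ.exists_isMinOn Set.univ_nonempty h2.continuousOn
  exact ⟨p, fun q => hmin (Set.mem_univ q)⟩

/-- Two-convexity is preserved: at the first time at which it fails, the lower bound for
`log det S^{[2]}` given by the maximum principle is contradicted. -/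
theorem IsLagrangianMCF.isTwoConvexAt_of_le [CompactSpace L] (hn : 2 ≤ n)
    (hF : IsLagrangianMCF K T F) (hgraph : ∀ t ∈ timeInterval T, IsGraphical K (F t)) {t₀ : ℝ}
    (ht₀ : t₀ ∈ timeInterval T) (h0 : ∀ p, IsTwoConvexAt K (F t₀) p) {t : ℝ}
    (ht : t ∈ timeInterval T) (htt : t₀ ≤ t) (p : L) : IsTwoConvexAt K (F t) p := by
  by_contra hbad
  have : Nonempty L := ⟨p⟩
  set B : Set ℝ := {r | r ∈ Set.Icc t₀ t ∧ ∃ q, ¬ IsTwoConvexAt K (F r) q} with hB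
  have hBne : B.Nonempty := ⟨t, ⟨htt, le_rfl⟩, p, hbad⟩
  have hBbdd : BddBelow B := ⟨t₀, fun r hr => hr.1.1⟩
  have hc : sInf B ∈ Set.Icc t₀ t :=
    ⟨le_csInf hBne fun r hr => hr.1.1, csInf_le hBbdd ⟨⟨htt, le_rfl⟩, p, hbad⟩⟩
  have hcT := Icc_subset_timeInterval ht₀ ht hc
  have hgood : ∀ r ∈ Set.Ico t₀ (sInf B), ∀ q, IsTwoConvexAt K (F r) q := by
    intro r hr q
    by_contra hq
    exact notMem_of_lt_csInf hr.2 hBbdd ⟨⟨hr.1, hr.2.le.trans hc.2⟩, q, hq⟩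
  have hcgood : ∀ q, IsTwoConvexAt K (F (sInf B)) q := by
    rcases hc.1.eq_or_lt with heq | hlt
    · rwa [← heq]
    · intro q
      obtain ⟨p₀, hp₀⟩ := hF.exists_isLeast hgraph ht₀ h0
      refine hF.isTwoConvexAt_of_limit hgraph hlt ht₀ hcT (fun r hr => hgood r hr q)
        (m := logDetS2 K (F t₀) p₀) fun r hr => ?_
      have hrT := Icc_subset_timeInterval ht₀ hcT (Set.Ico_subset_Icc_self hr)
      exact hF.exists_logDetS2_le hn hgraph hr.1 (Icc_subset_timeInterval ht₀ hrT)
        (fun s hs => hgood s ⟨hs.1, hs.2.trans_lt hr.2⟩) hp₀ q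
  obtain ⟨δ, hδ, hball⟩ := Metric.eventually_nhds_iff.1
    (hF.eventually_forall_isTwoConvexAt hgraph hcT hcgood)
  obtain ⟨r, hr, hrδ⟩ := exists_lt_of_csInf_lt hBne (lt_add_of_pos_right (sInf B) hδ)
  obtain ⟨q, hq⟩ := hr.2
  refine hq (hball ?_ (Icc_subset_timeInterval ht₀ ht hr.1) q)
  rw [Real.dist_eq, abs_of_nonneg (sub_nonneg.2 (csInf_le hBbdd hr))]
  linarith

end Preservation
end

theorem proposition2p1 {n : ℕ} (hn : 2 ≤ n) {M L : Type*}
    [TopologicalSpace M] [ChartedSpace (Euc (2 * n)) M] [IsManifold (𝓡 (2 * n)) ∞ M]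
    [TopologicalSpace L] [ChartedSpace (Euc n) L] [IsManifold (𝓡 n) ∞ L]
    (K : FlatKahlerSplitting n M) (T : EReal) (F : ℝ → L → M)
    (hF : IsLagrangianMCF K T F) (hgraph : ∀ t ∈ timeInterval T, IsGraphical K (F t)) :
    ((∀ t ∈ timeInterval T, IsTwoConvex K (F t)) →
      ContMDiffOn (𝓘(ℝ, ℝ).prod (𝓡 n)) 𝓘(ℝ, ℝ) ∞
        (fun q : ℝ × L => logDetS2 K (F q.1) q.2) (timeInterval T ×ˢ Set.univ) ∧
      ∀ t ∈ timeInterval T, ∀ p : L,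
        (∃ (e : Fin n → Tan n p) (a : Fin n → Tan (2 * n) (F t p)) (lam : Fin n → ℝ),
          IsAdaptedFrame K (F t) p e a lam) ∧
        ∀ (e : Fin n → Tan n p) (a : Fin n → Tan (2 * n) (F t p)) (lam : Fin n → ℝ),
          IsAdaptedFrame K (F t) p e a lam →
          logDetS2 K (F t) p =
            Real.log (∏ i, ∏ j ∈ Finset.Ioi i,
              (lam i + lam j) * (1 + lam i * lam j) / ((1 + lam i ^ 2) * (1 + lam j ^ 2))) ∧
          ∀ (φ : OpenPartialHomeomorph L (Euc n)) (ψ : OpenPartialHomeomorph M (Euc (2 * n))),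
            IsChartAround φ p → IsFlatChart K.g ψ → F t p ∈ ψ.source →
            let h : Fin n → Fin n → Fin n → ℝ := hComp K φ ψ (F t) p e
            let Q : ℝ := ∑ i, ∑ j ∈ Finset.Ioi i, ∑ k,
              (4 * h k i j ^ 2
                + (1 + lam i ^ 2) * (1 + lam j ^ 2) / (lam i + lam j) ^ 2
                  * (h k i i + h k j j) ^ 2
                + (1 + lam i ^ 2) * (1 + lam j ^ 2) / (1 + lam i * lam j) ^ 2
                  * (h k i i - h k j j) ^ 2)
            let normASq : ℝ := ∑ i, ∑ j, ∑ k, h i j k ^ 2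
            Q ≤ derivWithin (fun s => logDetS2 K (F s) p) (timeInterval T) t
                - laplaceBeltrami K (F t) φ (logDetS2 K (F t)) p ∧
              2 * normASq ≤ Q ∧ 0 ≤ 2 * normASq) ∧
    (CompactSpace L → ∀ t₀ ∈ timeInterval T, IsTwoConvex K (F t₀) →
      (∀ t ∈ timeInterval T, t₀ ≤ t → IsTwoConvex K (F t)) ∧
      (Nonempty L → ∃ m : ℝ → ℝ,
        (∀ t ∈ timeInterval T, t₀ ≤ t →
          IsLeast (Set.range fun p : L => logDetS2 K (F t) p) (m t)) ∧
        MonotoneOn m (timeInterval T ∩ Set.Ici t₀))) := by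
  refine ⟨fun h2 => ⟨fun q hq => ?_, fun t ht p => ⟨hF.exists_isAdaptedFrame hgraph ht p,
    fun e a lam he => ⟨hF.logDetS2_eq_log_prod hgraph ht he, fun φ ψ hφ hψ hpψ => ?_⟩⟩⟩,
    fun hL t₀ ht₀ h0 => ?_⟩
  · exact hF.contMDiffWithinAt_logDetS2 hgraph hq.1 ((h2 q.1 hq.1).2 q.2)
  · intro h Q normASq
    have hQ : Q = ∑ k, ∑ i, ∑ j ∈ Finset.Ioi i, evolutionQuadratic lam (h k) i j := by
      rw [Finset.sum_comm]
      exact Finset.sum_congr rfl fun i _ => Finset.sum_comm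
    obtain ⟨h3, h4⟩ := hF.evolution_logDetS2 hn hgraph ht ((h2 t ht).2 p) he hφ hψ hpψ
    rw [hQ]
    refine ⟨h3, h4, ?_⟩
    positivity
  · have hconv : ∀ t ∈ timeInterval T, t₀ ≤ t → ∀ p, IsTwoConvexAt K (F t) p :=
      fun t ht htt => hF.isTwoConvexAt_of_le hn hgraph ht₀ h0.2 ht htt
    refine ⟨fun t ht htt => ⟨hgraph t ht, hconv t ht htt⟩, fun _ =>
      ⟨fun t => sInf (Set.range fun p : L => logDetS2 K (F t) p), ?_, ?_⟩⟩
    · intro t ht htt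
      obtain ⟨p, hp⟩ := hF.exists_isLeast hgraph ht (hconv t ht htt)
      have hleast : IsLeast (Set.range fun p : L => logDetS2 K (F t) p) (logDetS2 K (F t) p) :=
        ⟨⟨p, rfl⟩, Set.forall_mem_range.2 hp⟩
      change IsLeast _ (sInf _)
      rwa [hleast.csInf_eq]
    · intro s hs t ht hst
      obtain ⟨p, hp⟩ := hF.exists_isLeast hgraph hs.1 (hconv s hs.1 hs.2)
      refine le_csInf (Set.range_nonempty _) (Set.forall_mem_range.2 fun q => ?_)
      refine (csInf_le ⟨_, Set.forall_mem_range.2 hp⟩ ⟨p, rfl⟩).trans ?_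
      exact hF.exists_logDetS2_le hn hgraph hst (Icc_subset_timeInterval hs.1 ht.1)
        (fun r hr => hconv r (Icc_subset_timeInterval hs.1 ht.1 hr) (hs.2.trans hr.1)) hp q
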